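/- **Stochastic block model.** Let $2\le K\le n$, let $G=(G_1,\dots,G_K)$ be a partition of $\{1,\dots,n\}$ into $K$ non-empty groups, $m_k=|G_k|$, $m=\min_k m_k$, and let $P\in[0,1]^{K\times K}$ be symmetric (no assortativity is assumed). The observation is a random undirected graph on $\{1,\dots,n\}$ without loops, whose edges are independent, with an edge between $a\in G_k$ and $b\in G_j$, $a\neq b$, present with probability $P_{jk}$. Let $\mathbf X\in\{0,1\}^{n\times n}$ be its adjacency matrix. Put $$\Delta^2=\min_{j\neq k}\sum_{\ell=1}^K m_\ell\,(P_{k\ell}-P_{j\ell})^2 .$$ **Procedure.** For $\alpha>0$ let $\mathcal C_\alpha$ be the set of positive semidefinite $B\in\mathbb R^{n\times n}$ with $\mathrm{Tr}(B)=K$, $B\mathbf 1=\mathbf 1$ and $0\le B_{ab}\le\alpha$ for all $a,b$, and let $$\widehat B\in\operatorname*{argmax}_{B\in\mathcal C_\alpha}\langle \mathbf X\mathbf X^T,B\rangle,\qquad \langle M,N\rangle=\sum_{a,b}M_{ab}N_{ab}.$$ Let $\mathcal A_K$ be the set of matrices $A\in\{0,1\}^{n\times K}$ of the form $A_{ik}=\mathbf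 1_{i\in H_k}$ for a partition $(H_1,\dots,H_K)$ of $\{1,\dots,n\}$ into $K$ non-empty groups, and let $|M|_1=\sum_{a,b}|M_{ab}|$. Let $(\widehat A,\widehat M)$ be any pair with $\widehat A\in\mathcal A_K$, $\widehat M\in\mathbb R^{K\times n}$, $\mathrm{Rows}(\widehat M)\subset\mathrm{Rows}(\widehat B)$ and $$|\widehat A\widehat M-\widehat B|_1\le 7\min_{A\in\mathcal A_K,\ \mathrm{Rows}(M)\subset\mathrm{Rows}(\widehat B)}|AM-\widehat B|_1 ,$$ and set $\widehat G_k=\{i:\widehat A_{ik}=1\}$. The misclassification proportion is $$err(\widehat G,G)=\min_{\pi\in\mathcal S_K}\frac1{2n}\sum_{k=1}^K|G_k\bigtriangleup\widehat G_{\pi(k)}| .$$ **Theorem.** There exist numerical constants $c,c',c''>0$ such that the following holds for all $n,K,G,P$ as above and all real $L,\alpha$ with $$\max_{j,k}|P_{jk}|\le L,\qquad \frac1m\le L\le\frac1{\log n},\qquad \frac1m\le\alpha\le\frac{K^3}{n}e^{4nL}.$$ If $s^2:=\Delta^2/L$ satisfies $s^2\ge c''\,n/m$, then, with probability at least $1-c/n^2$,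 every partition $\widehat G$ obtained by the procedure above (whatever maximiser $\widehat B$ and whatever $7$-approximate pair $(\widehat A,\widehat M)$ are used) satisfies $$err(\widehat G,G)\le e^{-c's^2}.$$ -/

import Mathlib

noncomputable section

namespace SBMClustering

open MeasureTheory ProbabilityTheory

/-- The `k`-th group of the partition of `{1, …, n}` described by the labelling `z`. Partitions into
`K` non-empty groups are the labellings `z : Fin n → Fin K` that are surjective. -/
def group {n K : ℕ} (z : Fin n → Fin K) (k : Fin K) : Finset (Fin n) :=
  Finset.univ.filter fun a => z a = k

/-- The size `m` of the smallest group. -/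
def minGroupSize {n K : ℕ} (z : Fin n → Fin K) : ℕ :=
  ⨅ k : Fin K, (group z k).card

/-- The partition matrix `A` with `A i k = 1` if `i` lies in group `k`, and `0` otherwise. -/
def partitionMatrix {n K : ℕ} (z : Fin n → Fin K) : Matrix (Fin n) (Fin K) ℝ :=
  Matrix.of fun i k => if i ∈ group z k then 1 else 0

/-- The proportion of misclassified points, minimised over relabellings of the groups. -/
def misclassification {n K : ℕ} (zhat z : Fin n → Fin K) : ℝ :=
  ⨅ π : Equiv.Perm (Fin K),
    1 / (2 * (n : ℝ)) * ∑ k, ((symmDiff (group z k) (group zhat (π k))).card : ℝ)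

/-- The entrywise `ℓ¹` norm. -/
def l1Norm {ι κ : Type*} [Fintype ι] [Fintype κ] (M : Matrix ι κ ℝ) : ℝ :=
  ∑ i, ∑ j, |M i j|

/-- The canonical inner product of two matrices. -/
def frobInner {ι κ : Type*} [Fintype ι] [Fintype κ] (M N : Matrix ι κ ℝ) : ℝ :=
  ∑ i, ∑ j, M i j * N i j

/-- The feasible set of the box-constrained relaxed `K`-means program. -/
def feasibleSet (n K : ℕ) (α : ℝ) : Set (Matrix (Fin n) (Fin n) ℝ) :=
  {B | B.PosSemidef ∧ B.trace = (K : ℝ) ∧ B.mulVec 1 = 1 ∧ ∀ a b, 0 ≤ B a b ∧ B a b ≤ α}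

/-- `B` maximises `⟨X Xᵀ, ·⟩` over the feasible set. -/
def IsRelaxedKMeans {n : ℕ} (K : ℕ) (α : ℝ) (X B : Matrix (Fin n) (Fin n) ℝ) : Prop :=
  B ∈ feasibleSet n K α ∧ IsMaxOn (frobInner (X * X.transpose)) (feasibleSet n K α) B

/-- Every row of `M` is a row of `B`. -/
def RowsSubset {n K : ℕ} (M : Matrix (Fin K) (Fin n) ℝ) (B : Matrix (Fin n) (Fin n) ℝ) : Prop :=
  Set.range M.row ⊆ Set.range B.row

/-- `(partitionMatrix zhat, M)` is a `ρ`-approximate `K`-medoids on the rows of `B`. -/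
def IsApproxKMedoids {n K : ℕ} (ρ : ℝ) (B : Matrix (Fin n) (Fin n) ℝ) (zhat : Fin n → Fin K)
    (M : Matrix (Fin K) (Fin n) ℝ) : Prop :=
  Function.Surjective zhat ∧ RowsSubset M B ∧
    ∀ (z' : Fin n → Fin K) (M' : Matrix (Fin K) (Fin n) ℝ),
      Function.Surjective z' → RowsSubset M' B →
        l1Norm (partitionMatrix zhat * M - B) ≤ ρ * l1Norm (partitionMatrix z' * M' - B)

/-- `zhat` is a partition that the procedure may output on the data `X`: it comes from some
`7`-approximate `K`-medoids on the rows of some maximiser of the box-constrained program. -/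
def IsClusteringOutput {n K : ℕ} (α : ℝ) (X : Matrix (Fin n) (Fin n) ℝ)
    (zhat : Fin n → Fin K) : Prop :=
  ∃ B M, IsRelaxedKMeans K α X B ∧ IsApproxKMedoids 7 B zhat M

/-- The squared signal strength `Δ² = min_{j ≠ k} ∑_ℓ m_ℓ (P_{kℓ} - P_{jℓ})²`. -/
def signalSq {n K : ℕ} (z : Fin n → Fin K) (P : Matrix (Fin K) (Fin K) ℝ) : ℝ :=
  ⨅ q : {q : Fin K × Fin K // q.1 ≠ q.2},
    ∑ l, ((group z l).card : ℝ) * (P q.1.2 l - P q.1.1 l) ^ 2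

open Classical in
/-- The adjacency matrix of a graph. -/
def adjacency {n : ℕ} (g : SimpleGraph (Fin n)) : Matrix (Fin n) (Fin n) ℝ :=
  g.adjMatrix ℝ

/-- The random graph `g` follows the stochastic block model with partition `z` and connection
probabilities `P`. -/
structure IsSBM {Ω : Type*} [MeasurableSpace Ω] (μ : Measure Ω) {n K : ℕ}
    (g : Ω → SimpleGraph (Fin n)) (z : Fin n → Fin K) (P : Matrix (Fin K) (Fin K) ℝ) : Prop where
  surjective : Function.Surjective z
  symm : P.IsSymm
  mem_Icc : ∀ j k, P j k ∈ Set.Icc (0 : ℝ) 1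
  measurableSet_adj : ∀ a b, MeasurableSet {ω | (g ω).Adj a b}
  prob_adj : ∀ a b, a ≠ b → μ.real {ω | (g ω).Adj a b} = P (z a) (z b)
  indep : iIndepSet
    (fun e : {e : Fin n × Fin n // e.1 < e.2} => {ω | (g ω).Adj e.1.1 e.1.2}) μ

end SBMClustering

end

/-! Write B* for `blockMean z`, the projection that averages over the true groups, W for `deviation`
(adjacency minus probabilities), and δ for `crossMass`, the mass that a maximiser B puts on pairs of
vertices from different groups. The aim is to show that δ is exponentially small; the rounding step
is then deterministic.

B* is feasible, so B does at least as well as B*. Expanding this comparison column by column around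
the group averages (`quad_sub_blockMean`, `IsRelaxedKMeans.basic_ineq`) leaves two kinds of terms. A
pair (a,b) across groups, weighted by B_ab, contributes its squared separation minus a correlation
of row b of W with the difference of the two group means. What remains is a quadratic form of W
against the compression (1-B*)B(1-B*). Since separations are at least Δ², it suffices to bound the
correlations and the compressed form.

The compressed form. The compression is positive semidefinite, has trace at most δ/m and entries at
most 2α. On vertices of degree O(nL), W has operator norm O(√(nL)) by the Kahn-Szemerédi argument:
light pairs by a union bound over integer vectors, heavy pairs by a discrepancy property
(`sum_heavy_le`, `sum_sq_deviation_mul_le`). This costs nLδ/m, which the assumption Δ² ≥ c'' nL/m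
absorbs. Rows and columns of larger degree are paid for by the entrywise bound: their squared
degrees sum to O(n e^{-7nL}) (`sum_sq_highDegree_le`), and the factor e^{-7nL} beats the allowed
growth e^{4nL} of α.

The correlations. Bounds uniform over sets T of vertices cost the entropy t log(en/t), t = |T|, in
Bennett's inequality (`prob_sum_noise_ge_le`). For T inside one group, the sum of the correlations
over T is at most of order L·entropy(T), plus |T| times a small fraction of the separation
(`GoodEvent.sum_corr_le`). Taking for T the vertices whose correlation exceeds 1/32 of the
separation D, the total excess is at most of order L (t log(en/t) - tD/(CL)) ≤ L n e^{-D/(CL)}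
(`entropy_sub_mul_le`). This is where the exponential rate arises. As columns of B sum to 1, the
excess bounds the B-weighted sum too.

The delicate part of a correlation is the product of two rows of noise. For a set of rows U disjoint
from T, splitting the columns into T and its complement makes the form linear in edges on which its
coefficients do not depend (`prob_bilinear_part_le`). For a vertex's own group, the squared diagonal
terms have a favourable sign, and the others are averaged over the bipartitions given by Walsh
characters of the binary digits; there are only O(n) of them, so the union bound survives.

Together these give δ/m ≤ K³ e^{-cs²} up to a constant (`GoodEvent.crossMass_div_le`). The squared
ℓ¹ distance of B to B* is at most 2n²δ/m, the approximate medoids lose a factor 15, and distinct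
rows of B* are at ℓ¹ distance at least 2, so the misclassified proportion is at most 15|B-B*|_1/n.
Since K ≤ n/m ≤ s²/c'', the polynomial prefactor is absorbed in the exponential. -/

noncomputable section

namespace SBMClustering

open MeasureTheory ProbabilityTheory

/-! ### Products of Bernoulli weights -/

section Bernoulli

set_option linter.unusedSectionVars false

variable {ι : Type*} [Fintype ι] [DecidableEq ι]

/-- The Bernoulli weight of a Boolean. -/
def bernWeight (q : ℝ) (b : Bool) : ℝ := if b then q else 1 - q

/-- The product Bernoulli weight of a configuration. -/
def configWeight (p : ι → ℝ) (x : ι → Bool) : ℝ := ∏ e, bernWeight (p e) (x e)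

/-- The expectation under the product Bernoulli law. -/
def expect (p : ι → ℝ) (f : (ι → Bool) → ℝ) : ℝ := ∑ x, configWeight p x * f x

open Classical in
/-- The probability of a predicate under the product Bernoulli law. -/
def prob (p : ι → ℝ) (A : (ι → Bool) → Prop) : ℝ := expect p fun x => if A x then 1 else 0

lemma configWeight_nonneg {p : ι → ℝ} (hp : ∀ e, 0 ≤ p e ∧ p e ≤ 1) (x : ι → Bool) :
    0 ≤ configWeight p x := by
  refine Finset.prod_nonneg fun e _ => ?_
  unfold bernWeight
  split_ifs <;> linarith [(hp e).1, (hp e).2]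

lemma expect_mono {p : ι → ℝ} (hp : ∀ e, 0 ≤ p e ∧ p e ≤ 1) {f g : (ι → Bool) → ℝ}
    (h : ∀ x, f x ≤ g x) : expect p f ≤ expect p g :=
  Finset.sum_le_sum fun x _ => mul_le_mul_of_nonneg_left (h x) (configWeight_nonneg hp x)

lemma expect_const_mul (p : ι → ℝ) (c : ℝ) (f : (ι → Bool) → ℝ) :
    expect p (fun x => c * f x) = c * expect p f := by
  simp only [expect, Finset.mul_sum]
  exact Finset.sum_congr rfl fun x _ => by ring

lemma expect_one (p : ι → ℝ) : expect p (fun _ => 1) = 1 := by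
  simp only [expect, mul_one, configWeight]
  have := Finset.prod_univ_sum (fun _ : ι => (Finset.univ : Finset Bool))
    (fun e b => bernWeight (p e) b)
  rw [Fintype.piFinset_univ] at this
  rw [← this]
  simp [bernWeight]

/-- Averaging over one coordinate does not change the expectation. -/
lemma expect_eq_expect_update (p : ι → ℝ) (e : ι) (f : (ι → Bool) → ℝ) :
    expect p f = expect p fun x =>
      p e * f (Function.update x e true) + (1 - p e) * f (Function.update x e false) := by
  -- Flipping coordinate e is an involution, so each sum is half the sum over flip pairs. Within a
  -- pair the two weights share all factors but the one at e, and both sides agree.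
  set σ : (ι → Bool) → (ι → Bool) := fun x => Function.update x e (!x e) with hσ
  have hinv : Function.Involutive σ := by
    intro x
    simp [hσ]
  have hsum : ∀ g : (ι → Bool) → ℝ, 2 * ∑ x, g x = ∑ x, (g x + g (σ x)) := by
    intro g
    rw [Finset.sum_add_distrib, two_mul]
    congr 1
    exact (Equiv.sum_comp hinv.toPerm g).symm
  have hw : ∀ (x : ι → Bool) (b : Bool), configWeight p (Function.update x e b) =
      bernWeight (p e) b * ∏ i ∈ Finset.univ.erase e, bernWeight (p i) (x i) := by
    intro x b
    rw [configWeight, ← Finset.mul_prod_erase Finset.univ _ (Finset.mem_univ e)]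
    congr 1
    · simp
    · refine Finset.prod_congr rfl fun i hi => ?_
      rw [Function.update_of_ne (Finset.ne_of_mem_erase hi)]
  have h2 : (2 : ℝ) * expect p f = 2 * expect p fun x =>
      p e * f (Function.update x e true) + (1 - p e) * f (Function.update x e false) := by
    rw [expect, expect, hsum, hsum]
    refine Finset.sum_congr rfl fun x _ => ?_
    have hx : x = Function.update x e (x e) := by simp
    have hwx := hw x (x e)
    rw [← hx] at hwx
    have hwσ := hw x (!x e)
    simp only [hσ, Function.update_idem]
    rw [hwx, hwσ]
    cases hxe : x e
    · have h1 : Function.update x e false = x := by rw [← hxe]; simp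
      simp only [Bool.not_false, bernWeight, h1]
      simp
      ring
    · have h1 : Function.update x e true = x := by rw [← hxe]; simp
      simp only [Bool.not_true, bernWeight, h1]
      simp
      ring
  linarith

/-- Markov's inequality applied to the exponential. -/
lemma prob_le_of_exp {p : ι → ℝ} (hp : ∀ e, 0 ≤ p e ∧ p e ≤ 1) {A : (ι → Bool) → Prop}
    {f : (ι → Bool) → ℝ} {u : ℝ} (hA : ∀ x, A x → u ≤ f x)
    (hf : expect p (fun x => Real.exp (f x)) ≤ 1) : prob p A ≤ Real.exp (-u) := by
  classical
  have h1 : prob p A ≤ expect p fun x => Real.exp (-u) * Real.exp (f x) := by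
    refine expect_mono hp fun x => ?_
    split_ifs with h
    · rw [← Real.exp_add]
      exact Real.one_le_exp (by linarith [hA x h])
    · positivity
  rw [expect_const_mul] at h1
  exact h1.trans (mul_le_of_le_one_right (Real.exp_pos _).le hf)

lemma prob_mono {p : ι → ℝ} (hp : ∀ e, 0 ≤ p e ∧ p e ≤ 1) {A A' : (ι → Bool) → Prop}
    (h : ∀ x, A x → A' x) : prob p A ≤ prob p A' := by
  refine expect_mono hp fun x => ?_
  by_cases hA : A x
  · simp [hA, h x hA]
  · simp only [hA, if_false]
    split_ifs <;> norm_num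

lemma prob_exists_le {p : ι → ℝ} (hp : ∀ e, 0 ≤ p e ∧ p e ≤ 1) {κ : Type*} (s : Finset κ)
    (A : κ → (ι → Bool) → Prop) :
    prob p (fun x => ∃ i ∈ s, A i x) ≤ ∑ i ∈ s, prob p (A i) := by
  classical
  unfold prob expect
  rw [Finset.sum_comm]
  refine Finset.sum_le_sum fun x _ => ?_
  rw [← Finset.mul_sum]
  refine mul_le_mul_of_nonneg_left ?_ (configWeight_nonneg hp x)
  beta_reduce
  split_ifs with h
  · obtain ⟨i, hi, hAi⟩ := h
    refine le_trans ?_ (Finset.single_le_sum (f := fun i => if A i x then (1 : ℝ) else 0)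
      (fun i _ => by split_ifs <;> norm_num) hi)
    simp [hAi]
  · exact Finset.sum_nonneg fun i _ => by split_ifs <;> norm_num

lemma prob_or_le {p : ι → ℝ} (hp : ∀ e, 0 ≤ p e ∧ p e ≤ 1) (A A' : (ι → Bool) → Prop) :
    prob p (fun x => A x ∨ A' x) ≤ prob p A + prob p A' := by
  classical
  unfold prob expect
  rw [← Finset.sum_add_distrib]
  refine Finset.sum_le_sum fun x _ => ?_
  rw [← mul_add]
  refine mul_le_mul_of_nonneg_left ?_ (configWeight_nonneg hp x)
  by_cases h1 : A x <;> by_cases h2 : A' x <;> simp [h1, h2]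

lemma prob_not (p : ι → ℝ) (A : (ι → Bool) → Prop) :
    prob p (fun x => ¬ A x) = 1 - prob p A := by
  classical
  rw [← expect_one p]
  unfold prob expect
  rw [← Finset.sum_sub_distrib]
  refine Finset.sum_congr rfl fun x _ => ?_
  by_cases h1 : A x <;> simp [h1]

/-- The Bennett function `exp v - 1 - v`. -/
def bennett (v : ℝ) : ℝ := Real.exp v - 1 - v

lemma bennett_nonneg (v : ℝ) : 0 ≤ bennett v := by
  unfold bennett; linarith [Real.add_one_le_exp v]

/-- This is (e^u - e^v)² ≥ 0. An edge appears at both (a,b) and (b,a), so its coefficient is a sum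
of two; the inequality separates them. -/
lemma bennett_add_le (u v : ℝ) : bennett (u + v) ≤ (bennett (2 * u) + bennett (2 * v)) / 2 := by
  unfold bennett
  have h1 : Real.exp (u + v) = Real.exp u * Real.exp v := Real.exp_add u v
  have h2 : Real.exp (2 * u) = Real.exp u * Real.exp u := by rw [two_mul, Real.exp_add]
  have h3 : Real.exp (2 * v) = Real.exp v * Real.exp v := by rw [two_mul, Real.exp_add]
  nlinarith [sq_nonneg (Real.exp u - Real.exp v)]

lemma bennett_le_sq {v : ℝ} (hv : |v| ≤ 1) : bennett v ≤ v ^ 2 := by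
  have := Real.abs_exp_sub_one_sub_id_le hv
  exact (le_abs_self _).trans this

/-- The moment generating function 1 + q(e^v - 1) is at most exp(q(e^v - 1)), and the exponents
subtract exactly this. -/
lemma bernoulli_mgf_le (q v : ℝ) :
    q * Real.exp ((1 - q) * v - q * bennett v) +
      (1 - q) * Real.exp ((0 - q) * v - q * bennett v) ≤ 1 := by
  have h1 : Real.exp ((1 - q) * v - q * bennett v) =
      Real.exp (-q * (Real.exp v - 1)) * Real.exp v := by
    rw [← Real.exp_add]; congr 1; unfold bennett; ring
  have h2 : Real.exp ((0 - q) * v - q * bennett v) = Real.exp (-q * (Real.exp v - 1)) := by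
    congr 1; unfold bennett; ring
  rw [h1, h2]
  have h3 : q * (Real.exp v - 1) + 1 ≤ Real.exp (q * (Real.exp v - 1)) := Real.add_one_le_exp _
  have h4 : Real.exp (-q * (Real.exp v - 1)) * Real.exp (q * (Real.exp v - 1)) = 1 := by
    rw [← Real.exp_add]; simp
  nlinarith [Real.exp_pos (-q * (Real.exp v - 1))]

/-- The real value of a Boolean. -/
def boolVal (b : Bool) : ℝ := if b then 1 else 0

/-- An exponential supermartingale bound: the coefficients may be random as long as they do not
depend on the coordinates that are summed. -/
lemma expect_exp_sum_le_one {p : ι → ℝ} (hp : ∀ e, 0 ≤ p e ∧ p e ≤ 1) (F : Finset ι)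
    (v : ι → (ι → Bool) → ℝ)
    (hv : ∀ i ∈ F, ∀ e ∈ F, ∀ x b, v i (Function.update x e b) = v i x) :
    expect p (fun x => Real.exp (∑ e ∈ F,
      ((boolVal (x e) - p e) * v e x - p e * bennett (v e x)))) ≤ 1 := by
  induction F using Finset.induction_on with
  | empty => simp [expect_one]
  | insert a F ha ih =>
    have ih' := ih fun i hi e he => hv i (Finset.mem_insert_of_mem hi) e
      (Finset.mem_insert_of_mem he)
    refine le_trans ?_ ih'
    -- Resample coordinate a with the others fixed. No coefficient changes, so only one factor is
    -- averaged, and its mean is at most 1.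
    rw [expect_eq_expect_update p a]
    refine expect_mono hp fun x => ?_
    have key : ∀ b, (∑ e ∈ insert a F, ((boolVal (Function.update x a b e) - p e) *
        v e (Function.update x a b) - p e * bennett (v e (Function.update x a b)))) =
        ((boolVal b - p a) * v a x - p a * bennett (v a x)) +
        ∑ e ∈ F, ((boolVal (x e) - p e) * v e x - p e * bennett (v e x)) := by
      intro b
      rw [Finset.sum_insert ha]
      congr 1
      · rw [hv a (Finset.mem_insert_self _ _) a (Finset.mem_insert_self _ _)]
        simp
      · refine Finset.sum_congr rfl fun e he => ?_
        rw [hv e (Finset.mem_insert_of_mem he) a (Finset.mem_insert_self _ _),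
          Function.update_of_ne (by rintro rfl; exact ha he)]
    rw [key, key, Real.exp_add, Real.exp_add]
    have := bernoulli_mgf_le (p a) (v a x)
    set R := Real.exp (∑ e ∈ F, ((boolVal (x e) - p e) * v e x - p e * bennett (v e x))) with hR
    have hRpos : 0 < R := Real.exp_pos _
    simp only [boolVal, if_true, Bool.false_eq_true, if_false]
    nlinarith

end Bernoulli

/-! ### Random graphs with independent edges -/

section Graph

variable {n : ℕ}

/-- Potential edges, as ordered pairs. -/
abbrev Edge (n : ℕ) := {e : Fin n × Fin n // e.1 < e.2}

/-- Edge configurations. -/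
abbrev Config (n : ℕ) := Edge n → Bool

/-- The edge probabilities read off a matrix. -/
def edgeProb (S : Matrix (Fin n) (Fin n) ℝ) (e : Edge n) : ℝ := S e.1.1 e.1.2

/-- The adjacency matrix of a configuration. -/
def adj (x : Config n) : Matrix (Fin n) (Fin n) ℝ := Matrix.of fun a b =>
  if h : a < b then boolVal (x ⟨(a, b), h⟩) else
    if h : b < a then boolVal (x ⟨(b, a), h⟩) else 0

/-- The centred adjacency matrix, with zero diagonal. -/
def noise (S : Matrix (Fin n) (Fin n) ℝ) (x : Config n) : Matrix (Fin n) (Fin n) ℝ :=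
  Matrix.of fun a b => if a = b then 0 else adj x a b - S a b

/-- A symmetric matrix of probabilities bounded by `L`. -/
structure IsProbMatrix (S : Matrix (Fin n) (Fin n) ℝ) (L : ℝ) : Prop where
  symm : ∀ a b, S a b = S b a
  nonneg : ∀ a b, 0 ≤ S a b
  le_one : ∀ a b, S a b ≤ 1
  le : ∀ a b, S a b ≤ L

lemma IsProbMatrix.edgeProb_mem {S : Matrix (Fin n) (Fin n) ℝ} {L : ℝ} (hS : IsProbMatrix S L)
    (e : Edge n) : 0 ≤ edgeProb S e ∧ edgeProb S e ≤ 1 := ⟨hS.nonneg _ _, hS.le_one _ _⟩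

lemma boolVal_nonneg (b : Bool) : 0 ≤ boolVal b := by unfold boolVal; split_ifs <;> norm_num

lemma boolVal_le_one (b : Bool) : boolVal b ≤ 1 := by unfold boolVal; split_ifs <;> norm_num

lemma adj_of_lt (x : Config n) {a b : Fin n} (h : a < b) : adj x a b = boolVal (x ⟨(a, b), h⟩) := by
  simp [adj, h]

lemma adj_self (x : Config n) (a : Fin n) : adj x a a = 0 := by simp [adj]

lemma adj_comm (x : Config n) (a b : Fin n) : adj x a b = adj x b a := by
  rcases lt_trichotomy a b with h | h | h
  · simp [adj, h, h.not_gt]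
  · rw [h]
  · simp [adj, h, h.not_gt]

lemma adj_nonneg (x : Config n) (a b : Fin n) : 0 ≤ adj x a b := by
  simp only [adj, Matrix.of_apply]
  split_ifs <;> simp [boolVal_nonneg]

lemma adj_le_one (x : Config n) (a b : Fin n) : adj x a b ≤ 1 := by
  simp only [adj, Matrix.of_apply]
  split_ifs <;> simp [boolVal_le_one]

lemma noise_self (S : Matrix (Fin n) (Fin n) ℝ) (x : Config n) (a : Fin n) :
    noise S x a a = 0 := by simp [noise]

lemma noise_of_ne (S : Matrix (Fin n) (Fin n) ℝ) (x : Config n) {a b : Fin n} (h : a ≠ b) :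
    noise S x a b = adj x a b - S a b := by simp [noise, h]

lemma noise_comm {S : Matrix (Fin n) (Fin n) ℝ} {L : ℝ} (hS : IsProbMatrix S L) (x : Config n)
    (a b : Fin n) : noise S x a b = noise S x b a := by
  by_cases h : a = b
  · rw [h]
  · rw [noise_of_ne S x h, noise_of_ne S x (Ne.symm h), adj_comm, hS.symm]

lemma abs_noise_le_one {S : Matrix (Fin n) (Fin n) ℝ} {L : ℝ} (hS : IsProbMatrix S L)
    (x : Config n) (a b : Fin n) : |noise S x a b| ≤ 1 := by
  by_cases h : a = b
  · rw [h, noise_self]; simp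
  · rw [noise_of_ne S x h, abs_le]
    constructor <;> linarith [adj_nonneg x a b, adj_le_one x a b, hS.nonneg a b, hS.le_one a b]

/-- A sum over ordered pairs that vanishes on the diagonal is a sum over edges. -/
lemma sum_sum_eq_sum_edge (f : Fin n → Fin n → ℝ) (hf : ∀ a, f a a = 0) :
    ∑ a, ∑ b, f a b = ∑ e : Edge n, (f e.1.1 e.1.2 + f e.1.2 e.1.1) := by
  have h1 : ∀ g : Fin n → Fin n → ℝ,
      ∑ e : Edge n, g e.1.1 e.1.2 = ∑ a, ∑ b, if a < b then g a b else 0 := by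
    intro g
    rw [← Fintype.sum_prod_type' (f := fun a b => if a < b then g a b else 0),
      ← Finset.sum_filter, Finset.sum_subtype (p := fun e : Fin n × Fin n => e.1 < e.2)]
    simp
  rw [Finset.sum_add_distrib, h1 f, h1 fun a b => f b a]
  conv_rhs =>
    arg 2
    rw [Finset.sum_comm]
  rw [← Finset.sum_add_distrib]
  refine Finset.sum_congr rfl fun a _ => ?_
  rw [← Finset.sum_add_distrib]
  refine Finset.sum_congr rfl fun b _ => ?_
  rcases lt_trichotomy a b with h | h | h
  · simp [h, h.not_gt]
  · simp [h, hf]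
  · simp [h, h.not_gt]

/-- The edge joining two distinct vertices lies in `F`. -/
def InEdges (F : Finset (Edge n)) (a b : Fin n) : Prop :=
  (∃ h : a < b, (⟨(a, b), h⟩ : Edge n) ∈ F) ∨ ∃ h : b < a, (⟨(b, a), h⟩ : Edge n) ∈ F

/-- Bennett's inequality for linear forms in the centred adjacency matrix, whose coefficients may
depend on the other edges. -/
lemma prob_sum_noise_ge_le {S : Matrix (Fin n) (Fin n) ℝ} {L : ℝ} (hS : IsProbMatrix S L)
    (F : Finset (Edge n)) (V : Config n → Fin n → Fin n → ℝ)
    (hV0 : ∀ x a b, a ≠ b → ¬ InEdges F a b → V x a b = 0)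
    (hdep : ∀ e ∈ F, ∀ x b, V (Function.update x e b) = V x) (u : ℝ) :
    prob (edgeProb S) (fun x => u + L / 2 * ∑ a, ∑ b, bennett (2 * V x a b) ≤
      ∑ a, ∑ b, noise S x a b * V x a b) ≤ Real.exp (-u) := by
  classical
  have hp := hS.edgeProb_mem
  refine prob_le_of_exp hp (f := fun x => ∑ e ∈ F,
      ((boolVal (x e) - edgeProb S e) * (V x e.1.1 e.1.2 + V x e.1.2 e.1.1) -
        edgeProb S e * bennett (V x e.1.1 e.1.2 + V x e.1.2 e.1.1))) ?_
      (expect_exp_sum_le_one hp F (fun e x => V x e.1.1 e.1.2 + V x e.1.2 e.1.1) ?_)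
  · intro x hx
    have hsum : ∑ a, ∑ b, noise S x a b * V x a b = ∑ e ∈ F,
        (boolVal (x e) - edgeProb S e) * (V x e.1.1 e.1.2 + V x e.1.2 e.1.1) := by
      rw [sum_sum_eq_sum_edge _ (fun a => by rw [noise_self, zero_mul])]
      rw [← Finset.sum_subset (Finset.subset_univ F)]
      · refine Finset.sum_congr rfl fun e _ => ?_
        rw [noise_comm hS x e.1.2 e.1.1, noise_of_ne S x e.2.ne, adj_of_lt x e.2]
        simp only [edgeProb]
        ring
      · intro e _ he
        have h1 : ¬ InEdges F e.1.1 e.1.2 := by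
          rintro (⟨h, h'⟩ | ⟨h, h'⟩)
          · exact he h'
          · exact absurd e.2 h.not_gt
        have h2 : ¬ InEdges F e.1.2 e.1.1 := by
          rintro (⟨h, h'⟩ | ⟨h, h'⟩)
          · exact absurd e.2 h.not_gt
          · exact he h'
        rw [hV0 x _ _ e.2.ne h1, hV0 x _ _ e.2.ne' h2]
        ring
    have hb : ∑ e ∈ F, edgeProb S e * bennett (V x e.1.1 e.1.2 + V x e.1.2 e.1.1) ≤
        L / 2 * ∑ a, ∑ b, bennett (2 * V x a b) := by
      have h1 : ∑ e : Edge n, (bennett (2 * V x e.1.1 e.1.2) + bennett (2 * V x e.1.2 e.1.1)) ≤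
          ∑ a, ∑ b, bennett (2 * V x a b) := by
        have h2 := sum_sum_eq_sum_edge
          (fun a b => if a = b then 0 else bennett (2 * V x a b)) (by simp)
        have h3 : ∑ e : Edge n, (bennett (2 * V x e.1.1 e.1.2) + bennett (2 * V x e.1.2 e.1.1)) =
            ∑ a, ∑ b, if a = b then 0 else bennett (2 * V x a b) := by
          rw [h2]
          refine Finset.sum_congr rfl fun e _ => ?_
          rw [if_neg e.2.ne, if_neg e.2.ne']
        rw [h3]
        refine Finset.sum_le_sum fun a _ => Finset.sum_le_sum fun b _ => ?_
        split_ifs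
        · exact bennett_nonneg _
        · exact le_rfl
      have hterm : ∀ e : Edge n, edgeProb S e * bennett (V x e.1.1 e.1.2 + V x e.1.2 e.1.1) ≤
          L / 2 * (bennett (2 * V x e.1.1 e.1.2) + bennett (2 * V x e.1.2 e.1.1)) := by
        intro e
        have h4 := bennett_add_le (V x e.1.1 e.1.2) (V x e.1.2 e.1.1)
        have h5 := bennett_nonneg (V x e.1.1 e.1.2 + V x e.1.2 e.1.1)
        have h6 : edgeProb S e ≤ L := hS.le _ _
        have h7 := (hp e).1
        calc _ ≤ L * bennett (V x e.1.1 e.1.2 + V x e.1.2 e.1.1) := by gcongr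
          _ ≤ L * ((bennett (2 * V x e.1.1 e.1.2) + bennett (2 * V x e.1.2 e.1.1)) / 2) := by
            have : 0 ≤ L := h7.trans h6
            gcongr
          _ = _ := by ring
      -- Nonnegativity of L is read off from an edge probability, so the case without edges is
      -- treated apart.
      by_cases hn : Nonempty (Edge n)
      · obtain ⟨e0⟩ := hn
        have hL : 0 ≤ L := (hp e0).1.trans (hS.le _ _)
        calc _ ≤ ∑ e ∈ F, L / 2 * (bennett (2 * V x e.1.1 e.1.2) + bennett (2 * V x e.1.2 e.1.1)) :=
              Finset.sum_le_sum fun e _ => hterm e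
          _ ≤ ∑ e : Edge n, L / 2 * (bennett (2 * V x e.1.1 e.1.2) + bennett (2 * V x e.1.2 e.1.1)) :=
              Finset.sum_le_sum_of_subset_of_nonneg (Finset.subset_univ _) fun e _ _ =>
                mul_nonneg (by positivity) (add_nonneg (bennett_nonneg _) (bennett_nonneg _))
          _ ≤ _ := by
            rw [← Finset.mul_sum]
            gcongr
      · have hF : F = ∅ := Finset.eq_empty_of_forall_notMem fun e _ => hn ⟨e⟩
        rw [hF, Finset.sum_empty]
        rcases Nat.eq_zero_or_pos n with h0 | h0
        · subst h0
          simp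
        · have hL : 0 ≤ L := (hS.nonneg ⟨0, h0⟩ ⟨0, h0⟩).trans (hS.le _ _)
          exact mul_nonneg (by positivity)
            (Finset.sum_nonneg fun a _ => Finset.sum_nonneg fun b _ => bennett_nonneg _)
    rw [Finset.sum_sub_distrib, ← hsum]
    linarith
  · intro i _ e he x b
    simp only [hdep e he x b]

/-- Bennett's inequality for linear forms with deterministic coefficients. -/
lemma prob_sum_noise_ge_le_of_const {S : Matrix (Fin n) (Fin n) ℝ} {L : ℝ}
    (hS : IsProbMatrix S L) (V : Fin n → Fin n → ℝ) (u : ℝ) :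
    prob (edgeProb S) (fun x => u + L / 2 * ∑ a, ∑ b, bennett (2 * V a b) ≤
      ∑ a, ∑ b, noise S x a b * V a b) ≤ Real.exp (-u) := by
  refine prob_sum_noise_ge_le hS Finset.univ (fun _ => V) ?_ (fun _ _ _ _ => rfl) u
  intro _ a b hab h
  refine absurd ?_ h
  rcases lt_or_gt_of_ne hab with h' | h'
  · exact Or.inl ⟨h', Finset.mem_univ _⟩
  · exact Or.inr ⟨h', Finset.mem_univ _⟩

end Graph

/-! ### From the stochastic block model to configurations -/

section Transfer

variable {n K : ℕ}

open Classical in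
/-- The configuration of a graph. -/
def graphConfig (g : SimpleGraph (Fin n)) : Config n := fun e => decide (g.Adj e.1.1 e.1.2)

lemma adj_graphConfig (g : SimpleGraph (Fin n)) : adj (graphConfig g) = adjacency g := by
  classical
  ext a b
  simp only [adjacency, SimpleGraph.adjMatrix_apply, adj, Matrix.of_apply, graphConfig, boolVal]
  rcases lt_trichotomy a b with h | h | h
  · simp [h]
  · simp [h]
  · simp [h, h.not_gt, g.adj_comm a b]

/-- The matrix of connection probabilities of the vertices. -/
def signal (z : Fin n → Fin K) (P : Matrix (Fin K) (Fin K) ℝ) : Matrix (Fin n) (Fin n) ℝ :=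
  Matrix.of fun a b => P (z a) (z b)

/-- By independence, the event that the graph has a given configuration has the product Bernoulli
mass. The target event is a finite disjoint union of such events, so the rest of the argument can
take place on the finite product space. -/
lemma IsSBM.prob_le {Ω : Type*} [MeasurableSpace Ω] {μ : Measure Ω} [IsProbabilityMeasure μ]
    {g : Ω → SimpleGraph (Fin n)} {z : Fin n → Fin K} {P : Matrix (Fin K) (Fin K) ℝ}
    (h : IsSBM μ g z P) (A : Config n → Prop) :
    prob (edgeProb (signal z P)) A ≤ μ.real {ω | A (graphConfig (g ω))} := by
  classical
  have hsingle : ∀ x : Config n, MeasurableSet {ω | graphConfig (g ω) = x} ∧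
      μ.real {ω | graphConfig (g ω) = x} = configWeight (edgeProb (signal z P)) x := by
    intro x
    set s : Edge n → Set Ω := fun e =>
      if x e then {ω | (g ω).Adj e.1.1 e.1.2} else {ω | (g ω).Adj e.1.1 e.1.2}ᶜ with hs
    have hset : {ω | graphConfig (g ω) = x} = ⋂ e, s e := by
      ext ω
      simp only [Set.mem_ofPred_eq, Set.mem_iInter, funext_iff, hs, graphConfig]
      refine forall_congr' fun e => ?_
      cases x e <;> simp
    have hmeas : ∀ e, MeasurableSet (s e) := by
      intro e
      simp only [hs]
      split_ifs
      · exact h.measurableSet_adj _ _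
      · exact (h.measurableSet_adj _ _).compl
    refine ⟨hset ▸ MeasurableSet.iInter hmeas, ?_⟩
    have hind : μ (⋂ e, s e) = ∏ e, μ (s e) := by
      refine iIndep.meas_iInter h.indep fun e => ?_
      have hgen : MeasurableSet[MeasurableSpace.generateFrom {{ω | (g ω).Adj e.1.1 e.1.2}}]
          {ω | (g ω).Adj e.1.1 e.1.2} := MeasurableSpace.measurableSet_generateFrom rfl
      simp only [hs]
      split_ifs
      · exact hgen
      · exact hgen.compl
    rw [hset, Measure.real, hind, ENNReal.toReal_prod, configWeight]
    refine Finset.prod_congr rfl fun e _ => ?_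
    have hpe := h.prob_adj e.1.1 e.1.2 e.2.ne
    change μ.real (s e) = _
    simp only [hs, bernWeight, edgeProb, signal, Matrix.of_apply]
    split_ifs
    · exact hpe
    · rw [probReal_compl_eq_one_sub (h.measurableSet_adj _ _), hpe]
  have hunion : {ω | A (graphConfig (g ω))} =
      ⋃ x ∈ Finset.univ.filter A, {ω | graphConfig (g ω) = x} := by
    ext ω
    simp
  rw [hunion, measureReal_biUnion_finset]
  · rw [Finset.sum_filter, prob, expect]
    refine Finset.sum_le_sum fun x _ => ?_
    rw [(hsingle x).2]
    split_ifs <;> simp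
  · intro x _ y _ hxy
    refine Set.disjoint_left.2 fun ω hx hy => hxy ?_
    have hx' : graphConfig (g ω) = x := hx
    exact hx'.symm.trans hy
  · exact fun x _ => (hsingle x).1

end Transfer

/-! ### Entropy of subsets -/

/-- The logarithmic factor `log (e n / t)`. -/
def logFactor (n t : ℕ) : ℝ := 1 + Real.log ((n : ℝ) / t)

/-- The entropy `t log (e n / t)` of the subsets with `t` elements. -/
def entropy (n t : ℕ) : ℝ := t * logFactor n t

lemma one_le_logFactor {n t : ℕ} (h : t ≤ n) : 1 ≤ logFactor n t := by
  unfold logFactor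
  rcases Nat.eq_zero_or_pos t with h0 | h0
  · simp [h0]
  · have : (1 : ℝ) ≤ n / t := by
      rw [le_div_iff₀ (by positivity)]
      simpa using (Nat.cast_le (α := ℝ)).2 h
    linarith [Real.log_nonneg this]

lemma exp_logFactor {n t : ℕ} (hn : 0 < n) (ht : 0 < t) :
    Real.exp (logFactor n t) = Real.exp 1 * (n / t) := by
  unfold logFactor
  rw [Real.exp_add, Real.exp_log (by positivity)]

lemma le_entropy {n t : ℕ} (h : t ≤ n) : (t : ℝ) ≤ entropy n t := by
  unfold entropy
  nlinarith [one_le_logFactor h, (Nat.cast_nonneg t : (0 : ℝ) ≤ t)]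

lemma entropy_nonneg {n t : ℕ} (h : t ≤ n) : 0 ≤ entropy n t :=
  (Nat.cast_nonneg t).trans (le_entropy h)

/-- The function t log(en/t) increases up to t = n; quantitatively, s log(t/s) ≤ t - s. -/
lemma entropy_mono {n s t : ℕ} (hst : s ≤ t) (htn : t ≤ n) : entropy n s ≤ entropy n t := by
  rcases Nat.eq_zero_or_pos s with h0 | h0
  · subst h0
    simpa [entropy] using entropy_nonneg htn
  have hs : (0 : ℝ) < s := by positivity
  have ht : (0 : ℝ) < t := by have := h0.trans_le hst; positivity
  have hn : (0 : ℝ) < n := by have := (h0.trans_le hst).trans_le htn; positivity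
  have hst' : (s : ℝ) ≤ t := by exact_mod_cast hst
  have hl := one_le_logFactor htn
  have h1 : logFactor n s = logFactor n t + Real.log (t / s) := by
    unfold logFactor
    rw [Real.log_div hn.ne' hs.ne', Real.log_div hn.ne' ht.ne', Real.log_div ht.ne' hs.ne']
    ring
  have h2 : Real.log (t / s) ≤ t / s - 1 := Real.log_le_sub_one_of_pos (by positivity)
  have h3 : s * Real.log (t / s) ≤ t - s := by
    calc (s : ℝ) * Real.log (t / s) ≤ s * (t / s - 1) := by gcongr
      _ = t - s := by field_simp
  unfold entropy
  rw [h1]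
  nlinarith

lemma one_add_log_le_entropy {n t : ℕ} (ht : 0 < t) (htn : t ≤ n) :
    1 + Real.log n ≤ entropy n t := by
  have := entropy_mono (n := n) (show 1 ≤ t from ht) htn
  simpa [entropy, logFactor] using this

/-- The binomial is at most n^t/t!, which is at most (en/t)^t because t^t/t! ≤ e^t. -/
lemma choose_le_exp_entropy {n t : ℕ} (ht : 0 < t) (htn : t ≤ n) :
    (n.choose t : ℝ) ≤ Real.exp (entropy n t) := by
  have hn : 0 < n := ht.trans_le htn
  have ht' : (0 : ℝ) < t := by positivity
  have h1 : (n.choose t : ℝ) ≤ (n : ℝ) ^ t / t.factorial := Nat.choose_le_pow_div t n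
  have h2 : (t : ℝ) ^ t / t.factorial ≤ Real.exp t := Real.pow_div_factorial_le_exp _ ht'.le t
  have h3 : Real.exp (entropy n t) = Real.exp t * (n / t) ^ t := by
    unfold entropy
    rw [Real.exp_nat_mul, exp_logFactor hn ht, mul_pow, ← Real.exp_nat_mul, mul_one]
  rw [h3]
  calc _ ≤ _ := h1
    _ = ((t : ℝ) ^ t / t.factorial) * (n / t) ^ t := by
      rw [div_pow]
      field_simp
    _ ≤ _ := by gcongr

/-- Summing over non-empty subsets costs two powers of `n`. -/
lemma sum_exp_neg_entropy_le {n : ℕ} (k : ℕ) :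
    ∑ T ∈ Finset.univ.filter (fun T : Finset (Fin n) => T.Nonempty),
      Real.exp (-((k + 2 : ℕ) * entropy n T.card)) ≤ 1 / (n : ℝ) ^ k := by
  rcases Nat.eq_zero_or_pos n with h0 | hn
  · subst h0
    refine le_trans (le_of_eq ?_) (by positivity)
    refine Finset.sum_eq_zero fun T hT => ?_
    exfalso
    obtain ⟨a, -⟩ := (Finset.mem_filter.1 hT).2
    exact a.elim0
  have hn' : (0 : ℝ) < n := by positivity
  have hn1 : (1 : ℝ) ≤ n := by exact_mod_cast hn
  have hmaps : ∀ T ∈ Finset.univ.filter (fun T : Finset (Fin n) => T.Nonempty),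
      T.card ∈ Finset.Icc 1 n := by
    intro T hT
    have := (Finset.mem_filter.1 hT).2
    rw [Finset.mem_Icc]
    exact ⟨this.card_pos, by simpa using Finset.card_le_univ T⟩
  rw [← Finset.sum_fiberwise_of_maps_to hmaps]
  have hterm : ∀ t ∈ Finset.Icc 1 n,
      ∑ T ∈ (Finset.univ.filter (fun T : Finset (Fin n) => T.Nonempty)).filter
        (fun T => T.card = t), Real.exp (-((k + 2 : ℕ) * entropy n T.card)) ≤
        1 / (n : ℝ) ^ (k + 1) := by
    intro t ht
    rw [Finset.mem_Icc] at ht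
    have hcard : ((Finset.univ.filter (fun T : Finset (Fin n) => T.Nonempty)).filter
        (fun T => T.card = t)).card ≤ n.choose t := by
      calc _ ≤ (Finset.powersetCard t (Finset.univ : Finset (Fin n))).card := by
            refine Finset.card_le_card fun T hT => ?_
            rw [Finset.mem_powersetCard]
            exact ⟨Finset.subset_univ _, (Finset.mem_filter.1 hT).2⟩
        _ = _ := by simp
    have hent := one_add_log_le_entropy ht.1 ht.2
    -- One of the k+2 entropies pays for the number of sets of size t. Each of the remaining k+1 is
    -- at least log n, and summing over the n possible sizes costs one more power.
    calc _ = ∑ T ∈ (Finset.univ.filter (fun T : Finset (Fin n) => T.Nonempty)).filter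
            (fun T => T.card = t), Real.exp (-((k + 2 : ℕ) * entropy n t)) := by
          refine Finset.sum_congr rfl fun T hT => ?_
          rw [(Finset.mem_filter.1 hT).2]
      _ ≤ Real.exp (entropy n t) * Real.exp (-((k + 2 : ℕ) * entropy n t)) := by
          rw [Finset.sum_const, nsmul_eq_mul]
          gcongr
          exact (Nat.cast_le.2 hcard).trans (choose_le_exp_entropy ht.1 ht.2)
      _ = Real.exp (-((k + 1 : ℕ) * entropy n t)) := by
          rw [← Real.exp_add]
          congr 1
          push_cast
          ring
      _ ≤ Real.exp (-((k + 1 : ℕ) * Real.log n)) := by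
          apply Real.exp_le_exp.2
          have : ((k + 1 : ℕ) : ℝ) * Real.log n ≤ (k + 1 : ℕ) * entropy n t := by
            gcongr
            linarith
          linarith
      _ = _ := by
          rw [Real.exp_neg, Real.exp_nat_mul, Real.exp_log hn', one_div]
  calc _ ≤ ∑ t ∈ Finset.Icc 1 n, 1 / (n : ℝ) ^ (k + 1) := Finset.sum_le_sum hterm
    _ = _ := by
      rw [Finset.sum_const, Nat.card_Icc, nsmul_eq_mul, pow_succ]
      simp
      field_simp

/-- Legendre duality: log u ≤ u - 1 at u = (n/t)e^{-y}. It converts a bound with entropy cost,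
uniform over sets, into an exponentially small quantity. -/
lemma entropy_sub_mul_le {n t : ℕ} (hn : 0 < n) (y : ℝ) :
    entropy n t - t * y ≤ n * Real.exp (-y) := by
  rcases Nat.eq_zero_or_pos t with h0 | h0
  · subst h0
    simp [entropy]
    positivity
  have ht : (0 : ℝ) < t := by positivity
  have h1 : Real.log ((n : ℝ) / t * Real.exp (-y)) ≤ (n : ℝ) / t * Real.exp (-y) - 1 :=
    Real.log_le_sub_one_of_pos (by positivity)
  rw [Real.log_mul (by positivity) (by positivity), Real.log_exp] at h1
  unfold entropy logFactor
  calc _ = t * (1 + (Real.log (n / t) + -y)) := by ring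
    _ ≤ t * (n / t * Real.exp (-y)) := by
      gcongr
      linarith
    _ = _ := by field_simp

lemma exp_half_logFactor_le {n t : ℕ} (hn : 0 < n) (ht : 0 < t) :
    Real.exp (logFactor n t / 2) ≤ 2 * Real.sqrt (n / t) := by
  have h1 : Real.exp (logFactor n t / 2) = Real.sqrt (Real.exp 1 * (n / t)) := by
    rw [← exp_logFactor hn ht, Real.exp_half]
  rw [h1, Real.sqrt_mul (Real.exp_pos _).le]
  gcongr
  rw [Real.sqrt_le_left (by norm_num)]
  linarith [Real.exp_one_lt_d9]

/-- With ℓ the logarithmic factor, ℓ² ≤ 64 e^{ℓ/4}, so the product is at most 64 e^{ℓ/2}. The result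
is summable over ranks by `sum_sqrt_div_le`; the extra exponential accommodates Bennett functions of
unbounded arguments. -/
lemma logFactor_sq_mul_exp_le {n t : ℕ} (hn : 0 < n) (ht : 0 < t) (htn : t ≤ n) :
    logFactor n t ^ 2 * Real.exp (logFactor n t / 4) ≤ 128 * Real.sqrt (n / t) := by
  have h1 := exp_half_logFactor_le hn ht
  set y := logFactor n t with hy
  have hy1 : 1 ≤ y := one_le_logFactor htn
  have h2 : y / 8 ≤ Real.exp (y / 8) := by linarith [Real.add_one_le_exp (y / 8)]
  have h3 : (y / 8) ^ 2 ≤ Real.exp (y / 4) := by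
    calc (y / 8) ^ 2 ≤ Real.exp (y / 8) ^ 2 := by gcongr
      _ = _ := by rw [← Real.exp_nat_mul]; congr 1; push_cast; ring
  have h4 : Real.exp (y / 2) = Real.exp (y / 4) * Real.exp (y / 4) := by
    rw [← Real.exp_add]; congr 1; ring
  have h5 : (0 : ℝ) < Real.exp (y / 4) := Real.exp_pos _
  nlinarith

lemma logFactor_sq_le {n t : ℕ} (hn : 0 < n) (ht : 0 < t) (htn : t ≤ n) :
    logFactor n t ^ 2 ≤ 128 * Real.sqrt (n / t) := by
  refine le_trans ?_ (logFactor_sq_mul_exp_le hn ht htn)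
  have : 1 ≤ Real.exp (logFactor n t / 4) :=
    Real.one_le_exp (by linarith [one_le_logFactor htn])
  nlinarith [sq_nonneg (logFactor n t)]

lemma sum_sqrt_div_le (n t : ℕ) :
    ∑ i ∈ Finset.range t, Real.sqrt (n / (i + 1 : ℕ)) ≤ 2 * Real.sqrt (n * t) := by
  have h : ∑ i ∈ Finset.range t, 1 / Real.sqrt ((i : ℝ) + 1) ≤ 2 * Real.sqrt t := by
    induction t with
    | zero => simp
    | succ t ih =>
      rw [Finset.sum_range_succ]
      have h1 : 1 / Real.sqrt ((t : ℝ) + 1) ≤ 2 * (Real.sqrt (t + 1) - Real.sqrt t) := by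
        rw [div_le_iff₀ (by positivity)]
        have h2 := Real.sq_sqrt (show (0 : ℝ) ≤ (t : ℝ) + 1 by positivity)
        have h3 := Real.sq_sqrt (show (0 : ℝ) ≤ (t : ℝ) by positivity)
        nlinarith [sq_nonneg (Real.sqrt ((t : ℝ) + 1) - Real.sqrt t)]
      push_cast
      linarith
  calc _ = Real.sqrt n * ∑ i ∈ Finset.range t, 1 / Real.sqrt ((i : ℝ) + 1) := by
        rw [Finset.mul_sum]
        refine Finset.sum_congr rfl fun i _ => ?_
        rw [Real.sqrt_div (by positivity)]
        push_cast
        ring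
    _ ≤ Real.sqrt n * (2 * Real.sqrt t) := by gcongr
    _ = _ := by rw [Real.sqrt_mul (by positivity)]; ring

/-- If all partial sums of a family are controlled by their number of terms, so are the sums of a
monotone transform. -/
lemma sum_comp_le_sum_range {ι : Type*} [DecidableEq ι] (f : ι → ℝ) (h : ℕ → ℝ) (ψ : ℝ → ℝ)
    (hf : ∀ i, 0 ≤ f i) (hψ : ∀ a b, 0 ≤ a → a ≤ b → ψ a ≤ ψ b) (T : Finset ι)
    (hT : ∀ C ⊆ T, C.Nonempty → ∑ c ∈ C, f c ≤ C.card * h C.card) :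
    ∑ c ∈ T, ψ (f c) ≤ ∑ i ∈ Finset.range T.card, ψ (h (i + 1)) := by
  induction hN : T.card generalizing T with
  | zero =>
    rw [Finset.card_eq_zero] at hN
    simp [hN]
  | succ N ih =>
    have hne : T.Nonempty := by rw [← Finset.card_pos]; omega
    -- The smallest value is at most the average over T, hence at most h at |T|; remove it and
    -- induct.
    obtain ⟨c, hc, hmin⟩ := Finset.exists_min_image T f hne
    have hcard : (T.erase c).card = N := by rw [Finset.card_erase_of_mem hc]; omega
    have h1 := ih (T.erase c) (fun C hC => hT C (hC.trans (Finset.erase_subset _ _))) hcard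
    rw [Finset.sum_range_succ, ← Finset.sum_erase_add T _ hc]
    refine add_le_add h1 (hψ _ _ (hf c) ?_)
    have h2 := hT T subset_rfl hne
    have h3 : (T.card : ℝ) * f c ≤ ∑ i ∈ T, f i := by
      rw [← nsmul_eq_mul]
      exact Finset.card_nsmul_le_sum _ _ _ hmin
    rw [hN] at h2 h3
    exact le_of_mul_le_mul_left (h3.trans h2) (by positivity)

/-! ### High-probability events -/

section Events

variable {n : ℕ}

/-- Union bound over the index and over all nonempty sets, with two entropies spent by
`sum_exp_neg_entropy_le`. -/
lemma prob_exists_nonempty_le {S : Matrix (Fin n) (Fin n) ℝ} {L : ℝ} (hS : IsProbMatrix S L)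
    {ι : Type*} [Fintype ι] (A : ι → Finset (Fin n) → Config n → Prop) (k : ℕ)
    (hA : ∀ i T, T.Nonempty →
      prob (edgeProb S) (A i T) ≤ Real.exp (-((k + 2 : ℕ) * entropy n T.card))) :
    prob (edgeProb S) (fun x => ∃ i T, T.Nonempty ∧ A i T x) ≤ Fintype.card ι / (n : ℝ) ^ k := by
  classical
  have hp := hS.edgeProb_mem
  have h1 : prob (edgeProb S) (fun x => ∃ i T, T.Nonempty ∧ A i T x) ≤
      prob (edgeProb S) (fun x => ∃ i ∈ (Finset.univ : Finset ι), ∃ T ∈ Finset.univ.filter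
        (fun T : Finset (Fin n) => T.Nonempty), A i T x) := by
    refine prob_mono hp fun x => ?_
    rintro ⟨i, T, hT, h⟩
    exact ⟨i, Finset.mem_univ _, T, by simpa using hT, h⟩
  refine h1.trans ((prob_exists_le hp _ _).trans ?_)
  calc _ ≤ ∑ _i : ι, 1 / (n : ℝ) ^ k := by
        refine Finset.sum_le_sum fun i _ => ?_
        refine (prob_exists_le hp _ _).trans (le_trans ?_ (sum_exp_neg_entropy_le k))
        exact Finset.sum_le_sum fun T hT => hA i T (Finset.mem_filter.1 hT).2
    _ = _ := by simp [div_eq_mul_inv]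

lemma bennett_zero : bennett 0 = 0 := by simp [bennett]

/-! ### Degrees: sums over sets of vertices -/

/-- The degree of a vertex. -/
def degree (x : Config n) (b : Fin n) : ℝ := ∑ c, adj x b c

lemma degree_nonneg (x : Config n) (b : Fin n) : 0 ≤ degree x b :=
  Finset.sum_nonneg fun _ _ => adj_nonneg _ _ _

lemma adj_le_noise_add {S : Matrix (Fin n) (Fin n) ℝ} {L : ℝ} (hS : IsProbMatrix S L)
    (x : Config n) (a b : Fin n) : adj x a b ≤ noise S x a b + L := by
  by_cases h : a = b
  · subst h
    rw [adj_self, noise_self]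
    linarith [hS.nonneg a a, hS.le a a]
  · rw [noise_of_ne S x h]
    linarith [hS.le a b]

/-- Sums of degrees are controlled by the number of vertices. -/
def DegreeEvent (L : ℝ) (x : Config n) : Prop :=
  ∀ T : Finset (Fin n), T.Nonempty →
    ∑ b ∈ T, degree x b ≤ 2 * (n * L) * T.card + 8 * entropy n T.card

lemma sum_ite_mem_const (T : Finset (Fin n)) (f : Fin n → ℝ) :
    ∑ b, (if b ∈ T then f b else 0) = ∑ b ∈ T, f b := by
  rw [← Finset.sum_filter]
  simp

lemma prob_not_degreeEvent {S : Matrix (Fin n) (Fin n) ℝ} {L : ℝ} (hS : IsProbMatrix S L)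
    (hL : 0 ≤ L) : prob (edgeProb S) (fun x => ¬ DegreeEvent L x) ≤ 1 / (n : ℝ) ^ 2 := by
  -- The coefficient 1/2 becomes 1 after the doubling in Bennett's inequality, and `bennett 1` is at
  -- most 1. Dividing by 1/2 turns 4 entropies into 8; the variance term and the mean each
  -- contribute nL|T|.
  have h := prob_exists_nonempty_le hS (ι := Unit)
    (fun _ T x => ((2 + 2 : ℕ) : ℝ) * entropy n T.card + L / 2 * ∑ a, ∑ b,
      bennett (2 * (if a ∈ T then (1 / 2 : ℝ) else 0)) ≤
      ∑ a, ∑ b, noise S x a b * (if a ∈ T then (1 / 2 : ℝ) else 0)) 2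
    (fun _ T _ => prob_sum_noise_ge_le_of_const hS (fun a _ => if a ∈ T then (1 / 2 : ℝ) else 0) _)
  simp only [Fintype.card_unit, Nat.cast_one] at h
  refine (prob_mono hS.edgeProb_mem fun x hx => ?_).trans h
  by_contra hcon
  push Not at hcon
  refine hx fun T hT => ?_
  have h1 := hcon () T hT
  have h2 : ∑ a, ∑ _b : Fin n, bennett (2 * (if a ∈ T then (1 / 2 : ℝ) else 0)) ≤
      n * T.card := by
    calc _ = ∑ a, if a ∈ T then n * bennett 1 else 0 := by
          refine Finset.sum_congr rfl fun a _ => ?_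
          split_ifs <;> simp [bennett_zero]
      _ ≤ ∑ a, if a ∈ T then (n : ℝ) else 0 := by
          refine Finset.sum_le_sum fun a _ => ?_
          split_ifs
          · have := bennett_le_sq (v := 1) (by simp)
            have hn : (0 : ℝ) ≤ n := Nat.cast_nonneg n
            nlinarith
          · exact le_rfl
      _ = _ := by rw [sum_ite_mem_const, Finset.sum_const, nsmul_eq_mul, mul_comm]
  have h3 : ∑ a, ∑ b, noise S x a b * (if a ∈ T then (1 / 2 : ℝ) else 0) =
      1 / 2 * ∑ a ∈ T, ∑ b, noise S x a b := by
    rw [Finset.mul_sum, ← sum_ite_mem_const T]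
    refine Finset.sum_congr rfl fun a _ => ?_
    split_ifs
    · rw [Finset.mul_sum]
      exact Finset.sum_congr rfl fun b _ => by ring
    · simp
  have h4 : ∑ b ∈ T, degree x b ≤ ∑ a ∈ T, ∑ b, noise S x a b + n * L * T.card := by
    calc _ ≤ ∑ a ∈ T, (∑ b, noise S x a b + n * L) := by
          refine Finset.sum_le_sum fun a _ => ?_
          unfold degree
          calc _ ≤ ∑ b, (noise S x a b + L) :=
                Finset.sum_le_sum fun b _ => adj_le_noise_add hS x a b
            _ = _ := by simp [Finset.sum_add_distrib]
      _ = _ := by simp [Finset.sum_add_distrib, mul_comm]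
  rw [h3] at h1
  have h5 : L / 2 * ∑ a, ∑ _b : Fin n, bennett (2 * (if a ∈ T then (1 / 2 : ℝ) else 0)) ≤
      L / 2 * (n * T.card) := by gcongr
  push_cast at h1
  nlinarith

/-! ### Discrepancy: edges between two sets -/

/-- The number of adjacent pairs between two sets. -/
def edgeCount (x : Config n) (A B : Finset (Fin n)) : ℝ := ∑ a ∈ A, ∑ b ∈ B, adj x a b

/-- The larger entropy of two sets. -/
def pairEntropy (A B : Finset (Fin n)) : ℝ := max (entropy n A.card) (entropy n B.card)

/-- The mean number of adjacent pairs, up to constants. -/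
def pairMean (L : ℝ) (A B : Finset (Fin n)) : ℝ := L * A.card * B.card

/-- The discrepancy property of sparse random graphs. -/
def DiscrepancyEvent (L : ℝ) (x : Config n) : Prop :=
  ∀ A B : Finset (Fin n), A.Nonempty → B.Nonempty →
    (pairEntropy A B ≤ Real.exp 2 * pairMean L A B → edgeCount x A B ≤ 63 * pairMean L A B) ∧
    (Real.exp 2 * pairMean L A B < pairEntropy A B →
      edgeCount x A B * Real.log (pairEntropy A B / pairMean L A B) ≤ 17 * pairEntropy A B)

lemma exp_two_lt : Real.exp 2 < 7.4 := by
  have h : Real.exp 2 = Real.exp 1 * Real.exp 1 := by rw [← Real.exp_add]; norm_num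
  have h1 := Real.exp_one_lt_d9
  have h2 := Real.exp_pos 1
  rw [h]
  nlinarith

lemma card_le_of_finset (T : Finset (Fin n)) : T.card ≤ n := by
  simpa using Finset.card_le_univ T

/-- The exponent used in the discrepancy property. -/
def discrepancyExponent (L : ℝ) (A B : Finset (Fin n)) : ℝ :=
  if pairEntropy A B ≤ Real.exp 2 * pairMean L A B then 1
  else Real.log (pairEntropy A B / pairMean L A B) / 2

/-- Bennett's inequality with coefficient θ on A × B gives θ·edges ≤ 6·entropy + mean·e^{2θ}/2. When
the mean dominates, θ = 1 suffices; otherwise θ is chosen so that mean·e^{2θ} equals the entropy.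
Three entropies for each of the two sets leave a factor 1/n apiece after the union bound. -/
lemma prob_not_discrepancyEvent {S : Matrix (Fin n) (Fin n) ℝ} {L : ℝ} (hS : IsProbMatrix S L)
    (hL : 0 < L) : prob (edgeProb S) (fun x => ¬ DiscrepancyEvent L x) ≤ 1 / (n : ℝ) ^ 2 := by
  classical
  have hp := hS.edgeProb_mem
  set V : Finset (Fin n) → Finset (Fin n) → Fin n → Fin n → ℝ := fun A B a b =>
    if a ∈ A then if b ∈ B then discrepancyExponent L A B else 0 else 0 with hV
  set I := Finset.univ.filter (fun T : Finset (Fin n) => T.Nonempty) with hI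
  set u : Finset (Fin n) → Finset (Fin n) → ℝ := fun A B =>
    ((1 + 2 : ℕ) : ℝ) * entropy n A.card + ((1 + 2 : ℕ) : ℝ) * entropy n B.card with hu
  have hbad := prob_exists_le hp I (fun A x => ∃ B ∈ I, u A B + L / 2 * ∑ a, ∑ b,
      bennett (2 * V A B a b) ≤ ∑ a, ∑ b, noise S x a b * V A B a b)
  have hle : ∑ A ∈ I, prob (edgeProb S) (fun x => ∃ B ∈ I, u A B + L / 2 * ∑ a, ∑ b,
      bennett (2 * V A B a b) ≤ ∑ a, ∑ b, noise S x a b * V A B a b) ≤ 1 / (n : ℝ) ^ 2 := by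
    calc _ ≤ ∑ A ∈ I, ∑ B ∈ I, Real.exp (-((1 + 2 : ℕ) * entropy n A.card)) *
          Real.exp (-((1 + 2 : ℕ) * entropy n B.card)) := by
          refine Finset.sum_le_sum fun A _ => (prob_exists_le hp _ _).trans ?_
          refine Finset.sum_le_sum fun B _ => ?_
          refine (prob_sum_noise_ge_le_of_const hS (V A B) (u A B)).trans (le_of_eq ?_)
          rw [← Real.exp_add, hu]
          congr 1
          ring
      _ = (∑ A ∈ I, Real.exp (-((1 + 2 : ℕ) * entropy n A.card))) *
          ∑ B ∈ I, Real.exp (-((1 + 2 : ℕ) * entropy n B.card)) := by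
          rw [Finset.sum_mul_sum]
      _ ≤ (1 / (n : ℝ) ^ 1) * (1 / (n : ℝ) ^ 1) := by
          have h1 := sum_exp_neg_entropy_le (n := n) 1
          exact mul_le_mul h1 h1 (Finset.sum_nonneg fun _ _ => (Real.exp_pos _).le) (by positivity)
      _ = _ := by rw [pow_one, pow_two, one_div_mul_one_div]
  refine le_trans (prob_mono hp fun x hx => ?_) (hbad.trans hle)
  by_contra hcon
  push Not at hcon
  refine hx fun A B hA hB => ?_
  have h1 := hcon A (by simpa [hI] using hA) B (by simpa [hI] using hB)
  set θ := discrepancyExponent L A B with hθ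
  have hsum : ∀ f : Fin n → Fin n → ℝ, ∑ a, ∑ b, (if a ∈ A then if b ∈ B then f a b else 0 else 0) =
      ∑ a ∈ A, ∑ b ∈ B, f a b := by
    intro f
    rw [← sum_ite_mem_const A]
    refine Finset.sum_congr rfl fun a _ => ?_
    split_ifs
    · rw [sum_ite_mem_const]
    · simp
  have h2 : ∑ a, ∑ b, bennett (2 * V A B a b) = A.card * B.card * bennett (2 * θ) := by
    have : ∀ a b, bennett (2 * V A B a b) =
        if a ∈ A then if b ∈ B then bennett (2 * θ) else 0 else 0 := by
      intro a b
      simp only [hV]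
      split_ifs <;> simp [bennett_zero, hθ]
    simp only [this]
    rw [hsum]
    simp
    ring
  have h3 : ∑ a, ∑ b, noise S x a b * V A B a b = θ * ∑ a ∈ A, ∑ b ∈ B, noise S x a b := by
    have : ∀ a b, noise S x a b * V A B a b =
        if a ∈ A then if b ∈ B then θ * noise S x a b else 0 else 0 := by
      intro a b
      simp only [hV]
      split_ifs <;> simp [hθ, mul_comm]
    simp only [this]
    rw [hsum]
    simp only [Finset.mul_sum]
  have h4 : edgeCount x A B ≤ ∑ a ∈ A, ∑ b ∈ B, noise S x a b + pairMean L A B := by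
    calc _ ≤ ∑ a ∈ A, ∑ b ∈ B, (noise S x a b + L) :=
          Finset.sum_le_sum fun a _ => Finset.sum_le_sum fun b _ => adj_le_noise_add hS x a b
      _ = _ := by
          simp only [Finset.sum_add_distrib, Finset.sum_const, nsmul_eq_mul, pairMean]
          ring
  rw [h2, h3] at h1
  have hAc : (1 : ℝ) ≤ A.card := by exact_mod_cast hA.card_pos
  have hBc : (1 : ℝ) ≤ B.card := by exact_mod_cast hB.card_pos
  have hmean : 0 < pairMean L A B := by unfold pairMean; positivity
  have hlam : u A B ≤ 6 * pairEntropy A B := by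
    have := le_max_left (entropy n A.card) (entropy n B.card)
    have := le_max_right (entropy n A.card) (entropy n B.card)
    simp only [hu, pairEntropy]
    push_cast
    linarith
  have hent : 0 < pairEntropy A B := by
    have h5 := le_entropy (card_le_of_finset A)
    have := le_max_left (entropy n A.card) (entropy n B.card)
    unfold pairEntropy
    linarith
  have hθpos : 0 < θ := by
    rw [hθ, discrepancyExponent]
    split_ifs with hc
    · norm_num
    · push Not at hc
      have : Real.exp 2 < pairEntropy A B / pairMean L A B := by
        rwa [lt_div_iff₀ hmean]
      have h6 := Real.log_lt_log (Real.exp_pos 2) this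
      rw [Real.log_exp] at h6
      linarith
  have hkey : θ * edgeCount x A B ≤
      6 * pairEntropy A B + pairMean L A B * Real.exp (2 * θ) / 2 := by
    have h7 : L / 2 * (A.card * B.card * bennett (2 * θ)) =
        pairMean L A B * Real.exp (2 * θ) / 2 - pairMean L A B / 2 - θ * pairMean L A B := by
      unfold bennett pairMean
      ring
    have h8 : θ * edgeCount x A B ≤
        θ * (∑ a ∈ A, ∑ b ∈ B, noise S x a b + pairMean L A B) := by gcongr
    rw [mul_add] at h8
    linarith
  have he := exp_two_lt
  constructor
  · intro hc
    have hθ1 : θ = 1 := by rw [hθ, discrepancyExponent, if_pos hc]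
    rw [hθ1] at hkey
    norm_num at hkey
    nlinarith
  · intro hc
    have hθ1 : θ = Real.log (pairEntropy A B / pairMean L A B) / 2 := by
      rw [hθ, discrepancyExponent, if_neg hc.not_ge]
    have h9 : Real.exp (2 * θ) = pairEntropy A B / pairMean L A B := by
      rw [hθ1, mul_div_cancel₀ _ (by norm_num), Real.exp_log (by positivity)]
    rw [h9, mul_div_cancel₀ _ hmean.ne'] at hkey
    rw [hθ1] at hkey
    linarith

end Events

section Events

variable {n : ℕ}

/-! #### Lattice vectors and light pairs -/

/-- Integer vectors of squared length at most `4 n`. -/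
def lattice (n : ℕ) : Finset (Fin n → ℤ) :=
  (Fintype.piFinset fun _ => Finset.Icc (-(2 * n : ℤ)) (2 * n)).filter
    fun ξ => ∑ a, (ξ a) ^ 2 ≤ 4 * n

lemma mem_lattice {ξ : Fin n → ℤ} : ξ ∈ lattice n ↔ ∑ a, (ξ a) ^ 2 ≤ 4 * n := by
  unfold lattice
  rw [Finset.mem_filter, Fintype.mem_piFinset]
  refine ⟨fun h => h.2, fun h => ⟨fun a => ?_, h⟩⟩
  have h1 : (ξ a) ^ 2 ≤ 4 * n :=
    (Finset.single_le_sum (f := fun a => (ξ a) ^ 2) (fun a _ => sq_nonneg _)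
      (Finset.mem_univ a)).trans h
  have hn : (1 : ℤ) ≤ n := by exact_mod_cast Fin.pos a
  rw [Finset.mem_Icc]
  constructor <;> nlinarith

lemma sum_exp_neg_sq_le (M : ℕ) :
    ∑ k ∈ Finset.Icc (-(M : ℤ)) M, Real.exp (-(k : ℝ) ^ 2) ≤ 3 - 2 * (1 / 2) ^ M := by
  induction M with
  | zero => simp; norm_num
  | succ M ih =>
    have hset : Finset.Icc (-((M + 1 : ℕ) : ℤ)) (M + 1 : ℕ) =
        insert ((M : ℤ) + 1) (insert (-((M : ℤ) + 1)) (Finset.Icc (-(M : ℤ)) M)) := by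
      ext k
      simp only [Finset.mem_Icc, Finset.mem_insert]
      push_cast
      omega
    rw [hset, Finset.sum_insert (by simp; omega), Finset.sum_insert (by simp)]
    have h1 : Real.exp (-((M : ℝ) + 1) ^ 2) ≤ (1 / 2) ^ (M + 1) := by
      have h2 : Real.exp (-1) ≤ 1 / 2 := by
        rw [Real.exp_neg, inv_eq_one_div]
        apply one_div_le_one_div_of_le (by norm_num)
        linarith [Real.exp_one_gt_d9]
      calc _ ≤ Real.exp (((M + 1 : ℕ) : ℝ) * (-1)) := by
            apply Real.exp_le_exp.2
            push_cast
            nlinarith [(Nat.cast_nonneg M : (0 : ℝ) ≤ M)]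
        _ = Real.exp (-1) ^ (M + 1) := by rw [Real.exp_nat_mul]
        _ ≤ _ := by gcongr
    push_cast
    have h3 : (-((-1 : ℝ) + -M)) = M + 1 := by ring
    have h4 : Real.exp (-(-((M : ℝ) + 1)) ^ 2) = Real.exp (-((M : ℝ) + 1) ^ 2) := by
      congr 1; ring
    rw [h4]
    have h5 : (1 / 2 : ℝ) ^ M = 2 * (1 / 2) ^ (M + 1) := by rw [pow_succ]; ring
    linarith

/-- Gaussian weights: e^{4n}∏e^{-ξ_a²} is at least 1 on the lattice, and its sum over the box
factorises into one-dimensional sums, each at most 3 ≤ e². -/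
lemma card_lattice_le : ((lattice n).card : ℝ) ≤ Real.exp (6 * n) := by
  have h1 : ((lattice n).card : ℝ) ≤
      ∑ ξ ∈ Fintype.piFinset fun _ : Fin n => Finset.Icc (-(2 * n : ℤ)) (2 * n),
        Real.exp (4 * n) * ∏ a, Real.exp (-(ξ a : ℝ) ^ 2) := by
    calc _ = ∑ ξ ∈ lattice n, (1 : ℝ) := by simp
      _ ≤ ∑ ξ ∈ lattice n, Real.exp (4 * n) * ∏ a, Real.exp (-(ξ a : ℝ) ^ 2) := by
          refine Finset.sum_le_sum fun ξ hξ => ?_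
          rw [← Real.exp_sum, ← Real.exp_add]
          apply Real.one_le_exp
          have := mem_lattice.1 hξ
          have h2 : ∑ a, (ξ a : ℝ) ^ 2 ≤ 4 * n := by exact_mod_cast this
          rw [Finset.sum_neg_distrib]
          linarith
      _ ≤ _ := Finset.sum_le_sum_of_subset_of_nonneg (Finset.filter_subset _ _)
          fun _ _ _ => by positivity
  refine h1.trans ?_
  rw [← Finset.mul_sum, ← Finset.prod_univ_sum (fun _ : Fin n => Finset.Icc (-(2 * n : ℤ)) (2 * n))
    (fun _ k => Real.exp (-(k : ℝ) ^ 2)), Finset.prod_const, Finset.card_univ, Fintype.card_fin]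
  have h3 := sum_exp_neg_sq_le (2 * n)
  push_cast at h3
  have h4 : ∑ k ∈ Finset.Icc (-(2 * n : ℤ)) (2 * n), Real.exp (-(k : ℝ) ^ 2) ≤ Real.exp 2 := by
    have h5 : (0 : ℝ) ≤ (1 / 2) ^ (2 * n) := by positivity
    have h6 := Real.add_one_le_exp (2 : ℝ)
    linarith
  calc _ ≤ Real.exp (4 * n) * Real.exp 2 ^ n := by
        gcongr
    _ = _ := by
        rw [← Real.exp_nat_mul, ← Real.exp_add]
        congr 1
        ring

/-- The pairs of coordinates with a small product. -/
def lightCoeff (d : ℝ) (ξ η : Fin n → ℤ) (a b : Fin n) : ℝ :=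
  if |(ξ a : ℝ) * η b| ≤ Real.sqrt d then (ξ a : ℝ) * η b else 0

/-- The light pairs contribute little to all bilinear forms on lattice vectors. -/
def LightEvent (S : Matrix (Fin n) (Fin n) ℝ) (d : ℝ) (x : Config n) : Prop :=
  ∀ ξ ∈ lattice n, ∀ η ∈ lattice n,
    ∑ a, ∑ b, noise S x a b * lightCoeff d ξ η a b ≤ 44 * n * Real.sqrt d

lemma sum_sq_lattice {ξ : Fin n → ℤ} (hξ : ξ ∈ lattice n) : ∑ a, (ξ a : ℝ) ^ 2 ≤ 4 * n := by
  exact_mod_cast mem_lattice.1 hξ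

lemma prob_not_lightEvent {S : Matrix (Fin n) (Fin n) ℝ} {L : ℝ} (hS : IsProbMatrix S L)
    (hL : 0 < L) (hn : 0 < n) :
    prob (edgeProb S) (fun x => ¬ LightEvent S (n * L) x) ≤ 1 / (n : ℝ) ^ 2 := by
  classical
  have hp := hS.edgeProb_mem
  have hn' : (0 : ℝ) < n := by positivity
  set d : ℝ := n * L with hd
  have hdpos : 0 < d := by positivity
  -- With this scaling, doubled light coefficients have modulus at most 1, where the Bennett
  -- function is at most the square.
  set θ : ℝ := 1 / (2 * Real.sqrt d) with hθ
  have hθpos : 0 < θ := by positivity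
  set V : (Fin n → ℤ) → (Fin n → ℤ) → Fin n → Fin n → ℝ := fun ξ η a b =>
    θ * lightCoeff d ξ η a b with hV
  have hbad := prob_exists_le hp (lattice n) (fun ξ x => ∃ η ∈ lattice n, (14 * n : ℝ) + L / 2 *
      ∑ a, ∑ b, bennett (2 * V ξ η a b) ≤ ∑ a, ∑ b, noise S x a b * V ξ η a b)
  have hle : ∑ ξ ∈ lattice n, prob (edgeProb S) (fun x => ∃ η ∈ lattice n, (14 * n : ℝ) + L / 2 *
      ∑ a, ∑ b, bennett (2 * V ξ η a b) ≤ ∑ a, ∑ b, noise S x a b * V ξ η a b) ≤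
      1 / (n : ℝ) ^ 2 := by
    -- The two lattice vectors cost e^{12n}, so the exponent 14n leaves e^{-2n} ≤ n^{-2}.
    calc _ ≤ ∑ ξ ∈ lattice n, ∑ η ∈ lattice n, Real.exp (-(14 * n)) := by
          refine Finset.sum_le_sum fun ξ _ => (prob_exists_le hp _ _).trans ?_
          exact Finset.sum_le_sum fun η _ => prob_sum_noise_ge_le_of_const hS (V ξ η) _
      _ = (lattice n).card * ((lattice n).card * Real.exp (-(14 * n))) := by simp
      _ ≤ Real.exp (6 * n) * (Real.exp (6 * n) * Real.exp (-(14 * n))) := by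
          gcongr <;> exact card_lattice_le
      _ = 1 / Real.exp n ^ 2 := by
          rw [← Real.exp_nat_mul, one_div, ← Real.exp_neg, ← Real.exp_add, ← Real.exp_add]
          congr 1
          push_cast
          ring
      _ ≤ _ := by
          apply one_div_le_one_div_of_le (by positivity)
          gcongr
          linarith [Real.add_one_le_exp (n : ℝ)]
  refine le_trans (prob_mono hp fun x hx => ?_) (hbad.trans hle)
  by_contra hcon
  push Not at hcon
  refine hx fun ξ hξ η hη => ?_
  have h1 := hcon ξ hξ η hη
  have hsq : Real.sqrt d ^ 2 = d := Real.sq_sqrt hdpos.le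
  have hsqpos : 0 < Real.sqrt d := Real.sqrt_pos.2 hdpos
  have h2 : ∑ a, ∑ b, bennett (2 * V ξ η a b) ≤ 16 * n ^ 2 / d := by
    calc _ ≤ ∑ a, ∑ b, ((ξ a : ℝ) ^ 2 * (η b : ℝ) ^ 2) / d := by
          refine Finset.sum_le_sum fun a _ => Finset.sum_le_sum fun b _ => ?_
          simp only [hV, lightCoeff]
          split_ifs with hc
          · have h3 : 2 * (θ * ((ξ a : ℝ) * η b)) = ((ξ a : ℝ) * η b) / Real.sqrt d := by
              rw [hθ]; field_simp
            rw [h3]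
            refine (bennett_le_sq ?_).trans (le_of_eq ?_)
            · rw [abs_div, abs_of_pos hsqpos, div_le_one hsqpos]
              exact hc
            · rw [div_pow, hsq, mul_pow]
          · simp only [mul_zero, bennett_zero]
            positivity
      _ = (∑ a, (ξ a : ℝ) ^ 2) * (∑ b, (η b : ℝ) ^ 2) / d := by
          rw [Finset.sum_mul_sum, Finset.sum_div]
          simp only [Finset.sum_div]
      _ ≤ (4 * n) * (4 * n) / d := by
          have h4 := sum_sq_lattice hξ
          have h5 := sum_sq_lattice hη
          gcongr
      _ = _ := by ring
  have h3 : ∑ a, ∑ b, noise S x a b * V ξ η a b =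
      θ * ∑ a, ∑ b, noise S x a b * lightCoeff d ξ η a b := by
    simp only [hV, Finset.mul_sum]
    refine Finset.sum_congr rfl fun a _ => Finset.sum_congr rfl fun b _ => by ring
  have h4 : L / 2 * ∑ a, ∑ b, bennett (2 * V ξ η a b) ≤ 8 * n := by
    calc _ ≤ L / 2 * (16 * n ^ 2 / d) := by gcongr
      _ = _ := by rw [hd]; field_simp; norm_num
  rw [h3] at h1
  have h5 : θ * ∑ a, ∑ b, noise S x a b * lightCoeff d ξ η a b ≤ θ * (44 * n * Real.sqrt d) := by
    have : θ * (44 * n * Real.sqrt d) = 22 * n := by rw [hθ]; field_simp; norm_num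
    linarith
  exact le_of_mul_le_mul_left h5 hθpos

/-! #### Column sums -/

/-- The sign encoded by a Boolean. -/
def boolSign (b : Bool) : ℝ := if b then 1 else -1

lemma abs_boolSign (b : Bool) : |boolSign b| = 1 := by unfold boolSign; split_ifs <;> simp

/-- The sum of the rows in `U` of the noise matrix. -/
def rowSum (S : Matrix (Fin n) (Fin n) ℝ) (x : Config n) (U : Finset (Fin n)) (c : Fin n) : ℝ :=
  ∑ a ∈ U, noise S x a c

/-- Uniform control of the sums of the rows in each set of a family. -/
def RowSumEvent {ι : Type*} (S : Matrix (Fin n) (Fin n) ℝ) (L : ℝ) (U : ι → Finset (Fin n))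
    (m : ι → ℝ) (x : Config n) : Prop :=
  ∀ i σ, ∀ C : Finset (Fin n), C.Nonempty →
    boolSign σ * ∑ c ∈ C, rowSum S x (U i) c ≤ 21 * Real.sqrt (m i * L) * entropy n C.card

/-- The coefficients are ±θ with θ = 1/(2√(mL)), and mL ≥ 1 keeps the doubled ones within [-1,1].
The variance term is then at most half an entropy, and 10 + 1/2 entropies divided by θ give the
constant 21. The power 8 of n leaves room for polynomially many sets U. -/
lemma prob_not_rowSumEvent {ι : Type*} [Fintype ι] {S : Matrix (Fin n) (Fin n) ℝ} {L : ℝ}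
    (hS : IsProbMatrix S L) (hL : 0 < L) (U : ι → Finset (Fin n)) (m : ι → ℝ)
    (hU : ∀ i, ((U i).card : ℝ) ≤ m i) (hm : ∀ i, 1 ≤ m i * L) :
    prob (edgeProb S) (fun x => ¬ RowSumEvent S L U m x) ≤
      (2 * Fintype.card ι) / (n : ℝ) ^ 8 := by
  classical
  set θ : ι → ℝ := fun i => 1 / (2 * Real.sqrt (m i * L)) with hθ
  set V : ι × Bool → Finset (Fin n) → Fin n → Fin n → ℝ := fun j C a b =>
    if a ∈ U j.1 then if b ∈ C then θ j.1 * boolSign j.2 else 0 else 0 with hV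
  have h := prob_exists_nonempty_le hS (ι := ι × Bool)
    (fun j C x => ((8 + 2 : ℕ) : ℝ) * entropy n C.card + L / 2 * ∑ a, ∑ b,
      bennett (2 * V j C a b) ≤ ∑ a, ∑ b, noise S x a b * V j C a b) 8
    (fun j C _ => prob_sum_noise_ge_le_of_const hS (V j C) _)
  have hcard : ((Fintype.card (ι × Bool) : ℕ) : ℝ) = 2 * Fintype.card ι := by
    rw [Fintype.card_prod]; simp [mul_comm]
  rw [hcard] at h
  refine (prob_mono hS.edgeProb_mem fun x hx => ?_).trans h
  by_contra hcon
  push Not at hcon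
  refine hx fun i σ C hC => ?_
  have h1 := hcon (i, σ) C hC
  have hsum : ∀ f : Fin n → Fin n → ℝ,
      ∑ a, ∑ b, (if a ∈ U i then if b ∈ C then f a b else 0 else 0) =
      ∑ a ∈ U i, ∑ b ∈ C, f a b := by
    intro f
    rw [← sum_ite_mem_const (U i)]
    refine Finset.sum_congr rfl fun a _ => ?_
    split_ifs
    · rw [sum_ite_mem_const]
    · simp
  have hs1 : 1 ≤ Real.sqrt (m i * L) := Real.one_le_sqrt.2 (hm i)
  have hs2 : Real.sqrt (m i * L) ^ 2 = m i * L := Real.sq_sqrt (by linarith [hm i])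
  have hθpos : 0 < θ i := by simp only [hθ]; positivity
  have h2 : ∑ a, ∑ b, bennett (2 * V (i, σ) C a b) ≤ m i * C.card * (1 / (m i * L)) := by
    calc _ ≤ ∑ a, ∑ b, (if a ∈ U i then if b ∈ C then 1 / (m i * L) else 0 else 0) := by
          refine Finset.sum_le_sum fun a _ => Finset.sum_le_sum fun b _ => ?_
          simp only [hV]
          split_ifs
          · have h3 : |2 * (θ i * boolSign σ)| = 1 / Real.sqrt (m i * L) := by
              rw [abs_mul, abs_mul, abs_boolSign, abs_of_pos hθpos]
              simp only [hθ, abs_two]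
              field_simp
            refine (bennett_le_sq ?_).trans (le_of_eq ?_)
            · rw [h3, div_le_one (by linarith)]
              exact hs1
            · rw [← sq_abs, h3, div_pow, hs2, one_pow]
          all_goals simp [bennett_zero]
      _ = (U i).card * C.card * (1 / (m i * L)) := by
          rw [hsum]
          simp
          ring
      _ ≤ _ := by
          have := hU i
          have := hm i
          gcongr
  have h3 : ∑ a, ∑ b, noise S x a b * V (i, σ) C a b =
      θ i * (boolSign σ * ∑ c ∈ C, rowSum S x (U i) c) := by
    have : ∀ a b, noise S x a b * V (i, σ) C a b =
        if a ∈ U i then if b ∈ C then θ i * (boolSign σ * noise S x a b) else 0 else 0 := by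
      intro a b
      simp only [hV]
      split_ifs <;> ring
    simp only [this]
    rw [hsum]
    simp only [rowSum]
    rw [Finset.sum_comm]
    simp only [Finset.mul_sum]
  rw [h3] at h1
  have hmpos : 0 < m i := pos_of_mul_pos_left (by linarith [hm i]) hL.le
  have h4 : L / 2 * ∑ a, ∑ b, bennett (2 * V (i, σ) C a b) ≤ entropy n C.card / 2 := by
    calc _ ≤ L / 2 * (m i * C.card * (1 / (m i * L))) := by gcongr
      _ = C.card / 2 := by field_simp
      _ ≤ _ := by
          have := le_entropy (card_le_of_finset C)
          linarith
  have h5 : θ i * (boolSign σ * ∑ c ∈ C, rowSum S x (U i) c) ≤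
      θ i * (21 * Real.sqrt (m i * L) * entropy n C.card) := by
    have : θ i * (21 * Real.sqrt (m i * L) * entropy n C.card) = 21 / 2 * entropy n C.card := by
      simp only [hθ]
      field_simp
    push_cast at h1
    linarith
  exact le_of_mul_le_mul_left h5 hθpos

/-! #### Linear forms of the rows -/

/-- Uniform control of the correlations of the rows with a family of vectors. -/
def LinearEvent {ι : Type*} (S : Matrix (Fin n) (Fin n) ℝ) (L c₀ : ℝ) (q : ι → Fin n → ℝ)
    (x : Config n) : Prop :=
  ∀ i, ∀ T : Finset (Fin n), T.Nonempty →
    ∑ b ∈ T, ∑ c, noise S x b c * q i c ≤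
      6 * L / c₀ * entropy n T.card + 2 * c₀ * T.card * ∑ c, q i c ^ 2

/-- Scaling by c₀/L makes the doubled coefficients at most 2c₀ ≤ 1. The parameter c₀ trades the
entropy cost L/c₀ against a multiple c₀ of the squared norm, which is later absorbed by the
separation. -/
lemma prob_not_linearEvent {ι : Type*} [Fintype ι] {S : Matrix (Fin n) (Fin n) ℝ} {L c₀ : ℝ}
    (hS : IsProbMatrix S L) (hL : 0 < L) (hc : 0 < c₀) (hc1 : c₀ ≤ 1 / 2) (q : ι → Fin n → ℝ)
    (hq : ∀ i c, |q i c| ≤ L) :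
    prob (edgeProb S) (fun x => ¬ LinearEvent S L c₀ q x) ≤ Fintype.card ι / (n : ℝ) ^ 4 := by
  classical
  set θ : ℝ := c₀ / L with hθ
  have hθpos : 0 < θ := by positivity
  set V : ι → Finset (Fin n) → Fin n → Fin n → ℝ := fun i T a b =>
    if a ∈ T then θ * q i b else 0 with hV
  have h := prob_exists_nonempty_le hS (ι := ι)
    (fun i T x => ((4 + 2 : ℕ) : ℝ) * entropy n T.card + L / 2 * ∑ a, ∑ b,
      bennett (2 * V i T a b) ≤ ∑ a, ∑ b, noise S x a b * V i T a b) 4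
    (fun i T _ => prob_sum_noise_ge_le_of_const hS (V i T) _)
  refine (prob_mono hS.edgeProb_mem fun x hx => ?_).trans h
  by_contra hcon
  push Not at hcon
  refine hx fun i T hT => ?_
  have h1 := hcon i T hT
  have h2 : ∑ a, ∑ b, bennett (2 * V i T a b) ≤ T.card * (4 * θ ^ 2 * ∑ c, q i c ^ 2) := by
    calc _ ≤ ∑ a, if a ∈ T then 4 * θ ^ 2 * ∑ c, q i c ^ 2 else 0 := by
          refine Finset.sum_le_sum fun a _ => ?_
          simp only [hV]
          split_ifs
          · rw [Finset.mul_sum]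
            refine Finset.sum_le_sum fun b _ => (bennett_le_sq ?_).trans (le_of_eq (by ring))
            rw [abs_mul, abs_mul, abs_two, abs_of_pos hθpos]
            calc 2 * (θ * |q i b|) ≤ 2 * (θ * L) := by gcongr; exact hq i b
              _ = 2 * c₀ := by rw [hθ]; field_simp
              _ ≤ 1 := by linarith
          · simp [bennett_zero]
      _ = _ := by rw [sum_ite_mem_const]; simp
  have h3 : ∑ a, ∑ b, noise S x a b * V i T a b =
      θ * ∑ b ∈ T, ∑ c, noise S x b c * q i c := by
    rw [Finset.mul_sum, ← sum_ite_mem_const T]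
    refine Finset.sum_congr rfl fun a _ => ?_
    simp only [hV]
    split_ifs
    · rw [Finset.mul_sum]
      exact Finset.sum_congr rfl fun b _ => by ring
    · simp
  rw [h3] at h1
  have h4 : L / 2 * ∑ a, ∑ b, bennett (2 * V i T a b) ≤
      L / 2 * (T.card * (4 * θ ^ 2 * ∑ c, q i c ^ 2)) := by gcongr
  have h5 : θ * ∑ b ∈ T, ∑ c, noise S x b c * q i c ≤ θ * (6 * L / c₀ * entropy n T.card +
      2 * c₀ * T.card * ∑ c, q i c ^ 2) := by
    have : θ * (6 * L / c₀ * entropy n T.card + 2 * c₀ * T.card * ∑ c, q i c ^ 2) =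
        6 * entropy n T.card + L / 2 * (T.card * (4 * θ ^ 2 * ∑ c, q i c ^ 2)) := by
      rw [hθ]
      field_simp
      ring
    push_cast at h1
    linarith
  exact le_of_mul_le_mul_left h5 hθpos

/-! #### Correlations between rows -/

lemma adj_update_of_ne (x : Config n) (e : Edge n) (v : Bool) {a c : Fin n}
    (h1 : ¬ (e.1.1 = a ∧ e.1.2 = c)) (h2 : ¬ (e.1.1 = c ∧ e.1.2 = a)) :
    adj (Function.update x e v) a c = adj x a c := by
  simp only [adj, Matrix.of_apply]
  split_ifs with h h'
  · rw [Function.update_of_ne]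
    rintro rfl
    exact h1 ⟨rfl, rfl⟩
  · rw [Function.update_of_ne]
    rintro rfl
    exact h2 ⟨rfl, rfl⟩
  · rfl

lemma noise_update_of_ne (S : Matrix (Fin n) (Fin n) ℝ) (x : Config n) (e : Edge n) (v : Bool)
    {a c : Fin n} (h1 : ¬ (e.1.1 = a ∧ e.1.2 = c)) (h2 : ¬ (e.1.1 = c ∧ e.1.2 = a)) :
    noise S (Function.update x e v) a c = noise S x a c := by
  simp only [noise, Matrix.of_apply, adj_update_of_ne x e v h1 h2]

/-- Uniform control of the correlations between the rows outside a set and the sum of the rows in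
this set. -/
def BilinearEvent {ι : Type*} (S : Matrix (Fin n) (Fin n) ℝ) (L c₀ : ℝ)
    (U : ι → Finset (Fin n)) (m : ι → ℝ) (x : Config n) : Prop :=
  ∀ i σ, ∀ T : Finset (Fin n), T.Nonempty → Disjoint (U i) T →
    boolSign σ * (∑ b ∈ T, ∑ c, noise S x b c * rowSum S x (U i) c) / m i ≤
      L / c₀ * (20 * entropy n T.card + L / 2 * T.card *
        ∑ c, bennett (boolSign σ * (2 * c₀ / (L * m i)) * rowSum S x (U i) c))

/-- Decoupling. The coefficient at column c involves the edges from c to U, and U avoids T. For c in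
T the form uses edges inside T, while the coefficients use edges with one end outside T. For c
outside T the form uses edges with exactly one end in T, while the coefficients use edges with no
end in T. In both cases the coefficients do not depend on the edges of the form, as Bennett's
inequality with random coefficients requires. -/
lemma prob_bilinear_part_le {ι : Type*} [Fintype ι] {S : Matrix (Fin n) (Fin n) ℝ} {L : ℝ}
    (hS : IsProbMatrix S L) (θ : ι → ℝ)
    (U : ι → Finset (Fin n)) (inside : Prop) [Decidable inside] :
    prob (edgeProb S) (fun x => ∃ (j : ι × Bool) (T : Finset (Fin n)), T.Nonempty ∧
      (Disjoint (U j.1) T ∧ ((8 + 2 : ℕ) : ℝ) * entropy n T.card + L / 2 * ∑ _b ∈ T,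
        ∑ c ∈ Finset.univ.filter (fun c => c ∈ T ↔ inside),
          bennett (2 * (boolSign j.2 * θ j.1 * rowSum S x (U j.1) c)) ≤
        ∑ b ∈ T, ∑ c ∈ Finset.univ.filter (fun c => c ∈ T ↔ inside),
          noise S x b c * (boolSign j.2 * θ j.1 * rowSum S x (U j.1) c))) ≤
      (2 * Fintype.card ι) / (n : ℝ) ^ 8 := by
  classical
  have hcard : ((Fintype.card (ι × Bool) : ℕ) : ℝ) = 2 * Fintype.card ι := by
    rw [Fintype.card_prod]; simp [mul_comm]
  rw [← hcard]
  refine prob_exists_nonempty_le hS (ι := ι × Bool) _ 8 fun j T _ => ?_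
  by_cases hdisj : Disjoint (U j.1) T
  swap
  · refine le_trans (le_of_eq ?_) (Real.exp_pos _).le
    simp [hdisj, prob, expect]
  set V : Config n → Fin n → Fin n → ℝ := fun x b c =>
    if b ∈ T then if (c ∈ T ↔ inside) then boolSign j.2 * θ j.1 * rowSum S x (U j.1) c else 0
    else 0 with hV
  set F : Finset (Edge n) := Finset.univ.filter fun e =>
    (e.1.1 ∈ T ∧ (e.1.2 ∈ T ↔ inside)) ∨ (e.1.2 ∈ T ∧ (e.1.1 ∈ T ↔ inside)) with hF
  have hsum : ∀ f : Fin n → Fin n → ℝ,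
      ∑ b, ∑ c, (if b ∈ T then if (c ∈ T ↔ inside) then f b c else 0 else 0) =
      ∑ b ∈ T, ∑ c ∈ Finset.univ.filter (fun c => c ∈ T ↔ inside), f b c := by
    intro f
    rw [← sum_ite_mem_const T]
    refine Finset.sum_congr rfl fun a _ => ?_
    split_ifs
    · rw [Finset.sum_filter]
    · simp
  have hmain := prob_sum_noise_ge_le hS F V ?_ ?_ (((8 + 2 : ℕ) : ℝ) * entropy n T.card)
  · refine le_trans (prob_mono hS.edgeProb_mem fun x hx => ?_) hmain
    have h2 : ∑ b, ∑ c, bennett (2 * V x b c) = ∑ b ∈ T,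
        ∑ c ∈ Finset.univ.filter (fun c => c ∈ T ↔ inside),
          bennett (2 * (boolSign j.2 * θ j.1 * rowSum S x (U j.1) c)) := by
      rw [← hsum]
      refine Finset.sum_congr rfl fun b _ => Finset.sum_congr rfl fun c _ => ?_
      simp only [hV]
      split_ifs <;> simp [bennett_zero]
    have h3 : ∑ b, ∑ c, noise S x b c * V x b c = ∑ b ∈ T,
        ∑ c ∈ Finset.univ.filter (fun c => c ∈ T ↔ inside),
          noise S x b c * (boolSign j.2 * θ j.1 * rowSum S x (U j.1) c) := by
      rw [← hsum]
      refine Finset.sum_congr rfl fun b _ => Finset.sum_congr rfl fun c _ => ?_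
      simp only [hV]
      split_ifs <;> simp
    rw [h2, h3]
    exact hx.2
  · intro x a b hab hnot
    simp only [hV]
    split_ifs with h1 h2
    · refine absurd ?_ hnot
      rcases lt_or_gt_of_ne hab with h' | h'
      · exact Or.inl ⟨h', Finset.mem_filter.2 ⟨Finset.mem_univ _, Or.inl ⟨h1, h2⟩⟩⟩
      · exact Or.inr ⟨h', Finset.mem_filter.2 ⟨Finset.mem_univ _, Or.inr ⟨h1, h2⟩⟩⟩
    · rfl
    · rfl
  · intro e he x v
    have he' := (Finset.mem_filter.1 he).2
    funext b c
    simp only [hV]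
    split_ifs with h1 h2
    · congr 1
      unfold rowSum
      refine Finset.sum_congr rfl fun a ha => ?_
      have haT : a ∉ T := Finset.disjoint_left.1 hdisj ha
      refine noise_update_of_ne S x e v ?_ ?_
      · rintro ⟨rfl, rfl⟩
        rcases he' with h | h
        · exact haT h.1
        · by_cases hin : inside
          · exact haT (h.2.2 hin)
          · exact hin (h2.1 h.1)
      · rintro ⟨rfl, rfl⟩
        rcases he' with h | h
        · by_cases hin : inside
          · exact haT (h.2.2 hin)
          · exact hin (h2.1 h.1)
        · exact haT h.1
    · rfl
    · rfl

lemma prob_not_bilinearEvent {ι : Type*} [Fintype ι] {S : Matrix (Fin n) (Fin n) ℝ} {L c₀ : ℝ}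
    (hS : IsProbMatrix S L) (hL : 0 < L) (hc : 0 < c₀)
    (U : ι → Finset (Fin n)) (m : ι → ℝ) (hm : ∀ i, 0 < m i) :
    prob (edgeProb S) (fun x => ¬ BilinearEvent S L c₀ U m x) ≤
      (4 * Fintype.card ι) / (n : ℝ) ^ 8 := by
  classical
  set θ : ι → ℝ := fun i => c₀ / (L * m i) with hθ
  -- The columns in T and those outside T cost 10 entropies each, which gives the 20 of the event.
  have h1 := prob_bilinear_part_le hS θ U True
  have h2 := prob_bilinear_part_le hS θ U False
  have h3 := (prob_or_le hS.edgeProb_mem _ _).trans (add_le_add h1 h2)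
  have h4 : (2 * Fintype.card ι : ℝ) / (n : ℝ) ^ 8 + 2 * Fintype.card ι / (n : ℝ) ^ 8 =
      (4 * Fintype.card ι) / (n : ℝ) ^ 8 := by ring
  rw [h4] at h3
  refine (prob_mono hS.edgeProb_mem fun x hx => ?_).trans h3
  by_contra hcon
  push Not at hcon
  obtain ⟨hin, hout⟩ := hcon
  refine hx fun i σ T hT hdisj => ?_
  have h5 := hin (i, σ) T hT hdisj
  have h6 := hout (i, σ) T hT hdisj
  simp only [iff_true, iff_false] at h5 h6
  have hsplit : ∀ f : Fin n → ℝ, ∑ c, f c =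
      ∑ c ∈ Finset.univ.filter (fun c => c ∈ T), f c +
        ∑ c ∈ Finset.univ.filter (fun c => c ∉ T), f c := fun f =>
    (Finset.sum_filter_add_sum_filter_not _ _ _).symm
  have hθpos : 0 < θ i := by have := hm i; simp only [hθ]; positivity
  have h7 : ∑ b ∈ T, ∑ c, noise S x b c * (boolSign σ * θ i * rowSum S x (U i) c) ≤
      20 * entropy n T.card + L / 2 * ∑ _b ∈ T,
        ∑ c, bennett (2 * (boolSign σ * θ i * rowSum S x (U i) c)) := by
    simp only [hsplit, Finset.sum_add_distrib]
    push_cast at h5 h6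
    rw [mul_add]
    linarith
  have h8 : ∑ b ∈ T, ∑ c, noise S x b c * (boolSign σ * θ i * rowSum S x (U i) c) =
      θ i * (boolSign σ * ∑ b ∈ T, ∑ c, noise S x b c * rowSum S x (U i) c) := by
    simp only [Finset.mul_sum]
    exact Finset.sum_congr rfl fun b _ => Finset.sum_congr rfl fun c _ => by ring
  have h9 : ∀ c, 2 * (boolSign σ * θ i * rowSum S x (U i) c) =
      boolSign σ * (2 * c₀ / (L * m i)) * rowSum S x (U i) c := by
    intro c
    simp only [hθ]
    ring
  simp only [h9, Finset.sum_const, nsmul_eq_mul] at h7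
  rw [h8] at h7
  have hmi := hm i
  have h10 : boolSign σ * (∑ b ∈ T, ∑ c, noise S x b c * rowSum S x (U i) c) / m i =
      L / c₀ * (θ i * (boolSign σ * ∑ b ∈ T, ∑ c, noise S x b c * rowSum S x (U i) c)) := by
    simp only [hθ]
    field_simp
  rw [h10]
  have : 0 < L / c₀ := by positivity
  gcongr
  linarith

end Events

/-! ### The trimmed operator norm -/

section Heavy

variable {n : ℕ}

lemma sum_two_pow_le (R : ℕ) {Y : ℝ} (hY : 0 ≤ Y) :
    ∑ s ∈ Finset.range R, (if (2 : ℝ) ^ s ≤ Y then (2 : ℝ) ^ s else 0) ≤ 2 * Y := by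
  induction R with
  | zero => simpa using hY
  | succ R ih =>
    rw [Finset.sum_range_succ]
    split_ifs with h
    · have h1 : ∑ s ∈ Finset.range R, (if (2 : ℝ) ^ s ≤ Y then (2 : ℝ) ^ s else 0) ≤
          ∑ s ∈ Finset.range R, (2 : ℝ) ^ s :=
        Finset.sum_le_sum fun s _ => by
          split_ifs
          · exact le_rfl
          · positivity
      have h2 : ∑ s ∈ Finset.range R, (2 : ℝ) ^ s = 2 ^ R - 1 := by
        rw [geom_sum_eq (by norm_num)]
        norm_num
      linarith
    · linarith

lemma sum_inv_two_pow_le (R : ℕ) : ∑ t ∈ Finset.range R, 1 / (2 : ℝ) ^ t ≤ 2 := by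
  have h : ∑ t ∈ Finset.range R, 1 / (2 : ℝ) ^ t = 2 - 2 / 2 ^ R := by
    induction R with
    | zero => simp
    | succ R ih =>
      rw [Finset.sum_range_succ, ih, pow_succ]
      field_simp
      ring
  rw [h]
  have : (0 : ℝ) ≤ 2 / 2 ^ R := by positivity
  linarith

lemma edgeCount_comm (x : Config n) (A B : Finset (Fin n)) :
    edgeCount x A B = edgeCount x B A := by
  refine Finset.sum_comm.trans ?_
  exact Finset.sum_congr rfl fun b _ => Finset.sum_congr rfl fun a _ => adj_comm x a b

lemma pairEntropy_comm (A B : Finset (Fin n)) : pairEntropy A B = pairEntropy B A := max_comm _ _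

lemma pairMean_comm (L : ℝ) (A B : Finset (Fin n)) : pairMean L A B = pairMean L B A := by
  unfold pairMean; ring

lemma edgeCount_nonneg (x : Config n) (A B : Finset (Fin n)) : 0 ≤ edgeCount x A B :=
  Finset.sum_nonneg fun _ _ => Finset.sum_nonneg fun _ _ => adj_nonneg _ _ _

lemma edgeCount_le_card_mul (x : Config n) {A B : Finset (Fin n)} {τ : ℝ}
    (hA : ∀ a ∈ A, degree x a ≤ τ) : edgeCount x A B ≤ A.card * τ := by
  calc _ ≤ ∑ a ∈ A, τ := by
        refine Finset.sum_le_sum fun a ha => le_trans ?_ (hA a ha)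
        exact Finset.sum_le_sum_of_subset_of_nonneg (Finset.subset_univ _)
          fun _ _ _ => adj_nonneg _ _ _
    _ = _ := by simp

/-- The exponential of a fraction of the logarithmic factor. -/
def expFactor (n b : ℕ) : ℝ := Real.exp (logFactor n b / 16)

/-- Let y be the factor and w = 2^t. If y² ≤ w, the first term suffices. Otherwise w² ≤ w⁷ ≤ y¹⁴,
and y¹⁶b = en gives the second. -/
lemma expFactor_sq_mul_le {b t : ℕ} (hb : b ≤ n) :
    expFactor n b ^ 2 * b * 2 ^ t ≤ b * 4 ^ t + 3 * n * (1 / 2 ^ t) := by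
  rcases Nat.eq_zero_or_pos b with h0 | h0
  · subst h0
    simp
  have hn : 0 < n := h0.trans_le hb
  have hb' : (0 : ℝ) < b := by positivity
  set y := expFactor n b with hy
  have hypos : 0 < y := Real.exp_pos _
  have hy16 : y ^ 16 * b = Real.exp 1 * n := by
    have : y ^ 16 = Real.exp 1 * (n / b) := by
      rw [← exp_logFactor hn h0, hy, expFactor, ← Real.exp_nat_mul]
      congr 1
      push_cast
      ring
    rw [this]
    field_simp
  have h4 : (4 : ℝ) ^ t = 2 ^ t * 2 ^ t := by rw [← mul_pow]; norm_num
  have h2 : (1 : ℝ) ≤ 2 ^ t := one_le_pow₀ (by norm_num)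
  set w : ℝ := 2 ^ t with hw
  rcases le_or_gt (y ^ 2) w with hc | hc
  · have h5 : y ^ 2 * b * w ≤ w * b * w := by gcongr
    have h6 : (0 : ℝ) ≤ 3 * n * (1 / w) := by positivity
    rw [h4]
    linarith
  · have h7 : w ^ 7 ≤ y ^ 14 := by
      calc w ^ 7 ≤ (y ^ 2) ^ 7 := by gcongr
        _ = _ := by ring
    have h8 : w ^ 2 ≤ w ^ 7 := pow_le_pow_right₀ h2 (by norm_num)
    have h9 : y ^ 2 * b * w * w ≤ 3 * n := by
      calc y ^ 2 * b * w * w = y ^ 2 * b * w ^ 2 := by ring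
        _ ≤ y ^ 2 * b * y ^ 14 := by
            have := h8.trans h7
            gcongr
        _ = y ^ 16 * b := by ring
        _ = Real.exp 1 * n := hy16
        _ ≤ _ := by
            have := Real.exp_one_lt_d9
            gcongr
            linarith
    have h10 : y ^ 2 * b * w ≤ 3 * n * (1 / w) := by
      rw [mul_one_div, le_div_iff₀ (by positivity)]
      exact h9
    have h11 : (0 : ℝ) ≤ b * 4 ^ t := by positivity
    linarith

lemma logFactor_le_expFactor (b : ℕ) : logFactor n b ≤ 16 * expFactor n b := by
  unfold expFactor
  linarith [Real.add_one_le_exp (logFactor n b / 16)]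

/-- Beyond the mean, the number of edges between two sets is essentially at most the size of the
larger one. -/
lemma edgeCount_le_of_entropy_lt {x : Config n} {A B : Finset (Fin n)} {L q : ℝ} {p : ℝ}
    (hL : 0 < L) (hq : 0 < q) (hnL : n * L = q ^ 2) (hA : A.Nonempty)
    (hB : B.Nonempty) (hAp : A.card * p ^ 2 ≤ 4 * n)
    (hent : entropy n A.card ≤ entropy n B.card)
    (hlt : Real.exp 2 * pairMean L A B < pairEntropy A B)
    (hdis : edgeCount x A B * Real.log (pairEntropy A B / pairMean L A B) ≤
      17 * pairEntropy A B) :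
    edgeCount x A B ≤ 136 * B.card ∨
      (edgeCount x A B ≤ 17 / 2 * B.card * logFactor n B.card ∧
        p ≤ 2 * q * expFactor n B.card) := by
  have ha : (0 : ℝ) < A.card := by exact_mod_cast hA.card_pos
  have hb : (0 : ℝ) < B.card := by exact_mod_cast hB.card_pos
  have hlam : pairEntropy A B = B.card * logFactor n B.card := max_eq_right hent
  have hl1 := one_le_logFactor (card_le_of_finset B)
  have hmean : 0 < pairMean L A B := by unfold pairMean; positivity
  have he := edgeCount_nonneg x A B
  set ℓ := logFactor n B.card with hℓ
  set Λ := Real.log (pairEntropy A B / pairMean L A B) with hΛ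
  have hpos : 0 < pairEntropy A B / pairMean L A B := by rw [hlam]; positivity
  -- If Λ is at least ℓ/8, dividing the discrepancy bound by it leaves a multiple of |B|. Otherwise
  -- Λ ≥ 2 still gives the bound with the logarithm, and the entropy is at most e^{ℓ/8} times the
  -- mean; this bounds |A| below, hence the height p above through |A|p² ≤ 4n.
  rcases le_or_gt (ℓ / 8) Λ with hc | hc
  · left
    have h1 : edgeCount x A B * (ℓ / 8) ≤ 17 * (B.card * ℓ) := by
      rw [← hlam]
      exact (mul_le_mul_of_nonneg_left hc he).trans hdis
    have h2 : edgeCount x A B * ℓ ≤ 136 * B.card * ℓ := by linarith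
    exact le_of_mul_le_mul_right h2 (by linarith)
  · right
    have h2 : 2 ≤ Λ := by
      rw [hΛ, Real.le_log_iff_exp_le hpos, le_div_iff₀ hmean]
      exact hlt.le
    constructor
    · rw [hlam] at hdis
      nlinarith
    · have h3 : pairEntropy A B / pairMean L A B < Real.exp (ℓ / 8) := by
        rw [← Real.log_lt_iff_lt_exp hpos]
        exact hc
      have h4 : Real.exp (ℓ / 8) = expFactor n B.card ^ 2 := by
        rw [expFactor, ← Real.exp_nat_mul]
        congr 1
        push_cast
        ring
      rw [h4, div_lt_iff₀ hmean, hlam] at h3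
      have h5 : B.card * ℓ < B.card * (expFactor n B.card ^ 2 * (L * A.card)) := by
        unfold pairMean at h3
        linarith
      have h6 : ℓ < expFactor n B.card ^ 2 * (L * A.card) := lt_of_mul_lt_mul_left h5 hb.le
      have h7 : p ^ 2 ≤ (2 * q * expFactor n B.card) ^ 2 := by
        calc p ^ 2 ≤ expFactor n B.card ^ 2 * (L * A.card) * p ^ 2 := by
              have : (1 : ℝ) ≤ expFactor n B.card ^ 2 * (L * A.card) := by linarith
              nlinarith [sq_nonneg p]
          _ = expFactor n B.card ^ 2 * L * (A.card * p ^ 2) := by ring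
          _ ≤ expFactor n B.card ^ 2 * L * (4 * n) := by gcongr
          _ = expFactor n B.card ^ 2 * 4 * (n * L) := by ring
          _ = _ := by rw [hnL]; ring
      have hyp : 0 < expFactor n B.card := Real.exp_pos _
      exact le_of_sq_le_sq h7 (by positivity) 

/-! ### Contributions of pairs of dyadic levels -/

/-- The contribution of two dyadic levels with too few or too many edges. -/
def levelBound (n : ℕ) (q : ℝ) (b s t : ℕ) : ℝ :=
  b * 2 ^ t * (136 * (if (2 : ℝ) ^ s ≤ q * 2 ^ t then 2 ^ s else 0) +
    17 / 2 * logFactor n b * (if (2 : ℝ) ^ s ≤ 2 * q * expFactor n b then 2 ^ s else 0))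

lemma levelBound_nonneg {q : ℝ} {b s t : ℕ} (hb : b ≤ n) : 0 ≤ levelBound n q b s t := by
  have := one_le_logFactor hb
  unfold levelBound
  have h1 : ∀ (c : Prop) [Decidable c], (0 : ℝ) ≤ if c then (2 : ℝ) ^ s else 0 := by
    intro c _
    split_ifs <;> positivity
  have h2 := h1 ((2 : ℝ) ^ s ≤ q * 2 ^ t)
  have h3 := h1 ((2 : ℝ) ^ s ≤ 2 * q * expFactor n b)
  positivity

/-- Both truncated sums in s are geometric, so at most twice their cutoffs. The logarithm is at most
16 times `expFactor`, and `expFactor_sq_mul_le` makes the outcome summable over t. -/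
lemma sum_levelBound_le {q : ℝ} (hq : 0 ≤ q) {b t : ℕ} (hb : b ≤ n) (R : ℕ) :
    ∑ s ∈ Finset.range R, levelBound n q b s t ≤
      q * (816 * (b * 4 ^ t) + 1632 * n * (1 / 2 ^ t)) := by
  have hl := one_le_logFactor hb
  have hy : 0 < expFactor n b := Real.exp_pos _
  have h1 := sum_two_pow_le R (Y := q * 2 ^ t) (by positivity)
  have h2 := sum_two_pow_le R (Y := 2 * q * expFactor n b) (by positivity)
  have h4 : (4 : ℝ) ^ t = 2 ^ t * 2 ^ t := by rw [← mul_pow]; norm_num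
  have h5 := expFactor_sq_mul_le (t := t) hb
  have h6 := logFactor_le_expFactor (n := n) b
  unfold levelBound
  rw [← Finset.mul_sum, Finset.sum_add_distrib, ← Finset.mul_sum, ← Finset.mul_sum]
  calc _ ≤ b * 2 ^ t * (136 * (2 * (q * 2 ^ t)) +
        17 / 2 * (16 * expFactor n b) * (2 * (2 * q * expFactor n b))) := by
        gcongr
    _ = q * (272 * (b * 4 ^ t) + 544 * (expFactor n b ^ 2 * b * 2 ^ t)) := by rw [h4]; ring
    _ ≤ q * (272 * (b * 4 ^ t) + 544 * (b * 4 ^ t + 3 * n * (1 / 2 ^ t))) := by gcongr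
    _ = _ := by ring

/-- The contribution of two dyadic levels of very different heights. -/
def degreeBound (D q : ℝ) (a s t : ℕ) : ℝ :=
  D * q ^ 2 * a * 2 ^ s * (if (2 : ℝ) ^ t ≤ 2 ^ s / q then 2 ^ t else 0)

lemma degreeBound_nonneg {D q : ℝ} (hD : 0 ≤ D) (a s t : ℕ) : 0 ≤ degreeBound D q a s t := by
  unfold degreeBound
  split_ifs <;> positivity

lemma sum_degreeBound_le {D q : ℝ} (hD : 0 ≤ D) (hq : 0 < q) (a s R : ℕ) :
    ∑ t ∈ Finset.range R, degreeBound D q a s t ≤ 2 * D * q * (a * 4 ^ s) := by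
  have h1 := sum_two_pow_le R (Y := 2 ^ s / q) (by positivity)
  have h4 : (4 : ℝ) ^ s = 2 ^ s * 2 ^ s := by rw [← mul_pow]; norm_num
  unfold degreeBound
  rw [← Finset.mul_sum]
  calc _ ≤ D * q ^ 2 * a * 2 ^ s * (2 * (2 ^ s / q)) := by gcongr
    _ = _ := by rw [h4]; field_simp

/-- The case analysis of Kahn and Szemerédi. If one height exceeds the other by a factor q, the
degrees of the higher level suffice. Otherwise, if the mean dominates, the edge count is at most 63
times the mean, and heaviness q < 4·2^s·2^t supplies the missing factor. In the remaining case the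
entropy dominates, and `edgeCount_le_of_entropy_lt` is applied with the set of larger entropy in the
role of B. -/
lemma heavy_level_le {x : Config n} {A B : Finset (Fin n)} {L q D : ℝ} {s t : ℕ}
    (hL : 0 < L) (hq : 1 ≤ q) (hD : 0 ≤ D) (hnL : n * L = q ^ 2)
    (hdis : DiscrepancyEvent L x)
    (hAd : ∀ a ∈ A, degree x a ≤ D * q ^ 2) (hBd : ∀ b ∈ B, degree x b ≤ D * q ^ 2)
    (hAs : (A.card : ℝ) * 4 ^ s ≤ 4 * n) (hBt : (B.card : ℝ) * 4 ^ t ≤ 4 * n)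
    (hst : q < 4 * (2 ^ s * 2 ^ t)) :
    edgeCount x A B * (2 ^ s * 2 ^ t) ≤
      degreeBound D q A.card s t + degreeBound D q B.card t s +
      252 * L / q * (A.card * 4 ^ s) * (B.card * 4 ^ t) +
      levelBound n q B.card s t + levelBound n q A.card t s := by
  have hq0 : 0 < q := by linarith
  have hAn := card_le_of_finset A
  have hBn := card_le_of_finset B
  have n1 := degreeBound_nonneg (q := q) hD A.card s t
  have n2 := degreeBound_nonneg (q := q) hD B.card t s
  have n3 : 0 ≤ 252 * L / q * (A.card * 4 ^ s) * (B.card * 4 ^ t) := by positivity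
  have n4 := levelBound_nonneg (q := q) (s := s) (t := t) hBn
  have n5 := levelBound_nonneg (q := q) (s := t) (t := s) hAn
  rcases A.eq_empty_or_nonempty with hA | hA
  · have h0 : edgeCount x A B = 0 := by simp [hA, edgeCount]
    rw [h0]
    linarith
  rcases B.eq_empty_or_nonempty with hB | hB
  · have h0 : edgeCount x A B = 0 := by simp [hB, edgeCount]
    rw [h0]
    linarith
  have hps : (0 : ℝ) < 2 ^ s := by positivity
  have hpt : (0 : ℝ) < 2 ^ t := by positivity
  have h4s : (4 : ℝ) ^ s = (2 ^ s) ^ 2 := by rw [← pow_mul, mul_comm, pow_mul]; norm_num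
  have h4t : (4 : ℝ) ^ t = (2 ^ t) ^ 2 := by rw [← pow_mul, mul_comm, pow_mul]; norm_num
  by_cases hc1 : (2 : ℝ) ^ t ≤ 2 ^ s / q
  · have h1 : edgeCount x A B * (2 ^ s * 2 ^ t) ≤ degreeBound D q A.card s t := by
      rw [degreeBound, if_pos hc1]
      have := edgeCount_le_card_mul x (B := B) hAd
      calc _ ≤ A.card * (D * q ^ 2) * (2 ^ s * 2 ^ t) := by gcongr
        _ = _ := by ring
    linarith
  by_cases hc2 : (2 : ℝ) ^ s ≤ 2 ^ t / q
  · have h1 : edgeCount x A B * (2 ^ s * 2 ^ t) ≤ degreeBound D q B.card t s := by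
      rw [degreeBound, if_pos hc2, edgeCount_comm]
      have := edgeCount_le_card_mul x (B := A) hBd
      calc _ ≤ B.card * (D * q ^ 2) * (2 ^ s * 2 ^ t) := by gcongr
        _ = _ := by ring
    linarith
  have hc1' : (2 : ℝ) ^ s ≤ q * 2 ^ t := by
    push Not at hc1
    rw [div_lt_iff₀ hq0] at hc1
    linarith
  have hc2' : (2 : ℝ) ^ t ≤ q * 2 ^ s := by
    push Not at hc2
    rw [div_lt_iff₀ hq0] at hc2
    linarith
  obtain ⟨hd1, hd2⟩ := hdis A B hA hB
  rcases le_or_gt (pairEntropy A B) (Real.exp 2 * pairMean L A B) with hc | hc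
  · have h1 := hd1 hc
    have h2 : edgeCount x A B * (2 ^ s * 2 ^ t) ≤
        252 * L / q * (A.card * 4 ^ s) * (B.card * 4 ^ t) := by
      calc _ ≤ 63 * (L * A.card * B.card) * (2 ^ s * 2 ^ t) := by
            unfold pairMean at h1
            gcongr
        _ = 63 * (L * A.card * B.card) * (2 ^ s * 2 ^ t) * q / q := by field_simp
        _ ≤ 63 * (L * A.card * B.card) * (2 ^ s * 2 ^ t) * (4 * (2 ^ s * 2 ^ t)) / q := by
            gcongr
        _ = _ := by rw [h4s, h4t]; ring
    linarith
  · have h1 := hd2 hc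
    have side : ∀ (A B : Finset (Fin n)) (s t : ℕ), A.Nonempty → B.Nonempty →
        (A.card : ℝ) * 4 ^ s ≤ 4 * n → entropy n A.card ≤ entropy n B.card →
        Real.exp 2 * pairMean L A B < pairEntropy A B →
        edgeCount x A B * Real.log (pairEntropy A B / pairMean L A B) ≤ 17 * pairEntropy A B →
        (2 : ℝ) ^ s ≤ q * 2 ^ t →
        edgeCount x A B * (2 ^ s * 2 ^ t) ≤ levelBound n q B.card s t := by
      intro A B s t hA hB hAs hent hlt hdis hst
      have h4s : (4 : ℝ) ^ s = (2 ^ s) ^ 2 := by rw [← pow_mul, mul_comm, pow_mul]; norm_num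
      have hl := one_le_logFactor (card_le_of_finset B)
      rw [levelBound, if_pos hst]
      rcases edgeCount_le_of_entropy_lt (p := 2 ^ s) hL hq0 hnL hA hB
        (by rw [← h4s]; exact hAs) hent hlt hdis with h | ⟨h, hp⟩
      · have h3 : (0 : ℝ) ≤ if (2 : ℝ) ^ s ≤ 2 * q * expFactor n B.card then (2 : ℝ) ^ s else 0 := by
          split_ifs <;> positivity
        calc _ ≤ 136 * B.card * ((2 : ℝ) ^ s * 2 ^ t) := by gcongr
          _ = B.card * 2 ^ t * (136 * 2 ^ s + 17 / 2 * logFactor n B.card * 0) := by ring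
          _ ≤ _ := by gcongr
      · rw [if_pos hp]
        calc _ ≤ 17 / 2 * B.card * logFactor n B.card * ((2 : ℝ) ^ s * 2 ^ t) := by gcongr
          _ = B.card * 2 ^ t * (0 + 17 / 2 * logFactor n B.card * 2 ^ s) := by ring
          _ ≤ _ := by
            gcongr
            positivity
    rcases le_total (entropy n A.card) (entropy n B.card) with he | he
    · have := side A B s t hA hB hAs he hc h1 hc1'
      linarith
    · have := side B A t s hB hA hBt he (by rwa [pairMean_comm, pairEntropy_comm])
        (by rwa [pairMean_comm, pairEntropy_comm, edgeCount_comm]) hc2'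
      rw [edgeCount_comm, mul_comm ((2 : ℝ) ^ t)] at this
      linarith

/-! ### Dyadic decomposition of integer vectors -/

/-- The vertices at a dyadic level of an integer vector. -/
def level (ξ : Fin n → ℤ) (s : ℕ) : Finset (Fin n) :=
  Finset.univ.filter fun a => ξ a ≠ 0 ∧ Nat.log 2 (ξ a).natAbs = s

lemma two_pow_le_of_mem_level {ξ : Fin n → ℤ} {s : ℕ} {a : Fin n} (ha : a ∈ level ξ s) :
    (2 : ℝ) ^ s ≤ |(ξ a : ℝ)| ∧ |(ξ a : ℝ)| ≤ 2 * 2 ^ s := by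
  obtain ⟨-, h0, hs⟩ := Finset.mem_filter.1 ha
  have h1 : (ξ a).natAbs ≠ 0 := by simpa using h0
  have h2 := Nat.pow_log_le_self 2 h1
  have h3 := Nat.lt_pow_succ_log_self (b := 2) (by norm_num) (ξ a).natAbs
  rw [hs] at h2 h3
  have h4 : |(ξ a : ℝ)| = ((ξ a).natAbs : ℝ) := by
    rw [Nat.cast_natAbs, Int.cast_abs]
  rw [h4]
  refine ⟨by exact_mod_cast h2, ?_⟩
  have h5 : ((ξ a).natAbs : ℝ) ≤ ((2 ^ (s + 1) : ℕ) : ℝ) := by exact_mod_cast h3.le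
  calc _ ≤ _ := h5
    _ = _ := by push_cast; rw [pow_succ]; ring

lemma sum_eq_sum_level {ξ : Fin n → ℤ} (hξ : ξ ∈ lattice n) (f : Fin n → ℝ)
    (hf : ∀ a, ξ a = 0 → f a = 0) :
    ∑ a, f a = ∑ s ∈ Finset.range (2 * n + 1), ∑ a ∈ level ξ s, f a := by
  have h1 : ∑ a, f a = ∑ a ∈ Finset.univ.filter (fun a => ξ a ≠ 0), f a := by
    rw [Finset.sum_filter]
    refine Finset.sum_congr rfl fun a _ => ?_
    split_ifs with h
    · rfl
    · exact hf a (by simpa using h)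
  rw [h1, ← Finset.sum_fiberwise_of_maps_to (g := fun a => Nat.log 2 (ξ a).natAbs)
    (t := Finset.range (2 * n + 1))]
  · refine Finset.sum_congr rfl fun s _ => Finset.sum_congr ?_ fun _ _ => rfl
    ext a
    simp [level]
  · intro a _
    have h2 : ξ a ∈ Finset.Icc (-(2 * n : ℤ)) (2 * n) := by
      have := (Finset.mem_filter.1 hξ).1
      exact Fintype.mem_piFinset.1 this a
    rw [Finset.mem_Icc] at h2
    have h3 := Nat.log_le_self 2 (ξ a).natAbs
    rw [Finset.mem_range]
    omega

lemma sum_card_level_le {ξ : Fin n → ℤ} (hξ : ξ ∈ lattice n) :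
    ∑ s ∈ Finset.range (2 * n + 1), ((level ξ s).card : ℝ) * 4 ^ s ≤ 4 * n := by
  refine le_trans ?_ (sum_sq_lattice hξ)
  rw [sum_eq_sum_level hξ _ (fun a h => by simp [h])]
  refine Finset.sum_le_sum fun s _ => ?_
  rw [← nsmul_eq_mul]
  refine Finset.card_nsmul_le_sum _ _ _ fun a ha => ?_
  have h4s : (4 : ℝ) ^ s = (2 ^ s) ^ 2 := by rw [← pow_mul, mul_comm, pow_mul]; norm_num
  rw [h4s, ← sq_abs (ξ a : ℝ)]
  have := (two_pow_le_of_mem_level ha).1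
  gcongr

lemma card_level_le {ξ : Fin n → ℤ} (hξ : ξ ∈ lattice n) {s : ℕ}
    (hs : s ∈ Finset.range (2 * n + 1)) : ((level ξ s).card : ℝ) * 4 ^ s ≤ 4 * n :=
  (Finset.single_le_sum (f := fun s => ((level ξ s).card : ℝ) * 4 ^ s)
    (fun _ _ => by positivity) hs).trans (sum_card_level_le hξ)

lemma sum_sum_mul_add (R : ℕ) (c : ℝ) (f₁ f₂ f₃ f₄ f₅ : ℕ → ℕ → ℝ) :
    ∑ s ∈ Finset.range R, ∑ t ∈ Finset.range R,
      c * (f₁ s t + f₂ t s + f₃ s t + f₄ t s + f₅ s t) =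
    c * (∑ s ∈ Finset.range R, ∑ t ∈ Finset.range R, f₁ s t +
      ∑ t ∈ Finset.range R, ∑ s ∈ Finset.range R, f₂ t s +
      ∑ s ∈ Finset.range R, ∑ t ∈ Finset.range R, f₃ s t +
      ∑ t ∈ Finset.range R, ∑ s ∈ Finset.range R, f₄ t s +
      ∑ s ∈ Finset.range R, ∑ t ∈ Finset.range R, f₅ s t) := by
  rw [Finset.sum_comm (f := f₂), Finset.sum_comm (f := f₄)]
  simp only [← Finset.sum_add_distrib, ← Finset.mul_sum]

lemma sum_sum_degreeBound_le {D q : ℝ} (hD : 0 ≤ D) (hq : 0 < q) (R : ℕ) (a : ℕ → ℕ)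
    (ha : ∑ s ∈ Finset.range R, (a s : ℝ) * 4 ^ s ≤ 4 * n) :
    ∑ s ∈ Finset.range R, ∑ t ∈ Finset.range R, degreeBound D q (a s) s t ≤ 8 * D * q * n := by
  calc _ ≤ ∑ s ∈ Finset.range R, 2 * D * q * (a s * 4 ^ s) :=
        Finset.sum_le_sum fun s _ => sum_degreeBound_le hD hq _ _ _
    _ = 2 * D * q * ∑ s ∈ Finset.range R, (a s : ℝ) * 4 ^ s := by rw [Finset.mul_sum]
    _ ≤ 2 * D * q * (4 * n) := by gcongr
    _ = _ := by ring

lemma sum_sum_levelBound_le {q : ℝ} (hq : 0 ≤ q) (R : ℕ) (a : ℕ → ℕ) (han : ∀ s, a s ≤ n)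
    (ha : ∑ s ∈ Finset.range R, (a s : ℝ) * 4 ^ s ≤ 4 * n) :
    ∑ s ∈ Finset.range R, ∑ t ∈ Finset.range R, levelBound n q (a s) t s ≤ 6528 * q * n := by
  calc _ ≤ ∑ s ∈ Finset.range R, q * (816 * (a s * 4 ^ s) + 1632 * n * (1 / 2 ^ s)) :=
        Finset.sum_le_sum fun s _ => sum_levelBound_le hq (han s) _
    _ = q * (816 * (∑ s ∈ Finset.range R, (a s : ℝ) * 4 ^ s) +
        1632 * n * ∑ s ∈ Finset.range R, 1 / (2 : ℝ) ^ s) := by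
        rw [← Finset.mul_sum, Finset.sum_add_distrib, ← Finset.mul_sum, ← Finset.mul_sum]
    _ ≤ q * (816 * (4 * n) + 1632 * n * 2) := by
        have := sum_inv_two_pow_le R
        gcongr
    _ = _ := by ring

lemma sum_sum_mean_le {L q : ℝ} (hL : 0 ≤ L) (hq : 0 < q) (hnL : n * L = q ^ 2) (R : ℕ)
    (a b : ℕ → ℕ) (ha : ∑ s ∈ Finset.range R, (a s : ℝ) * 4 ^ s ≤ 4 * n)
    (hb : ∑ s ∈ Finset.range R, (b s : ℝ) * 4 ^ s ≤ 4 * n) :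
    ∑ s ∈ Finset.range R, ∑ t ∈ Finset.range R,
      252 * L / q * (a s * 4 ^ s) * (b t * 4 ^ t) ≤ 4032 * q * n := by
  calc _ = 252 * L / q * ((∑ s ∈ Finset.range R, (a s : ℝ) * 4 ^ s) *
        ∑ t ∈ Finset.range R, (b t : ℝ) * 4 ^ t) := by
        rw [Finset.sum_mul_sum]
        simp only [Finset.mul_sum]
        refine Finset.sum_congr rfl fun s _ => Finset.sum_congr rfl fun t _ => ?_
        ring
    _ ≤ 252 * L / q * ((4 * n) * (4 * n)) := by gcongr
    _ = 4032 * n * (n * L) / q := by ring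
    _ = _ := by rw [hnL]; field_simp

/-- The pairs of coordinates with a large product contribute little to bilinear forms in the
adjacency matrix, on vectors supported by vertices of controlled degree. -/
lemma sum_heavy_le {x : Config n} {L q D : ℝ} (hL : 0 < L) (hq : 1 ≤ q) (hD : 0 ≤ D)
    (hnL : n * L = q ^ 2) (hdis : DiscrepancyEvent L x) {ξ η : Fin n → ℤ} (hξ : ξ ∈ lattice n)
    (hη : η ∈ lattice n) (hξd : ∀ a, ξ a ≠ 0 → degree x a ≤ D * q ^ 2)
    (hηd : ∀ a, η a ≠ 0 → degree x a ≤ D * q ^ 2) :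
    ∑ a, ∑ b, adj x a b * (if |(ξ a : ℝ) * η b| ≤ q then 0 else |(ξ a : ℝ) * η b|) ≤
      n * q * (64 * D + 68400) := by
  have hq0 : 0 < q := by linarith
  set R := 2 * n + 1 with hR
  set h : Fin n → Fin n → ℝ := fun a b =>
    adj x a b * (if |(ξ a : ℝ) * η b| ≤ q then 0 else |(ξ a : ℝ) * η b|) with hh
  have hlev : ∑ a, ∑ b, h a b = ∑ s ∈ Finset.range R, ∑ t ∈ Finset.range R,
      ∑ a ∈ level ξ s, ∑ b ∈ level η t, h a b := by
    rw [sum_eq_sum_level hξ]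
    · refine Finset.sum_congr rfl fun s _ => ?_
      trans ∑ a ∈ level ξ s, ∑ t ∈ Finset.range R, ∑ b ∈ level η t, h a b
      · refine Finset.sum_congr rfl fun a _ => sum_eq_sum_level hη _ fun b hb => ?_
        simp [hh, hb]
      · exact Finset.sum_comm
    · intro a ha
      refine Finset.sum_eq_zero fun b _ => ?_
      simp [hh, ha]
  have hterm : ∀ s ∈ Finset.range R, ∀ t ∈ Finset.range R,
      ∑ a ∈ level ξ s, ∑ b ∈ level η t, h a b ≤
      4 * (degreeBound D q (level ξ s).card s t + degreeBound D q (level η t).card t s +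
      252 * L / q * ((level ξ s).card * 4 ^ s) * ((level η t).card * 4 ^ t) +
      levelBound n q (level η t).card s t + levelBound n q (level ξ s).card t s) := by
    intro s hs t ht
    have hb : ∀ a ∈ level ξ s, ∀ b ∈ level η t, |(ξ a : ℝ) * η b| ≤ 4 * (2 ^ s * 2 ^ t) := by
      intro a ha b hb
      rw [abs_mul]
      have h1 := (two_pow_le_of_mem_level ha).2
      have h2 := (two_pow_le_of_mem_level hb).2
      calc _ ≤ (2 * 2 ^ s) * (2 * 2 ^ t) := by gcongr
        _ = (4 : ℝ) * (2 ^ s * 2 ^ t) := by ring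
    by_cases hst : q < 4 * (2 ^ s * 2 ^ t)
    · have hmain := heavy_level_le (A := level ξ s) (B := level η t) hL hq hD hnL hdis
        (fun a ha => hξd a (Finset.mem_filter.1 ha).2.1)
        (fun a ha => hηd a (Finset.mem_filter.1 ha).2.1)
        (card_level_le hξ hs) (card_level_le hη ht) hst
      calc _ ≤ ∑ a ∈ level ξ s, ∑ b ∈ level η t, adj x a b * (4 * (2 ^ s * 2 ^ t)) := by
            refine Finset.sum_le_sum fun a ha => Finset.sum_le_sum fun b hb' => ?_
            refine mul_le_mul_of_nonneg_left ?_ (adj_nonneg _ _ _)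
            split_ifs
            · positivity
            · exact hb a ha b hb'
        _ = 4 * (edgeCount x (level ξ s) (level η t) * (2 ^ s * 2 ^ t)) := by
            simp only [edgeCount, Finset.sum_mul, Finset.mul_sum]
            refine Finset.sum_congr rfl fun a _ => Finset.sum_congr rfl fun b _ => ?_
            ring
        _ ≤ _ := by gcongr
    · have h0 : ∑ a ∈ level ξ s, ∑ b ∈ level η t, h a b = 0 := by
        refine Finset.sum_eq_zero fun a ha => Finset.sum_eq_zero fun b hb' => ?_
        simp only [hh]
        rw [if_pos ((hb a ha b hb').trans (not_lt.1 hst)), mul_zero]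
      rw [h0]
      have n1 := degreeBound_nonneg (q := q) hD (level ξ s).card s t
      have n2 := degreeBound_nonneg (q := q) hD (level η t).card t s
      have n4 := levelBound_nonneg (q := q) (s := s) (t := t) (card_le_of_finset (level η t))
      have n5 := levelBound_nonneg (q := q) (s := t) (t := s) (card_le_of_finset (level ξ s))
      positivity
  have hA := sum_card_level_le hξ
  have hB := sum_card_level_le hη
  rw [← hR] at hA hB
  rw [hlev]
  calc _ ≤ ∑ s ∈ Finset.range R, ∑ t ∈ Finset.range R,
      4 * (degreeBound D q (level ξ s).card s t + degreeBound D q (level η t).card t s +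
      252 * L / q * ((level ξ s).card * 4 ^ s) * ((level η t).card * 4 ^ t) +
      levelBound n q (level η t).card s t + levelBound n q (level ξ s).card t s) :=
        Finset.sum_le_sum fun s hs => Finset.sum_le_sum fun t ht => hterm s hs t ht
    _ = 4 * (∑ s ∈ Finset.range R, ∑ t ∈ Finset.range R, degreeBound D q (level ξ s).card s t +
        ∑ t ∈ Finset.range R, ∑ s ∈ Finset.range R, degreeBound D q (level η t).card t s +
        ∑ s ∈ Finset.range R, ∑ t ∈ Finset.range R,
          252 * L / q * ((level ξ s).card * 4 ^ s) * ((level η t).card * 4 ^ t) +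
        ∑ t ∈ Finset.range R, ∑ s ∈ Finset.range R, levelBound n q (level η t).card s t +
        ∑ s ∈ Finset.range R, ∑ t ∈ Finset.range R, levelBound n q (level ξ s).card t s) := by
        exact sum_sum_mul_add R 4 (fun s t => degreeBound D q (level ξ s).card s t)
          (fun t s => degreeBound D q (level η t).card t s) _
          (fun t s => levelBound n q (level η t).card s t) _
    _ ≤ 4 * (8 * D * q * n + 8 * D * q * n + 4032 * q * n + 6528 * q * n + 6528 * q * n) := by
        have h1 := sum_sum_degreeBound_le hD hq0 _ (fun s => (level ξ s).card) hA
        have h2 := sum_sum_degreeBound_le hD hq0 _ (fun s => (level η s).card) hB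
        have h3 := sum_sum_levelBound_le hq0.le _ (fun s => (level ξ s).card)
          (fun s => card_le_of_finset _) hA
        have h4 := sum_sum_levelBound_le hq0.le _ (fun s => (level η s).card)
          (fun s => card_le_of_finset _) hB
        have h5 := sum_sum_mean_le hL.le hq0 hnL _ (fun s => (level ξ s).card)
          (fun s => (level η s).card) hA hB
        linarith
    _ ≤ _ := by
        have : (0 : ℝ) ≤ q * n := by positivity
        nlinarith

end Heavy

/-! ### From lattice vectors to the operator norm on low-degree vertices -/

section OperatorNorm

variable {n : ℕ}

/-- The deviation of the adjacency matrix from the matrix of probabilities. -/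
def deviation (S : Matrix (Fin n) (Fin n) ℝ) (x : Config n) : Matrix (Fin n) (Fin n) ℝ :=
  adj x - S

lemma deviation_apply (S : Matrix (Fin n) (Fin n) ℝ) (x : Config n) (a b : Fin n) :
    deviation S x a b = adj x a b - S a b := rfl

lemma deviation_eq (S : Matrix (Fin n) (Fin n) ℝ) (x : Config n) (a b : Fin n) :
    deviation S x a b = noise S x a b - if a = b then S a b else 0 := by
  by_cases h : a = b
  · subst h
    simp [deviation_apply, noise_self, adj_self]
  · simp [deviation_apply, noise_of_ne S x h, h]

lemma deviation_comm {S : Matrix (Fin n) (Fin n) ℝ} {L : ℝ} (hS : IsProbMatrix S L)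
    (x : Config n) (a b : Fin n) : deviation S x a b = deviation S x b a := by
  rw [deviation_apply, deviation_apply, adj_comm, hS.symm]

/-- The rounding direction follows the sign of c, so the linear form does not decrease; zeros stay
zero, so supports are kept. -/
lemma exists_int_round (c u : ℝ) : ∃ k : ℤ, (u = 0 → k = 0) ∧ |(k : ℝ) - u| ≤ 1 ∧ c * u ≤ c * k := by
  rcases le_total 0 c with hc | hc
  · refine ⟨⌈u⌉, fun h => by simp [h], ?_, mul_le_mul_of_nonneg_left (Int.le_ceil u) hc⟩
    rw [abs_le]
    constructor <;> linarith [Int.le_ceil u, Int.ceil_lt_add_one u]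
  · refine ⟨⌊u⌋, fun h => by simp [h], ?_, mul_le_mul_of_nonpos_left (Int.floor_le u) hc⟩
    rw [abs_le]
    constructor <;> linarith [Int.floor_le u, Int.lt_floor_add_one u]

lemma exists_lattice_round {u : Fin n → ℝ} (hu : ∑ a, u a ^ 2 ≤ n) (c : Fin n → ℝ) :
    ∃ ξ ∈ lattice n, (∀ a, u a = 0 → ξ a = 0) ∧ ∑ a, c a * u a ≤ ∑ a, c a * ξ a := by
  choose ξ h0 h1 h2 using fun a => exists_int_round (c a) (u a)
  refine ⟨ξ, ?_, h0, Finset.sum_le_sum fun a _ => h2 a⟩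
  rw [mem_lattice]
  have h3 : ∑ a, (ξ a : ℝ) ^ 2 ≤ 4 * n := by
    calc ∑ a, (ξ a : ℝ) ^ 2 ≤ ∑ a, (2 * u a ^ 2 + 2) := by
          refine Finset.sum_le_sum fun a _ => ?_
          have := abs_le.1 (h1 a)
          nlinarith [sq_nonneg ((ξ a : ℝ) - u a - u a)]
      _ = 2 * ∑ a, u a ^ 2 + 2 * n := by
          rw [Finset.sum_add_distrib, ← Finset.mul_sum]
          simp
          ring
      _ ≤ _ := by linarith
  exact_mod_cast h3

/-- Light pairs are controlled after centring. On heavy pairs the adjacency part is `sum_heavy_le`,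
and the mean part is at most (L/q)w² because |w| > q. The diagonal is bounded by |w|. The constants
add up as 44 + 68400 + 16 + 4. -/
lemma bilin_lattice_le {S : Matrix (Fin n) (Fin n) ℝ} {L q D : ℝ} (hS : IsProbMatrix S L)
    {x : Config n} (hL : 0 < L) (hq : 1 ≤ q) (hD : 0 ≤ D) (hnL : n * L = q ^ 2)
    (hdis : DiscrepancyEvent L x) (hlight : LightEvent S (n * L) x) {ξ η : Fin n → ℤ}
    (hξ : ξ ∈ lattice n) (hη : η ∈ lattice n) (hξd : ∀ a, ξ a ≠ 0 → degree x a ≤ D * q ^ 2)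
    (hηd : ∀ a, η a ≠ 0 → degree x a ≤ D * q ^ 2) :
    ∑ a, ∑ b, deviation S x a b * (ξ a * η b) ≤ n * q * (64 * D + 68464) := by
  have hq0 : 0 < q := by linarith
  have h1 := hlight ξ hξ η hη
  have hsqrt : Real.sqrt (n * L) = q := by rw [hnL, Real.sqrt_sq hq0.le]
  rw [hsqrt] at h1
  have h2 := sum_heavy_le hL hq hD hnL hdis hξ hη hξd hηd
  have hξ2 := sum_sq_lattice hξ
  have hη2 := sum_sq_lattice hη
  have h3 : ∑ a, ∑ b, (ξ a : ℝ) ^ 2 * (η b : ℝ) ^ 2 ≤ 16 * n ^ 2 := by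
    rw [← Finset.sum_mul_sum]
    calc _ ≤ (4 * n : ℝ) * (4 * n) := by gcongr
      _ = _ := by ring
  have h4 : ∑ a, |(ξ a : ℝ) * η a| ≤ 4 * n := by
    calc _ ≤ ∑ a, ((ξ a : ℝ) ^ 2 + (η a : ℝ) ^ 2) / 2 := by
          refine Finset.sum_le_sum fun a _ => ?_
          rw [abs_mul, ← sq_abs (ξ a : ℝ), ← sq_abs (η a : ℝ)]
          nlinarith [sq_nonneg (|(ξ a : ℝ)| - |(η a : ℝ)|)]
      _ = (∑ a, (ξ a : ℝ) ^ 2 + ∑ a, (η a : ℝ) ^ 2) / 2 := by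
          rw [← Finset.sum_div, Finset.sum_add_distrib]
      _ ≤ _ := by linarith
  have hterm : ∀ a b, deviation S x a b * (ξ a * η b) ≤
      noise S x a b * lightCoeff (n * L) ξ η a b +
      adj x a b * (if |(ξ a : ℝ) * η b| ≤ q then 0 else |(ξ a : ℝ) * η b|) +
      L / q * ((ξ a : ℝ) ^ 2 * (η b : ℝ) ^ 2) + (if a = b then |(ξ a : ℝ) * η b| else 0) := by
    intro a b
    rw [deviation_eq, lightCoeff, hsqrt]
    set w : ℝ := (ξ a : ℝ) * η b with hw
    have hw2 : (ξ a : ℝ) ^ 2 * (η b : ℝ) ^ 2 = w ^ 2 := by rw [hw]; ring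
    rw [hw2]
    have hdiag : -(if a = b then S a b else 0) * w ≤ if a = b then |w| else 0 := by
      split_ifs
      · have := neg_abs_le w
        have := le_abs_self w
        have h01 := hS.nonneg a b
        have h02 := hS.le_one a b
        have h03 := abs_nonneg w
        nlinarith
      · simp
    have hpos : 0 ≤ L / q * w ^ 2 := by positivity
    have hadj := adj_nonneg x a b
    by_cases hc : |w| ≤ q
    · rw [if_pos hc, if_pos hc]
      nlinarith
    rw [if_neg hc, if_neg hc]
    by_cases hab : a = b
    · rw [if_pos hab, if_pos hab] at hdiag
      rw [if_pos hab, if_pos hab]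
      have hns : noise S x a b = 0 := by rw [hab, noise_self]
      have : 0 ≤ adj x a b * |w| := mul_nonneg hadj (abs_nonneg w)
      rw [hns]
      nlinarith
    · rw [if_neg hab, if_neg hab, noise_of_ne S x hab]
      push Not at hc
      have h5 : adj x a b * w ≤ adj x a b * |w| :=
        mul_le_mul_of_nonneg_left (le_abs_self w) hadj
      have h6 : -S a b * w ≤ L / q * w ^ 2 := by
        have h7 : -S a b * w ≤ L * |w| := by
          have := neg_abs_le w
          have h01 := hS.nonneg a b
          have h02 := hS.le a b
          have h03 := abs_nonneg w
          nlinarith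
        have h8 : L * |w| ≤ L / q * w ^ 2 := by
          rw [← sq_abs w]
          calc L * |w| = L / q * (q * |w|) := by field_simp
            _ ≤ L / q * (|w| * |w|) := by gcongr
            _ = _ := by ring
        linarith
      linarith
  have hsum := Finset.sum_le_sum fun a (_ : a ∈ Finset.univ) =>
    Finset.sum_le_sum fun b (_ : b ∈ Finset.univ) => hterm a b
  simp only [Finset.sum_add_distrib, ← Finset.mul_sum] at hsum h3
  have hdiag : ∑ a, ∑ b, (if a = b then |(ξ a : ℝ) * η b| else 0) = ∑ a, |(ξ a : ℝ) * η a| := by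
    simp
  rw [hdiag] at hsum
  have h9 : L / q * ∑ a, (ξ a : ℝ) ^ 2 * ∑ b, (η b : ℝ) ^ 2 ≤ 16 * n * q := by
    calc _ ≤ L / q * (16 * n ^ 2) := by gcongr
      _ = 16 * n * (n * L) / q := by ring
      _ = _ := by rw [hnL]; field_simp
  have h10 : (n : ℝ) ≤ n * q := by nlinarith [(Nat.cast_nonneg n : (0 : ℝ) ≤ n)]
  linarith

/-- The vertices of low degree. -/
def lowDegree (x : Config n) (τ : ℝ) : Finset (Fin n) :=
  Finset.univ.filter fun a => degree x a ≤ τ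

/-- The form is linear in each vector, so rounding them one after the other in the favourable
directions can only increase it. The reduction to the lattice therefore loses no constant. -/
lemma bilin_le_of_sum_sq_le {S : Matrix (Fin n) (Fin n) ℝ} {L q D : ℝ} (hS : IsProbMatrix S L)
    {x : Config n} (hL : 0 < L) (hq : 1 ≤ q) (hD : 0 ≤ D) (hnL : n * L = q ^ 2)
    (hdis : DiscrepancyEvent L x) (hlight : LightEvent S (n * L) x) {u v : Fin n → ℝ}
    (hu : ∑ a, u a ^ 2 ≤ n) (hv : ∑ a, v a ^ 2 ≤ n)
    (hud : ∀ a, u a ≠ 0 → degree x a ≤ D * q ^ 2) (hvd : ∀ a, v a ≠ 0 → degree x a ≤ D * q ^ 2) :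
    ∑ a, ∑ b, deviation S x a b * (u a * v b) ≤ n * q * (64 * D + 68464) := by
  obtain ⟨ξ, hξ, hξ0, hξs⟩ := exists_lattice_round hu fun a => ∑ b, deviation S x a b * v b
  obtain ⟨η, hη, hη0, hηs⟩ := exists_lattice_round hv fun b => ∑ a, deviation S x a b * ξ a
  have h1 : ∑ a, ∑ b, deviation S x a b * (u a * v b) =
      ∑ a, (∑ b, deviation S x a b * v b) * u a := by
    refine Finset.sum_congr rfl fun a _ => ?_
    rw [Finset.sum_mul]
    exact Finset.sum_congr rfl fun b _ => by ring
  have h2 : ∑ a, (∑ b, deviation S x a b * v b) * ξ a =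
      ∑ b, (∑ a, deviation S x a b * ξ a) * v b := by
    simp only [Finset.sum_mul]
    rw [Finset.sum_comm]
    exact Finset.sum_congr rfl fun b _ => Finset.sum_congr rfl fun a _ => by ring
  have h3 : ∑ b, (∑ a, deviation S x a b * ξ a) * η b =
      ∑ a, ∑ b, deviation S x a b * (ξ a * η b) := by
    simp only [Finset.sum_mul]
    rw [Finset.sum_comm]
    exact Finset.sum_congr rfl fun b _ => Finset.sum_congr rfl fun a _ => by ring
  rw [h1]
  refine hξs.trans ?_
  rw [h2]
  refine hηs.trans ?_
  rw [h3]
  refine bilin_lattice_le hS hL hq hD hnL hdis hlight hξ hη (fun a ha => hud a ?_)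
    (fun a ha => hvd a ?_)
  · exact fun h => ha (hξ0 a h)
  · exact fun h => ha (hη0 a h)

/-- The operator norm of the deviation, restricted to the vertices of low degree. -/
lemma sum_sq_deviation_mul_le {S : Matrix (Fin n) (Fin n) ℝ} {L q D : ℝ} (hS : IsProbMatrix S L)
    {x : Config n} (hn : 0 < n) (hL : 0 < L) (hq : 1 ≤ q) (hD : 0 ≤ D) (hnL : n * L = q ^ 2)
    (hdis : DiscrepancyEvent L x) (hlight : LightEvent S (n * L) x) (u : Fin n → ℝ) :
    ∑ b ∈ lowDegree x (D * q ^ 2), (∑ a ∈ lowDegree x (D * q ^ 2), deviation S x a b * u a) ^ 2 ≤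
      (q * (64 * D + 68464)) ^ 2 * ∑ a ∈ lowDegree x (D * q ^ 2), u a ^ 2 := by
  classical
  set G := lowDegree x (D * q ^ 2) with hG
  set C := q * (64 * D + 68464) with hC
  have hCpos : 0 < C := by positivity
  set u' : Fin n → ℝ := fun a => if a ∈ G then u a else 0 with hu'
  -- Duality: the image of u, restricted to low-degree vertices, is paired with itself; both vectors
  -- are then rescaled to squared length n.
  set v : Fin n → ℝ := fun b => if b ∈ G then ∑ a, deviation S x a b * u' a else 0 with hv
  have hu'sum : ∑ a, u' a ^ 2 = ∑ a ∈ G, u a ^ 2 := by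
    rw [← sum_ite_mem_const G]
    refine Finset.sum_congr rfl fun a _ => ?_
    simp only [hu']
    split_ifs <;> simp
  have hvsum : ∑ b ∈ G, (∑ a ∈ G, deviation S x a b * u a) ^ 2 = ∑ b, v b ^ 2 := by
    rw [← sum_ite_mem_const G]
    refine Finset.sum_congr rfl fun b _ => ?_
    simp only [hv, hu']
    split_ifs
    · congr 1
      rw [← sum_ite_mem_const G]
      refine Finset.sum_congr rfl fun a _ => ?_
      split_ifs <;> simp
    · simp
  have hself : ∑ a, ∑ b, deviation S x a b * (u' a * v b) = ∑ b, v b ^ 2 := by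
    rw [Finset.sum_comm]
    refine Finset.sum_congr rfl fun b _ => ?_
    have : ∑ a, deviation S x a b * (u' a * v b) = (∑ a, deviation S x a b * u' a) * v b := by
      rw [Finset.sum_mul]
      exact Finset.sum_congr rfl fun a _ => by ring
    rw [this]
    simp only [hv]
    split_ifs
    · ring
    · simp
  rw [hvsum, ← hu'sum]
  set nu := ∑ a, u' a ^ 2 with hnu
  set nv := ∑ b, v b ^ 2 with hnv
  have hnu0 : 0 ≤ nu := Finset.sum_nonneg fun _ _ => sq_nonneg _
  have hnv0 : 0 ≤ nv := Finset.sum_nonneg fun _ _ => sq_nonneg _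
  rcases hnv0.eq_or_lt with hz | hvpos
  · rw [← hz]; positivity
  have hupos : 0 < nu := by
    rcases hnu0.eq_or_lt with hz | h
    · exfalso
      have h0 : ∀ a, u' a = 0 := by
        intro a
        have := (Finset.sum_eq_zero_iff_of_nonneg (fun a _ => sq_nonneg (u' a))).1 hz.symm a
          (Finset.mem_univ a)
        exact pow_eq_zero_iff (two_ne_zero) |>.1 this
      have : nv = 0 := by
        rw [← hself]
        simp [h0]
      linarith
    · exact h
  have hn' : (0 : ℝ) < n := by positivity
  have hdegG : ∀ a, a ∈ G → degree x a ≤ D * q ^ 2 := fun a ha => (Finset.mem_filter.1 ha).2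
  set cu := Real.sqrt (n / nu) with hcu
  set cv := Real.sqrt (n / nv) with hcv
  have hcu2 : cu ^ 2 = n / nu := Real.sq_sqrt (by positivity)
  have hcv2 : cv ^ 2 = n / nv := Real.sq_sqrt (by positivity)
  have hcupos : 0 < cu := Real.sqrt_pos.2 (by positivity)
  have hcvpos : 0 < cv := Real.sqrt_pos.2 (by positivity)
  have hmain := bilin_le_of_sum_sq_le (u := fun a => cu * u' a) (v := fun b => cv * v b) hS hL hq hD
    hnL hdis hlight ?_ ?_ ?_ ?_
  · have h1 : ∑ a, ∑ b, deviation S x a b * (cu * u' a * (cv * v b)) = cu * cv * nv := by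
      rw [← hself]
      simp only [Finset.mul_sum]
      exact Finset.sum_congr rfl fun a _ => Finset.sum_congr rfl fun b _ => by ring
    rw [h1] at hmain
    have h2 : cu * cv * nv ≤ n * C := by rw [hC]; linarith
    have h3 : (cu * cv * nv) ^ 2 ≤ (n * C) ^ 2 := by gcongr
    have h4 : (cu * cv * nv) ^ 2 = n ^ 2 * (nv / nu) := by
      rw [mul_pow, mul_pow, hcu2, hcv2]
      field_simp
    rw [h4, mul_pow] at h3
    have h5 : nv / nu ≤ C ^ 2 := le_of_mul_le_mul_left h3 (by positivity)
    rwa [div_le_iff₀ hupos] at h5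
  · simp only [mul_pow, ← Finset.mul_sum]
    rw [hcu2, ← hnu]
    field_simp
    exact le_rfl
  · simp only [mul_pow, ← Finset.mul_sum]
    rw [hcv2, ← hnv]
    field_simp
    exact le_rfl
  · intro a ha
    refine hdegG a ?_
    by_contra h
    exact ha (by simp [hu', h])
  · intro a ha
    refine hdegG a ?_
    by_contra h
    exact ha (by simp [hv, h])

/-! ### Vertices of high degree -/

/-- The vertices of high degree. -/
def highDegree (x : Config n) (τ : ℝ) : Finset (Fin n) :=
  Finset.univ.filter fun a => ¬ degree x a ≤ τ

/-- The threshold is 114 = 2 + 8·14: a set of vertices above it must have logarithmic factor at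
least 14nL, so there are at most e·n·e^{-14nL} of them. Their ordered degrees are bounded by 9 times
the logarithmic factor of the rank; summing the squares gives √(n|H|), whence the exponent 7. -/
lemma sum_sq_highDegree_le {L : ℝ} {x : Config n} (hn : 0 < n) (hL : 0 < L)
    (hdeg : DegreeEvent L x) :
    ∑ b ∈ highDegree x (114 * (n * L)), degree x b ^ 2 ≤
      41472 * n * Real.exp (-(7 * (n * L))) := by
  classical
  set H := highDegree x (114 * (n * L)) with hH
  have hn' : (0 : ℝ) < n := by positivity
  have hlog : ∀ C ⊆ H, C.Nonempty → 14 * (n * L) ≤ logFactor n C.card ∧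
      ∑ c ∈ C, degree x c ≤ C.card * (9 * logFactor n C.card) := by
    intro C hC hne
    have h1 := hdeg C hne
    have hcpos : (0 : ℝ) < C.card := by exact_mod_cast hne.card_pos
    have h2 : C.card * (114 * (n * L)) ≤ ∑ c ∈ C, degree x c := by
      rw [← nsmul_eq_mul]
      refine Finset.card_nsmul_le_sum _ _ _ fun c hc => ?_
      exact (not_le.1 (Finset.mem_filter.1 (hC hc)).2).le
    unfold entropy at h1
    have h3 : 14 * (n * L) ≤ logFactor n C.card := by
      have : C.card * (112 * (n * L)) ≤ C.card * (8 * logFactor n C.card) := by linarith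
      have := le_of_mul_le_mul_left this hcpos
      linarith
    refine ⟨h3, h1.trans ?_⟩
    have : C.card * (2 * (n * L)) ≤ C.card * logFactor n C.card := by
      gcongr
      nlinarith [mul_pos hn' hL]
    linarith
  have h1 := sum_comp_le_sum_range (degree x) (fun i => 9 * logFactor n i) (fun y => y ^ 2)
    (degree_nonneg x) (fun a b ha hab => by gcongr) H (fun C hC hne => (hlog C hC hne).2)
  refine h1.trans ?_
  have hHn := card_le_of_finset H
  calc _ ≤ ∑ i ∈ Finset.range H.card, 10368 * Real.sqrt (n / (i + 1 : ℕ)) := by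
        refine Finset.sum_le_sum fun i hi => ?_
        have hi' := Finset.mem_range.1 hi
        have := logFactor_sq_le hn (Nat.succ_pos i) (by omega : i + 1 ≤ n)
        rw [mul_pow]
        simp only [Nat.succ_eq_add_one] at this
        linarith
    _ = 10368 * ∑ i ∈ Finset.range H.card, Real.sqrt (n / (i + 1 : ℕ)) := by rw [Finset.mul_sum]
    _ ≤ 10368 * (2 * Real.sqrt (n * H.card)) := by
        have := sum_sqrt_div_le n H.card
        gcongr
    _ ≤ 10368 * (2 * (2 * n * Real.exp (-(7 * (n * L))))) := by
        gcongr
        rw [Real.sqrt_le_left (by positivity)]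
        rcases H.eq_empty_or_nonempty with h0 | h0
        · rw [h0]
          simp
          positivity
        · have h2 := (hlog H subset_rfl h0).1
          have h3 := Real.exp_le_exp.2 h2
          rw [exp_logFactor hn h0.card_pos] at h3
          have hHpos : (0 : ℝ) < H.card := by exact_mod_cast h0.card_pos
          have h4 : Real.exp (14 * (n * L)) * H.card ≤ Real.exp 1 * n := by
            have := mul_le_mul_of_nonneg_right h3 hHpos.le
            rwa [mul_assoc (Real.exp 1), div_mul_cancel₀ _ hHpos.ne'] at this
          have h5 : Real.exp (-(7 * (n * L))) ^ 2 * Real.exp (14 * (n * L)) = 1 := by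
            rw [← Real.exp_nat_mul, ← Real.exp_add]
            simp
            ring
          have h6 : (H.card : ℝ) ≤ Real.exp (-(7 * (n * L))) ^ 2 * (Real.exp 1 * n) := by
            calc (H.card : ℝ) = Real.exp (-(7 * (n * L))) ^ 2 *
                  (Real.exp (14 * (n * L)) * H.card) := by rw [← mul_assoc, h5, one_mul]
              _ ≤ _ := by gcongr
          have h7 := Real.exp_one_lt_d9
          calc (n : ℝ) * H.card ≤ n * (Real.exp (-(7 * (n * L))) ^ 2 * (Real.exp 1 * n)) := by gcongr
            _ ≤ n * (Real.exp (-(7 * (n * L))) ^ 2 * (4 * n)) := by gcongr; linarith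
            _ = _ := by ring
    _ = _ := by ring

/-! ### Consequences of the control of the row sums -/

lemma bennett_le_sq_mul_exp (v : ℝ) : bennett v ≤ v ^ 2 * Real.exp |v| := by
  rcases le_or_gt |v| 1 with h | h
  · refine (bennett_le_sq h).trans ?_
    have := Real.one_le_exp (abs_nonneg v)
    nlinarith [sq_nonneg v]
  · have h1 : bennett v ≤ Real.exp |v| := by
      unfold bennett
      rcases le_or_gt (-1) v with hv | hv
      · have := Real.exp_le_exp.2 (le_abs_self v)
        linarith
      · have h2 : Real.exp v ≤ 1 := Real.exp_le_one_iff.2 (by linarith)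
        have h3 := Real.add_one_le_exp |v|
        have h4 := neg_le_abs v
        linarith
    have h2 : 1 ≤ v ^ 2 := by rw [← sq_abs]; nlinarith
    nlinarith [Real.exp_pos |v|]

/-- Split C by the sign of the row sum; each part costs 21, and monotonicity of the entropy puts
both in terms of |C|. -/
lemma RowSumEvent.sum_abs_le {ι : Type*} {S : Matrix (Fin n) (Fin n) ℝ} {L : ℝ}
    {U : ι → Finset (Fin n)} {m : ι → ℝ} {x : Config n} (h : RowSumEvent S L U m x) (i : ι)
    (C : Finset (Fin n)) :
    ∑ c ∈ C, |rowSum S x (U i) c| ≤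
      C.card * (42 * Real.sqrt (m i * L) * logFactor n C.card) := by
  classical
  have hpart : ∀ (σ : Bool) (C' : Finset (Fin n)), C' ⊆ C →
      boolSign σ * ∑ c ∈ C', rowSum S x (U i) c ≤
        21 * Real.sqrt (m i * L) * entropy n C.card := by
    intro σ C' hC'
    have hmono := entropy_mono (Finset.card_le_card hC') (card_le_of_finset C)
    rcases C'.eq_empty_or_nonempty with h0 | h0
    · have := entropy_nonneg (card_le_of_finset C)
      rw [h0]
      simp
      positivity
    · refine (h i σ C' h0).trans ?_
      gcongr
  have h1 := hpart true (C.filter fun c => 0 ≤ rowSum S x (U i) c) (Finset.filter_subset _ _)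
  have h2 := hpart false (C.filter fun c => ¬ 0 ≤ rowSum S x (U i) c) (Finset.filter_subset _ _)
  simp only [boolSign, if_true, Bool.false_eq_true, if_false, one_mul] at h1 h2
  rw [← Finset.sum_filter_add_sum_filter_not C (fun c => 0 ≤ rowSum S x (U i) c)]
  have h3 : ∑ c ∈ C.filter (fun c => 0 ≤ rowSum S x (U i) c), |rowSum S x (U i) c| =
      ∑ c ∈ C.filter (fun c => 0 ≤ rowSum S x (U i) c), rowSum S x (U i) c :=
    Finset.sum_congr rfl fun c hc => abs_of_nonneg (Finset.mem_filter.1 hc).2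
  have h4 : ∑ c ∈ C.filter (fun c => ¬ 0 ≤ rowSum S x (U i) c), |rowSum S x (U i) c| =
      -1 * ∑ c ∈ C.filter (fun c => ¬ 0 ≤ rowSum S x (U i) c), rowSum S x (U i) c := by
    rw [Finset.mul_sum]
    refine Finset.sum_congr rfl fun c hc => ?_
    rw [abs_of_neg (not_le.1 (Finset.mem_filter.1 hc).2)]
    ring
  rw [h3, h4]
  unfold entropy at h1 h2
  linarith

lemma RowSumEvent.sum_sq_le {ι : Type*} {S : Matrix (Fin n) (Fin n) ℝ} {L : ℝ}
    {U : ι → Finset (Fin n)} {m : ι → ℝ} {x : Config n} (hn : 0 < n)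
    (h : RowSumEvent S L U m x) (i : ι) (hm : 1 ≤ m i * L) :
    ∑ c, rowSum S x (U i) c ^ 2 ≤ 500000 * (n * (m i * L)) := by
  have h1 := sum_comp_le_sum_range (fun c => |rowSum S x (U i) c|)
    (fun j => 42 * Real.sqrt (m i * L) * logFactor n j) (fun y => y ^ 2)
    (fun c => abs_nonneg _) (fun a b ha hab => by gcongr) Finset.univ
    (fun C _ _ => h.sum_abs_le i C)
  simp only [sq_abs, Finset.card_univ, Fintype.card_fin] at h1
  refine h1.trans ?_
  have hs : Real.sqrt (m i * L) ^ 2 = m i * L := Real.sq_sqrt (by linarith)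
  calc _ ≤ ∑ j ∈ Finset.range n, 225792 * (m i * L) * Real.sqrt (n / (j + 1 : ℕ)) := by
        refine Finset.sum_le_sum fun j hj => ?_
        have hj' := Finset.mem_range.1 hj
        have := logFactor_sq_le hn (Nat.succ_pos j) (by omega : j + 1 ≤ n)
        simp only [Nat.succ_eq_add_one] at this
        rw [mul_pow, mul_pow, hs]
        nlinarith
    _ = 225792 * (m i * L) * ∑ j ∈ Finset.range n, Real.sqrt (n / (j + 1 : ℕ)) := by
        rw [Finset.mul_sum]
    _ ≤ 225792 * (m i * L) * (2 * Real.sqrt (n * n)) := by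
        have := sum_sqrt_div_le n n
        gcongr
    _ ≤ _ := by
        rw [Real.sqrt_mul_self (by positivity)]
        have : (0 : ℝ) ≤ n * (m i * L) := by positivity
        nlinarith

/-- By `bennett_le_sq_mul_exp` and rearrangement by rank, the arguments are at most 84c₀ℓ/√M, where
ℓ is the logarithmic factor of the rank. The bound c₀ ≤ 1/336 makes this at most ℓ/4, exactly what
`logFactor_sq_mul_exp_le` can sum. -/
lemma RowSumEvent.sum_bennett_le {ι : Type*} {S : Matrix (Fin n) (Fin n) ℝ} {L c₀ : ℝ}
    {U : ι → Finset (Fin n)} {m : ι → ℝ} {x : Config n} (hn : 0 < n)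
    (hc : 0 ≤ c₀) (hc1 : c₀ ≤ 1 / 336)
    (h : RowSumEvent S L U m x) (i : ι) (hm : 1 ≤ m i * L) (σ : Bool) :
    ∑ c, bennett (boolSign σ * (2 * c₀ / (L * m i)) * rowSum S x (U i) c) ≤
      2000000 * c₀ ^ 2 * (n / (m i * L)) := by
  set M := m i * L with hM
  have hκ : L * m i = M := mul_comm _ _
  rw [hκ]
  set κ := 2 * c₀ / M with hκ
  have hκ0 : 0 ≤ κ := by positivity
  have h1 := sum_comp_le_sum_range (fun c => |rowSum S x (U i) c|)
    (fun j => 42 * Real.sqrt M * logFactor n j) (fun y => (κ * y) ^ 2 * Real.exp (κ * y))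
    (fun c => abs_nonneg _) (fun a b ha hab => by gcongr) Finset.univ
    (fun C _ _ => h.sum_abs_le i C)
  simp only [Finset.card_univ, Fintype.card_fin] at h1
  have h2 : ∑ c, bennett (boolSign σ * κ * rowSum S x (U i) c) ≤
      ∑ c, (κ * |rowSum S x (U i) c|) ^ 2 * Real.exp (κ * |rowSum S x (U i) c|) := by
    refine Finset.sum_le_sum fun c _ => ?_
    have h3 : |boolSign σ * κ * rowSum S x (U i) c| = κ * |rowSum S x (U i) c| := by
      rw [abs_mul, abs_mul, abs_boolSign, abs_of_nonneg hκ0, one_mul]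
    have := bennett_le_sq_mul_exp (boolSign σ * κ * rowSum S x (U i) c)
    rwa [← sq_abs, h3] at this
  refine h2.trans (h1.trans ?_)
  have hs : Real.sqrt M ^ 2 = M := Real.sq_sqrt (by linarith)
  have hs1 : 1 ≤ Real.sqrt M := Real.one_le_sqrt.2 hm
  have hMpos : 0 < M := by linarith
  calc _ ≤ ∑ j ∈ Finset.range n, 903168 * c₀ ^ 2 / M * Real.sqrt (n / (j + 1 : ℕ)) := by
        refine Finset.sum_le_sum fun j hj => ?_
        have hj' := Finset.mem_range.1 hj
        have h3 := logFactor_sq_mul_exp_le hn (Nat.succ_pos j) (by omega : j + 1 ≤ n)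
        have hl := one_le_logFactor (by omega : j + 1 ≤ n)
        simp only [Nat.succ_eq_add_one] at h3
        set ℓ := logFactor n (j + 1) with hℓ
        have h4 : κ * (42 * Real.sqrt M * ℓ) = 84 * c₀ * ℓ / Real.sqrt M := by
          rw [hκ]
          nth_rewrite 1 [← hs]
          field_simp
          ring
        have h5 : 84 * c₀ * ℓ / Real.sqrt M ≤ ℓ / 4 := by
          rw [div_le_iff₀ (by linarith)]
          nlinarith
        rw [h4]
        calc _ ≤ (84 * c₀ * ℓ / Real.sqrt M) ^ 2 * Real.exp (ℓ / 4) := by gcongr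
          _ = 7056 * c₀ ^ 2 / M * (ℓ ^ 2 * Real.exp (ℓ / 4)) := by
              rw [div_pow, hs]
              ring
          _ ≤ 7056 * c₀ ^ 2 / M * (128 * Real.sqrt (n / (j + 1 : ℕ))) := by gcongr
          _ = _ := by ring
    _ = 903168 * c₀ ^ 2 / M * ∑ j ∈ Finset.range n, Real.sqrt (n / (j + 1 : ℕ)) := by
        rw [Finset.mul_sum]
    _ ≤ 903168 * c₀ ^ 2 / M * (2 * Real.sqrt (n * n)) := by
        have := sum_sqrt_div_le n n
        gcongr
    _ = 1806336 * c₀ ^ 2 * (n / M) := by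
        rw [Real.sqrt_mul_self (by positivity)]
        ring
    _ ≤ _ := by gcongr; norm_num

end OperatorNorm

/-! ### Balanced families of bipartitions -/

section Bipartition

variable {n : ℕ}

/-- A Walsh character on the binary expansions. -/
def walsh (A : Finset (Fin n.size)) (a : Fin n) : ℝ :=
  ∏ i ∈ A, if (a : ℕ).testBit i then -1 else 1

lemma walsh_eq_one_or (A : Finset (Fin n.size)) (a : Fin n) : walsh A a = 1 ∨ walsh A a = -1 := by
  unfold walsh
  induction A using Finset.induction_on with
  | empty => simp
  | insert i A hi ih =>
    rw [Finset.prod_insert hi]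
    rcases ih with h | h <;> rw [h] <;> split_ifs <;> simp

/-- The sum over characters factorises over the bits, and the factor at a bit where a and b differ
is 1 - 1 = 0. -/
lemma sum_walsh_mul (a b : Fin n) :
    ∑ A : Finset (Fin n.size), walsh A a * walsh A b = if a = b then 2 ^ n.size else 0 := by
  have h1 : ∀ A : Finset (Fin n.size), walsh A a * walsh A b = ∏ i ∈ A,
      ((if (a : ℕ).testBit i then (-1 : ℝ) else 1) * if (b : ℕ).testBit i then -1 else 1) :=
    fun A => Finset.prod_mul_distrib.symm
  simp only [h1]
  rw [← Finset.powerset_univ, ← Finset.prod_one_add]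
  split_ifs with hab
  · subst hab
    have : ∀ i : Fin n.size, 1 + (if (a : ℕ).testBit i then (-1 : ℝ) else 1) *
        (if (a : ℕ).testBit i then -1 else 1) = 2 := by
      intro i
      split_ifs <;> norm_num
    rw [Finset.prod_congr rfl fun i _ => this i]
    simp
  · have hne : (a : ℕ) ≠ b := fun h => hab (Fin.ext h)
    obtain ⟨i, hi⟩ := Nat.exists_testBit_ne_of_ne hne
    have hin : i < n.size := by
      by_contra hcon
      have hlt : ∀ c : Fin n, (c : ℕ).testBit i = false := by
        intro c
        apply Nat.testBit_lt_two_pow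
        calc (c : ℕ) < n := c.2
          _ < 2 ^ n.size := Nat.lt_size_self n
          _ ≤ 2 ^ i := Nat.pow_le_pow_right (by norm_num) (not_lt.1 hcon)
      exact hi (by rw [hlt, hlt])
    refine Finset.prod_eq_zero (Finset.mem_univ (⟨i, hin⟩ : Fin n.size)) ?_
    cases ha : (a : ℕ).testBit i <;> cases hb : (b : ℕ).testBit i <;> simp_all

/-- The number of characters is linear in n, which keeps the union bound over bipartitions
polynomial. -/
lemma two_pow_size_le (hn : 0 < n) : 2 ^ n.size ≤ 2 * n := by
  have h1 : 0 < n.size := Nat.size_pos.2 hn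
  have h2 : 2 ^ (n.size - 1) ≤ n := Nat.lt_size.1 (by omega)
  calc 2 ^ n.size = 2 * 2 ^ (n.size - 1) := by
        rw [← pow_succ']
        congr 1
        omega
    _ ≤ _ := by omega

/-- Averaging over the bipartitions recovers half of all pairs of distinct points. -/
lemma sum_erase_eq_sum_walsh (b : Fin n) (G : Finset (Fin n)) (f : Fin n → ℝ) :
    ∑ a ∈ G.erase b, f a = 2 / 2 ^ n.size *
      ∑ A : Finset (Fin n.size), ∑ a ∈ G.filter (fun a => walsh A a ≠ walsh A b), f a := by
  -- The indicator of separation by a character is (1 - χ(a)χ(b))/2, so orthogonality of characters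
  -- computes the average.
  have hind : ∀ (A : Finset (Fin n.size)) (a : Fin n),
      (if walsh A a ≠ walsh A b then f a else 0) = f a / 2 - f a / 2 * (walsh A a * walsh A b) := by
    intro A a
    rcases walsh_eq_one_or A a with h1 | h1 <;> rcases walsh_eq_one_or A b with h2 | h2 <;>
      rw [h1, h2] <;> norm_num
  have h1 : ∑ A : Finset (Fin n.size), ∑ a ∈ G.filter (fun a => walsh A a ≠ walsh A b), f a =
      ∑ a ∈ G, (2 ^ n.size * (f a / 2) - f a / 2 * if a = b then 2 ^ n.size else 0) := by
    simp only [Finset.sum_filter, hind]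
    rw [Finset.sum_comm]
    refine Finset.sum_congr rfl fun a _ => ?_
    rw [Finset.sum_sub_distrib, ← Finset.mul_sum, sum_walsh_mul]
    simp
  rw [h1, Finset.mul_sum]
  have h2 : (0 : ℝ) < 2 ^ n.size := by positivity
  have h3 : ∀ a, 2 / 2 ^ n.size * (2 ^ n.size * (f a / 2) - f a / 2 *
      if a = b then (2 : ℝ) ^ n.size else 0) = if a ≠ b then f a else 0 := by
    intro a
    by_cases hab : a = b
    · rw [if_pos hab, if_neg (not_not.2 hab)]
      ring
    · rw [if_neg hab, if_pos hab]
      field_simp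
      ring
  simp only [h3]
  rw [← Finset.sum_filter]
  congr 1
  ext a
  simp [and_comm]

end Bipartition

/-! ### Correlations of the rows with the group means -/

section Correlation

variable {n K : ℕ}

/-- The index of the halves of the groups. -/
abbrev HalfIndex (n K : ℕ) := Fin K × Finset (Fin n.size) × Bool

/-- One side of a bipartition of a group. -/
def halfGroup (z : Fin n → Fin K) (i : HalfIndex n K) : Finset (Fin n) :=
  (group z i.1).filter fun a => walsh i.2.1 a = boolSign i.2.2

/-- The size of a group, as a real number. -/
def groupSize (z : Fin n → Fin K) (k : Fin K) : ℝ := (group z k).card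

lemma halfGroup_empty_true (z : Fin n → Fin K) (k : Fin K) :
    halfGroup z (k, ∅, true) = group z k := by
  ext a
  simp [halfGroup, walsh, boolSign]

lemma card_halfGroup_le (z : Fin n → Fin K) (i : HalfIndex n K) :
    ((halfGroup z i).card : ℝ) ≤ groupSize z i.1 := by
  unfold groupSize
  exact_mod_cast Finset.card_le_card (Finset.filter_subset _ _)

/-- The events on which the noise is controlled. -/
structure GoodEvent (S : Matrix (Fin n) (Fin n) ℝ) (L c₀ : ℝ) (z : Fin n → Fin K)
    (P : Matrix (Fin K) (Fin K) ℝ) (x : Config n) : Prop where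
  deg : DegreeEvent L x
  dis : DiscrepancyEvent L x
  light : LightEvent S (n * L) x
  row : RowSumEvent S L (halfGroup z) (fun i => groupSize z i.1) x
  lin : LinearEvent S L c₀ (fun (q : Fin K × Fin K) c => P q.2 (z c) - P q.1 (z c)) x
  bil : BilinearEvent S L c₀ (halfGroup z) (fun i => groupSize z i.1) x

/-- The bound for the correlations of the rows with sums of rows. -/
def corrBound (n : ℕ) (L c₀ m : ℝ) (t : ℕ) : ℝ :=
  20 * (L / c₀) * entropy n t + 1000000 * c₀ * t * (n * L / m)

lemma corrBound_mono {L c₀ m : ℝ} (hL : 0 ≤ L) (hc : 0 ≤ c₀) (hm : 0 ≤ m) {s t : ℕ} (hst : s ≤ t)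
    (ht : t ≤ n) : corrBound n L c₀ m s ≤ corrBound n L c₀ m t := by
  have := entropy_mono hst ht
  unfold corrBound
  gcongr

/-- The bilinear event bounds the form by a Bennett sum of the row sums, and the row-sum event
bounds that Bennett sum. Passing to T ⊇ T' lets the two halves of a set share one bound. -/
lemma GoodEvent.corr_halfGroup_le {S : Matrix (Fin n) (Fin n) ℝ} {L c₀ : ℝ} {z : Fin n → Fin K}
    {P : Matrix (Fin K) (Fin K) ℝ} {x : Config n} (h : GoodEvent S L c₀ z P x) (hn : 0 < n)
    (hL : 0 < L) (hc : 0 < c₀) (hc1 : c₀ ≤ 1 / 336) (hm : ∀ k, 1 ≤ groupSize z k * L)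
    (i : HalfIndex n K) (σ : Bool) {T T' : Finset (Fin n)} (hTT : T' ⊆ T)
    (hd : Disjoint (halfGroup z i) T') :
    boolSign σ * (∑ b ∈ T', ∑ c, noise S x b c * rowSum S x (halfGroup z i) c) / groupSize z i.1 ≤
      corrBound n L c₀ (groupSize z i.1) T.card := by
  set m := groupSize z i.1 with hmdef
  have hm1 : 1 ≤ m * L := hm i.1
  have hmpos : 0 < m := pos_of_mul_pos_left (by linarith) hL.le
  have hmono := corrBound_mono (n := n) hL.le hc.le hmpos.le (Finset.card_le_card hTT)
    (card_le_of_finset T)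
  refine le_trans ?_ hmono
  rcases T'.eq_empty_or_nonempty with h0 | h0
  · simp [h0, corrBound, entropy]
  refine (h.bil i σ T' h0 hd).trans ?_
  have h1 := h.row.sum_bennett_le hn hc.le hc1 i hm1 σ
  simp only [← hmdef] at h1 ⊢
  calc _ ≤ L / c₀ * (20 * entropy n T'.card + L / 2 * T'.card *
        (2000000 * c₀ ^ 2 * (n / (m * L)))) := by gcongr
    _ = _ := by
        unfold corrBound
        field_simp
        ring

lemma sum_row_mul_rowSum (S : Matrix (Fin n) (Fin n) ℝ) (x : Config n) (b : Fin n)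
    (U : Finset (Fin n)) : ∑ c, noise S x b c * rowSum S x U c =
      ∑ a ∈ U, ∑ c, noise S x b c * noise S x a c := by
  simp only [rowSum, Finset.mul_sum]
  exact Finset.sum_comm

/-- The own group mean: the diagonal has a favourable sign, and the rest is averaged over
bipartitions of the group. -/
lemma GoodEvent.neg_corr_group_le {S : Matrix (Fin n) (Fin n) ℝ} {L c₀ : ℝ} {z : Fin n → Fin K}
    {P : Matrix (Fin K) (Fin K) ℝ} {x : Config n} (h : GoodEvent S L c₀ z P x) (hn : 0 < n)
    (hL : 0 < L) (hc : 0 < c₀) (hc1 : c₀ ≤ 1 / 336) (hm : ∀ k, 1 ≤ groupSize z k * L)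
    (j : Fin K) {T : Finset (Fin n)} (hT : T ⊆ group z j) :
    -(∑ b ∈ T, ∑ c, noise S x b c * rowSum S x (group z j) c) / groupSize z j ≤
      4 * corrBound n L c₀ (groupSize z j) T.card := by
  classical
  set m := groupSize z j with hmdef
  have hmpos : 0 < m := pos_of_mul_pos_left (by linarith [hm j]) hL.le
  set r : ℝ := 2 ^ n.size with hr
  have hrpos : 0 < r := by positivity
  set f : Fin n → Fin n → ℝ := fun b a => ∑ c, noise S x b c * noise S x a c with hf
  -- The terms a = b are squares of row norms; only a lower bound is needed, so they may be dropped.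
  have hdrop : ∑ b ∈ T, ∑ a ∈ (group z j).erase b, f b a ≤
      ∑ b ∈ T, ∑ c, noise S x b c * rowSum S x (group z j) c := by
    refine Finset.sum_le_sum fun b hb => ?_
    rw [sum_row_mul_rowSum, ← Finset.add_sum_erase _ _ (hT hb)]
    have : 0 ≤ ∑ c, noise S x b c * noise S x b c :=
      Finset.sum_nonneg fun c _ => mul_self_nonneg _
    simp only [hf]
    linarith
  -- Vertices on one side of the bipartition are paired with the half of the group on the other
  -- side, which restores the disjointness needed for decoupling.
  have hsplit : ∀ A : Finset (Fin n.size),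
      ∑ b ∈ T, ∑ a ∈ (group z j).filter (fun a => walsh A a ≠ walsh A b), f b a =
      ∑ b ∈ T.filter (fun b => walsh A b = 1),
        ∑ c, noise S x b c * rowSum S x (halfGroup z (j, A, false)) c +
      ∑ b ∈ T.filter (fun b => ¬ walsh A b = 1),
        ∑ c, noise S x b c * rowSum S x (halfGroup z (j, A, true)) c := by
    intro A
    rw [← Finset.sum_filter_add_sum_filter_not T (fun b => walsh A b = 1)]
    congr 1
    · refine Finset.sum_congr rfl fun b hb => ?_
      have hb1 := (Finset.mem_filter.1 hb).2
      rw [sum_row_mul_rowSum]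
      refine Finset.sum_congr ?_ fun _ _ => rfl
      ext a
      simp only [halfGroup, Finset.mem_filter, boolSign, hb1]
      rcases walsh_eq_one_or A a with h1 | h1 <;> simp [h1] <;> norm_num
    · refine Finset.sum_congr rfl fun b hb => ?_
      have hb1 := (Finset.mem_filter.1 hb).2
      have hb2 : walsh A b = -1 := (walsh_eq_one_or A b).resolve_left hb1
      rw [sum_row_mul_rowSum]
      refine Finset.sum_congr ?_ fun _ _ => rfl
      ext a
      simp only [halfGroup, Finset.mem_filter, boolSign, hb2]
      rcases walsh_eq_one_or A a with h1 | h1 <;> simp [h1] <;> norm_num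
  have hA : ∀ A : Finset (Fin n.size),
      -(∑ b ∈ T, ∑ a ∈ (group z j).filter (fun a => walsh A a ≠ walsh A b), f b a) / m ≤
        2 * corrBound n L c₀ m T.card := by
    intro A
    have h1 := h.corr_halfGroup_le hn hL hc hc1 hm (j, A, false) false (T := T)
      (T' := T.filter (fun b => walsh A b = 1)) (Finset.filter_subset _ _) (by
        rw [Finset.disjoint_left]
        intro a ha hb
        have h1 := (Finset.mem_filter.1 ha).2
        have h2 := (Finset.mem_filter.1 hb).2
        simp only [boolSign] at h1
        rw [h2] at h1
        norm_num at h1)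
    have h2 := h.corr_halfGroup_le hn hL hc hc1 hm (j, A, true) false (T := T)
      (T' := T.filter (fun b => ¬ walsh A b = 1)) (Finset.filter_subset _ _) (by
        rw [Finset.disjoint_left]
        intro a ha hb
        have h1 := (Finset.mem_filter.1 ha).2
        have h2 := (Finset.mem_filter.1 hb).2
        simp only [boolSign] at h1
        exact h2 (by simpa using h1))
    simp only [← hmdef] at h1 h2
    have hs : boolSign false = -1 := by simp [boolSign]
    rw [hs] at h1 h2
    rw [hsplit A]
    have h3 : ∀ u v : ℝ, -(u + v) / m = -1 * u / m + -1 * v / m := by intro u v; ring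
    rw [h3]
    linarith
  have havg : ∑ b ∈ T, ∑ a ∈ (group z j).erase b, f b a = 2 / r * ∑ A : Finset (Fin n.size),
      ∑ b ∈ T, ∑ a ∈ (group z j).filter (fun a => walsh A a ≠ walsh A b), f b a := by
    rw [Finset.sum_comm, Finset.mul_sum]
    exact Finset.sum_congr rfl fun b _ => sum_erase_eq_sum_walsh b _ _
  calc _ ≤ -(∑ b ∈ T, ∑ a ∈ (group z j).erase b, f b a) / m := by gcongr
    _ = 2 / r * ∑ A : Finset (Fin n.size),
        -(∑ b ∈ T, ∑ a ∈ (group z j).filter (fun a => walsh A a ≠ walsh A b), f b a) / m := by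
        rw [havg, ← Finset.sum_div, Finset.sum_neg_distrib]
        ring
    _ ≤ 2 / r * ∑ _A : Finset (Fin n.size), 2 * corrBound n L c₀ m T.card := by
        gcongr with A
        exact hA A
    _ = _ := by
        rw [Finset.sum_const, Finset.card_univ, Fintype.card_finset, Fintype.card_fin,
          nsmul_eq_mul]
        push_cast
        rw [← hr]
        field_simp
        ring

/-- The mean of the rows of the deviation in a group. -/
def rowMean (S : Matrix (Fin n) (Fin n) ℝ) (x : Config n) (z : Fin n → Fin K) (k : Fin K)
    (c : Fin n) : ℝ := (∑ a ∈ group z k, deviation S x a c) / groupSize z k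

lemma sum_deviation_group (S : Matrix (Fin n) (Fin n) ℝ) (x : Config n) (U : Finset (Fin n))
    (c : Fin n) : ∑ a ∈ U, deviation S x a c = rowSum S x U c - if c ∈ U then S c c else 0 := by
  simp only [deviation_eq, Finset.sum_sub_distrib, rowSum]
  simp

lemma sum_deviation_mul (S : Matrix (Fin n) (Fin n) ℝ) (x : Config n) (b : Fin n)
    (v : Fin n → ℝ) : ∑ c, deviation S x b c * v c = ∑ c, noise S x b c * v c - S b b * v b := by
  have h : ∀ c, deviation S x b c * v c = noise S x b c * v c - if b = c then S b c * v c else 0 := by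
    intro c
    rw [deviation_eq]
    split_ifs <;> ring
  simp only [h, Finset.sum_sub_distrib]
  simp

lemma abs_rowSum_le {S : Matrix (Fin n) (Fin n) ℝ} {L : ℝ} (hS : IsProbMatrix S L) (x : Config n)
    (U : Finset (Fin n)) (c : Fin n) : |rowSum S x U c| ≤ U.card := by
  unfold rowSum
  refine (Finset.abs_sum_le_sum_abs _ _).trans ?_
  calc _ ≤ ∑ _a ∈ U, (1 : ℝ) := Finset.sum_le_sum fun a _ => abs_noise_le_one hS x a c
    _ = _ := by simp

/-- Deviation and noise differ only on the diagonal. Expanding the product leaves three correction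
terms, each at most L|U|. -/
lemma abs_sum_deviation_mul_sub_le {S : Matrix (Fin n) (Fin n) ℝ} {L : ℝ}
    (hS : IsProbMatrix S L) (x : Config n) {U : Finset (Fin n)} (hU : U.Nonempty) (b : Fin n) :
    |∑ c, deviation S x b c * (∑ a ∈ U, deviation S x a c) -
      ∑ c, noise S x b c * rowSum S x U c| ≤ 3 * L * U.card := by
  have hUc : (1 : ℝ) ≤ U.card := by exact_mod_cast hU.card_pos
  have h1 : ∑ c, deviation S x b c * (∑ a ∈ U, deviation S x a c) -
      ∑ c, noise S x b c * rowSum S x U c =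
      -(∑ c ∈ U, noise S x b c * S c c) - S b b * rowSum S x U b +
        S b b * (if b ∈ U then S b b else 0) := by
    simp only [sum_deviation_group]
    simp only [deviation_eq]
    have h2 : ∀ c, (noise S x b c - if b = c then S b c else 0) *
        (rowSum S x U c - if c ∈ U then S c c else 0) = noise S x b c * rowSum S x U c -
        (if c ∈ U then noise S x b c * S c c else 0) -
        (if b = c then S b c * rowSum S x U c else 0) +
        (if b = c then S b c * (if c ∈ U then S c c else 0) else 0) := by
      intro c
      split_ifs <;> ring
    simp only [h2, Finset.sum_add_distrib, Finset.sum_sub_distrib, sum_ite_mem_const,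
      Finset.sum_ite_eq, Finset.mem_univ, if_true]
    ring
  have hL : 0 ≤ L := (hS.nonneg b b).trans (hS.le b b)
  have h3 : |∑ c ∈ U, noise S x b c * S c c| ≤ L * U.card := by
    refine (Finset.abs_sum_le_sum_abs _ _).trans ?_
    calc _ ≤ ∑ _c ∈ U, L := by
          refine Finset.sum_le_sum fun c _ => ?_
          rw [abs_mul, abs_of_nonneg (hS.nonneg c c)]
          have := abs_noise_le_one hS x b c
          have h4 := hS.nonneg c c
          have h5 := hS.le c c
          nlinarith [abs_nonneg (noise S x b c)]
      _ = _ := by simp [mul_comm]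
  have h4 : |S b b * rowSum S x U b| ≤ L * U.card := by
    rw [abs_mul, abs_of_nonneg (hS.nonneg b b)]
    exact mul_le_mul (hS.le b b) (abs_rowSum_le hS x U b) (abs_nonneg _) hL
  have h5 : |S b b * (if b ∈ U then S b b else 0)| ≤ L * U.card := by
    have h6 := hS.nonneg b b
    have h7 := hS.le b b
    have h8 := hS.le_one b b
    split_ifs
    · rw [abs_of_nonneg (by positivity)]
      nlinarith
    · simp only [mul_zero, abs_zero]
      positivity
  rw [h1]
  rw [abs_le] at *
  constructor <;> linarith [h3.1, h3.2, h4.1, h4.2, h5.1, h5.2]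

/-- The correlation of a row with the separation of two groups. -/
def corr (S : Matrix (Fin n) (Fin n) ℝ) (x : Config n) (z : Fin n → Fin K)
    (P : Matrix (Fin K) (Fin K) ℝ) (b : Fin n) (k : Fin K) : ℝ :=
  ∑ c, deviation S x b c * (P k (z c) - P (z b) (z c)) +
    ∑ c, deviation S x b c * (rowMean S x z k c - rowMean S x z (z b) c)

/-- The squared separation of two groups. -/
def sepSq (z : Fin n → Fin K) (P : Matrix (Fin K) (Fin K) ℝ) (j k : Fin K) : ℝ :=
  ∑ c, (P k (z c) - P j (z c)) ^ 2

lemma sum_mul_rowMean (S : Matrix (Fin n) (Fin n) ℝ) (x : Config n) (z : Fin n → Fin K)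
    (k : Fin K) (b : Fin n) : ∑ c, deviation S x b c * rowMean S x z k c =
      (∑ c, deviation S x b c * (∑ a ∈ group z k, deviation S x a c)) / groupSize z k := by
  rw [Finset.sum_div]
  exact Finset.sum_congr rfl fun c _ => by rw [rowMean, mul_div_assoc]

/-- The linear event gives 6 entropies. The mean of the other group k, disjoint from T, costs one
`corrBound`, and the own group costs four, so 100 more entropies: 106 in all. The diagonal
corrections are L + 3L + 3L. -/
lemma GoodEvent.sum_corr_le {L c₀ m : ℝ} {z : Fin n → Fin K}
    {P : Matrix (Fin K) (Fin K) ℝ} {x : Config n} (h : GoodEvent (signal z P) L c₀ z P x)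
    (hS : IsProbMatrix (signal z P) L) (hP : ∀ j k, 0 ≤ P j k ∧ P j k ≤ L)
    (hn : 0 < n) (hL : 0 < L) (hc : 0 < c₀) (hc1 : c₀ ≤ 1 / 336) (hm0 : 0 < m)
    (hmk : ∀ k, m ≤ groupSize z k) (hmL : 1 ≤ m * L)
    {j k : Fin K} (hjk : j ≠ k) {T : Finset (Fin n)} (hT : T ⊆ group z j) :
    ∑ b ∈ T, corr (signal z P) x z P b k ≤ 106 * (L / c₀) * entropy n T.card +
      T.card * (2 * c₀ * sepSq z P j k + 5000000 * c₀ * (n * L / m) + 7 * L) := by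
  set S := signal z P with hSdef
  have hzT : ∀ b ∈ T, z b = j := fun b hb => (Finset.mem_filter.1 (hT hb)).2
  have hm : ∀ k, 1 ≤ groupSize z k * L := fun k => hmL.trans (by have := hmk k; gcongr)
  have hpos : ∀ k, 0 < groupSize z k := fun k => hm0.trans_le (hmk k)
  have hne : ∀ k, (group z k).Nonempty := fun k => by
    have := hpos k
    unfold groupSize at this
    exact Finset.card_pos.1 (by exact_mod_cast this)
  rcases T.eq_empty_or_nonempty with h0 | h0
  · simp [h0, entropy]
  have hlin := h.lin (j, k) T h0
  have hk := h.corr_halfGroup_le hn hL hc hc1 hm (k, ∅, true) true (subset_refl T) (by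
    rw [halfGroup_empty_true, Finset.disjoint_left]
    intro a ha hb
    exact hjk ((hzT a hb).symm.trans (Finset.mem_filter.1 ha).2))
  have hj := h.neg_corr_group_le hn hL hc hc1 hm j hT
  rw [halfGroup_empty_true] at hk
  simp only [boolSign, if_true, one_mul] at hk
  have hcb : ∀ k, corrBound n L c₀ (groupSize z k) T.card ≤ corrBound n L c₀ m T.card := by
    intro k
    have := hmk k
    unfold corrBound
    gcongr
  have e1 : ∑ b ∈ T, ∑ c, deviation S x b c * (P k (z c) - P (z b) (z c)) ≤
      ∑ b ∈ T, ∑ c, noise S x b c * (P k (z c) - P j (z c)) + T.card * L := by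
    rw [← nsmul_eq_mul, ← Finset.sum_const, ← Finset.sum_add_distrib]
    refine Finset.sum_le_sum fun b hb => ?_
    rw [hzT b hb]
    rw [sum_deviation_mul]
    have h3 := hS.nonneg b b
    have h4 := hS.le_one b b
    have h5 := hP k (z b)
    have h6 := hP j (z b)
    nlinarith
  have hdiff : ∀ k, |∑ b ∈ T, ∑ c, deviation S x b c * rowMean S x z k c -
      (∑ b ∈ T, ∑ c, noise S x b c * rowSum S x (group z k) c) / groupSize z k| ≤
      T.card * (3 * L) := by
    intro k
    rw [Finset.sum_div, ← Finset.sum_sub_distrib]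
    refine (Finset.abs_sum_le_sum_abs _ _).trans ?_
    rw [← nsmul_eq_mul, ← Finset.sum_const]
    refine Finset.sum_le_sum fun b _ => ?_
    rw [sum_mul_rowMean, ← sub_div, abs_div, abs_of_pos (hpos k), div_le_iff₀ (hpos k)]
    exact abs_sum_deviation_mul_sub_le hS x (hne k) b
  have e2 : ∑ b ∈ T, ∑ c, deviation S x b c * (rowMean S x z k c - rowMean S x z (z b) c) =
      ∑ b ∈ T, ∑ c, deviation S x b c * rowMean S x z k c -
      ∑ b ∈ T, ∑ c, deviation S x b c * rowMean S x z j c := by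
    rw [← Finset.sum_sub_distrib]
    refine Finset.sum_congr rfl fun b hb => ?_
    rw [hzT b hb, ← Finset.sum_sub_distrib]
    exact Finset.sum_congr rfl fun c _ => by ring
  have hdk := (abs_le.1 (hdiff k)).2
  have hdj := (abs_le.1 (hdiff j)).1
  have hck := hcb k
  have hcj := hcb j
  simp only [corr, Finset.sum_add_distrib]
  rw [e2]
  have hneg : ∀ u v : ℝ, -u / v = -(u / v) := fun u v => by ring
  rw [hneg] at hj
  have hfin : corrBound n L c₀ m T.card * 5 = 100 * (L / c₀) * entropy n T.card +
      T.card * (5000000 * c₀ * (n * L / m)) := by unfold corrBound; ring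
  have hlin' : 6 * L / c₀ * entropy n T.card = 6 * (L / c₀) * entropy n T.card := by ring
  unfold sepSq
  simp only at hlin hk
  rw [hlin'] at hlin
  linarith

lemma GoodEvent.sum_sq_rowMean_le {S : Matrix (Fin n) (Fin n) ℝ} {L c₀ m : ℝ} {z : Fin n → Fin K}
    {P : Matrix (Fin K) (Fin K) ℝ} {x : Config n} (h : GoodEvent S L c₀ z P x)
    (hS : IsProbMatrix S L) (hn : 0 < n) (hL : 0 < L) (hm0 : 0 < m)
    (hmk : ∀ k, m ≤ groupSize z k) (hmL : 1 ≤ m * L) (k : Fin K) :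
    ∑ c, rowMean S x z k c ^ 2 ≤ 1100000 * (n * L / m) := by
  have hm : 1 ≤ groupSize z k * L := hmL.trans (by have := hmk k; gcongr)
  have h1 := h.row.sum_sq_le hn (k, ∅, true) hm
  rw [halfGroup_empty_true] at h1
  set M := groupSize z k with hM
  have hMpos : 0 < M := hm0.trans_le (hmk k)
  have hn1 : (1 : ℝ) ≤ n := by exact_mod_cast hn
  have h2 : ∑ c, (∑ a ∈ group z k, deviation S x a c) ^ 2 ≤ 1100000 * (n * L) * M := by
    calc _ ≤ ∑ c, (2 * rowSum S x (group z k) c ^ 2 + 2 * if c ∈ group z k then L else 0) := by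
          refine Finset.sum_le_sum fun c _ => ?_
          rw [sum_deviation_group]
          have h3 := hS.nonneg c c
          have h4 := hS.le c c
          have h5 := hS.le_one c c
          split_ifs
          · nlinarith [sq_nonneg (rowSum S x (group z k) c + S c c)]
          · nlinarith [sq_nonneg (rowSum S x (group z k) c)]
      _ = 2 * ∑ c, rowSum S x (group z k) c ^ 2 + 2 * (M * L) := by
          rw [Finset.sum_add_distrib, ← Finset.mul_sum, ← Finset.mul_sum, sum_ite_mem_const,
            Finset.sum_const, nsmul_eq_mul, hM, groupSize]
      _ ≤ 2 * (500000 * (n * (M * L))) + 2 * (n * (M * L)) := by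
          have : M * L ≤ n * (M * L) := le_mul_of_one_le_left (by positivity) hn1
          linarith
      _ ≤ _ := by
          have : 0 ≤ n * (M * L) := by positivity
          nlinarith
  simp only [rowMean, div_pow, ← Finset.sum_div, ← hM]
  rw [div_le_iff₀ (by positivity)]
  refine h2.trans ?_
  have h3 : m ≤ M := hmk k
  calc _ = 1100000 * (n * L / m) * (m * M) := by field_simp
    _ ≤ 1100000 * (n * L / m) * (M * M) := by gcongr
    _ = _ := by ring

end Correlation

/-! ### Feasible matrices -/

section Feasible

variable {n K : ℕ}

/-- The matrix averaging over the groups. -/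
def blockMean (z : Fin n → Fin K) : Matrix (Fin n) (Fin n) ℝ :=
  Matrix.of fun a b => if z a = z b then 1 / groupSize z (z a) else 0

lemma blockMean_apply (z : Fin n → Fin K) (a b : Fin n) :
    blockMean z a b = if z a = z b then 1 / groupSize z (z a) else 0 := rfl

lemma groupSize_pos (z : Fin n → Fin K) (a : Fin n) : 0 < groupSize z (z a) := by
  unfold groupSize
  have : (group z (z a)).Nonempty := ⟨a, by simp [group]⟩
  exact_mod_cast this.card_pos

lemma groupSize_eq_sum (z : Fin n → Fin K) (k : Fin K) :
    groupSize z k = ∑ b, if k = z b then (1 : ℝ) else 0 := by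
  unfold groupSize group
  rw [Finset.card_filter]
  push_cast
  exact Finset.sum_congr rfl fun b _ => by simp [eq_comm]

lemma blockMean_comm (z : Fin n → Fin K) (a b : Fin n) : blockMean z a b = blockMean z b a := by
  rw [blockMean_apply, blockMean_apply]
  by_cases h : z a = z b
  · rw [if_pos h, if_pos h.symm, h]
  · rw [if_neg h, if_neg (Ne.symm h)]

lemma blockMean_nonneg (z : Fin n → Fin K) (a b : Fin n) : 0 ≤ blockMean z a b := by
  rw [blockMean_apply]
  split_ifs
  · exact (one_div_pos.2 (groupSize_pos z a)).le
  · exact le_rfl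

lemma sum_blockMean (z : Fin n → Fin K) (a : Fin n) : ∑ b, blockMean z a b = 1 := by
  have h : ∀ b, blockMean z a b = 1 / groupSize z (z a) * if z a = z b then (1 : ℝ) else 0 := by
    intro b
    rw [blockMean_apply]
    split_ifs <;> simp
  simp only [h]
  rw [← Finset.mul_sum, ← groupSize_eq_sum]
  exact one_div_mul_cancel (groupSize_pos z a).ne'

lemma sum_blockMean_mul (z : Fin n → Fin K) (a b : Fin n) :
    ∑ c, blockMean z a c * blockMean z c b = blockMean z a b := by
  have h : ∀ c, blockMean z a c * blockMean z c b = blockMean z a c * blockMean z a b := by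
    intro c
    simp only [blockMean_apply]
    by_cases hac : z a = z c
    · rw [if_pos hac, ← hac]
    · rw [if_neg hac, zero_mul, zero_mul]
  simp only [h]
  rw [← Finset.sum_mul, sum_blockMean, one_mul]

lemma blockMean_mul_self (z : Fin n → Fin K) : blockMean z * blockMean z = blockMean z := by
  ext a b
  rw [Matrix.mul_apply, sum_blockMean_mul]

lemma isHermitian_blockMean (z : Fin n → Fin K) : (blockMean z).conjTranspose = blockMean z := by
  ext a b
  rw [Matrix.conjTranspose_apply, star_trivial, blockMean_comm]

lemma trace_blockMean {z : Fin n → Fin K} (hz : Function.Surjective z) :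
    ∑ a, 1 / groupSize z (z a) = K := by
  rw [← Finset.sum_fiberwise (s := Finset.univ) (g := z)]
  have h : ∀ k, ∑ a ∈ Finset.univ.filter (fun a => z a = k), 1 / groupSize z (z a) = 1 := by
    intro k
    obtain ⟨a, rfl⟩ := hz k
    have h2 : ∀ b ∈ Finset.univ.filter (fun b => z b = z a), 1 / groupSize z (z b) =
        1 / groupSize z (z a) := fun b hb => by rw [(Finset.mem_filter.1 hb).2]
    rw [Finset.sum_congr rfl h2, Finset.sum_const, nsmul_eq_mul]
    exact mul_one_div_cancel (groupSize_pos z a).ne'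
  rw [Finset.sum_congr rfl fun k _ => h k]
  simp

lemma blockMean_mem_feasibleSet {z : Fin n → Fin K} (hz : Function.Surjective z) {m α : ℝ}
    (hm0 : 0 < m) (hmk : ∀ k, m ≤ groupSize z k) (hα : 1 / m ≤ α) :
    blockMean z ∈ feasibleSet n K α := by
  refine ⟨?_, ?_, ?_, fun a b => ⟨blockMean_nonneg z a b, ?_⟩⟩
  · have h := Matrix.posSemidef_self_mul_conjTranspose (blockMean z)
    rwa [isHermitian_blockMean, blockMean_mul_self] at h
  · rw [← trace_blockMean hz, Matrix.trace]
    refine Finset.sum_congr rfl fun a _ => ?_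
    rw [Matrix.diag_apply, blockMean_apply, if_pos rfl]
  · funext a
    simp only [Matrix.mulVec, dotProduct, Pi.one_apply, mul_one]
    exact sum_blockMean z a
  · rw [blockMean_apply]
    have h1 : 1 / groupSize z (z a) ≤ 1 / m := one_div_le_one_div_of_le hm0 (hmk _)
    have h2 : 0 < 1 / m := by positivity
    split_ifs <;> linarith

variable {α : ℝ} {B : Matrix (Fin n) (Fin n) ℝ}

lemma feasible_comm (hB : B ∈ feasibleSet n K α) (a b : Fin n) : B a b = B b a := by
  have := hB.1.isHermitian.apply b a
  simpa using this

lemma feasible_row_sum (hB : B ∈ feasibleSet n K α) (a : Fin n) : ∑ b, B a b = 1 := by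
  have := congrFun hB.2.2.1 a
  simpa [Matrix.mulVec, dotProduct] using this

lemma feasible_col_sum (hB : B ∈ feasibleSet n K α) (b : Fin n) : ∑ a, B a b = 1 := by
  rw [← feasible_row_sum hB b]
  exact Finset.sum_congr rfl fun a _ => feasible_comm hB a b

lemma exists_eq_sum_of_posSemidef {M : Matrix (Fin n) (Fin n) ℝ} (hM : M.PosSemidef) :
    ∃ (d : ℕ) (V : Fin d → Fin n → ℝ), ∀ a b, M a b = ∑ i, V i a * V i b := by
  obtain ⟨d, V, hV⟩ := Matrix.posSemidef_iff_eq_sum_vecMulVec.1 hM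
  refine ⟨d, V, fun a b => ?_⟩
  rw [hV, Matrix.sum_apply]
  exact Finset.sum_congr rfl fun i _ => by simp [Matrix.vecMulVec_apply]

/-- The mass that a feasible matrix puts between distinct groups. -/
def crossMass (z : Fin n → Fin K) (B : Matrix (Fin n) (Fin n) ℝ) : ℝ :=
  ∑ a, ∑ b, if z a = z b then 0 else B a b

lemma crossMass_nonneg (z : Fin n → Fin K) (hB : B ∈ feasibleSet n K α) : 0 ≤ crossMass z B :=
  Finset.sum_nonneg fun a _ => Finset.sum_nonneg fun b _ => by
    split_ifs
    · exact le_rfl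
    · exact (hB.2.2.2 a b).1

/-- Since rows of B sum to 1, K is the sum of B_ab/|G_{z(a)}| over all pairs. Pairs within a group
cancel against B*, and the others have weight at most 1/m. -/
lemma card_sub_inner_blockMean_le {z : Fin n → Fin K} (hz : Function.Surjective z) {m : ℝ}
    (hm0 : 0 < m) (hmk : ∀ k, m ≤ groupSize z k) (hB : B ∈ feasibleSet n K α) :
    K - ∑ a, ∑ b, B a b * blockMean z a b ≤ crossMass z B / m := by
  have h1 : (K : ℝ) = ∑ a, ∑ b, B a b * (1 / groupSize z (z a)) := by
    rw [← trace_blockMean hz]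
    refine Finset.sum_congr rfl fun a _ => ?_
    rw [← Finset.sum_mul, feasible_row_sum hB, one_mul]
  rw [h1, crossMass, ← Finset.sum_sub_distrib, Finset.sum_div]
  refine Finset.sum_le_sum fun a _ => ?_
  rw [← Finset.sum_sub_distrib, Finset.sum_div]
  refine Finset.sum_le_sum fun b _ => ?_
  rw [blockMean_apply]
  split_ifs
  · simp
  · rw [mul_zero, sub_zero, mul_one_div]
    have := (hB.2.2.2 a b).1
    have := hmk (z a)
    gcongr

/-- The squared distance to the block matrix is controlled by the mass between groups. -/
lemma sum_sq_sub_blockMean_le {z : Fin n → Fin K} (hz : Function.Surjective z) {m : ℝ}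
    (hm0 : 0 < m) (hmk : ∀ k, m ≤ groupSize z k) (hB : B ∈ feasibleSet n K α) :
    ∑ a, ∑ b, (B a b - blockMean z a b) ^ 2 ≤ 2 * (crossMass z B / m) := by
  have h1 := card_sub_inner_blockMean_le hz hm0 hmk hB
  have hdiag : ∀ a b, B a b ^ 2 ≤ B a a * B b b := by
    intro a b
    obtain ⟨d, V, he⟩ := exists_eq_sum_of_posSemidef hB.1
    rw [he a b, he a a, he b b]
    have := Finset.sum_mul_sq_le_sq_mul_sq Finset.univ (fun i => V i a) (fun i => V i b)
    simpa [pow_two] using this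
  -- Positivity gives B_ab ≤ (B_aa + B_bb)/2; with unit row sums, the squared norm is at most the
  -- trace, which is also the squared norm of B*.
  have h2 : ∑ a, ∑ b, B a b ^ 2 ≤ K := by
    have htr : ∑ a, B a a = K := hB.2.1
    calc _ ≤ ∑ a, ∑ b, B a b * ((B a a + B b b) / 2) := by
          refine Finset.sum_le_sum fun a _ => Finset.sum_le_sum fun b _ => ?_
          have hab := (hB.2.2.2 a b).1
          have haa := (hB.2.2.2 a a).1
          have hbb := (hB.2.2.2 b b).1
          have hle : B a b ≤ (B a a + B b b) / 2 := by
            refine le_of_sq_le_sq ?_ (by positivity)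
            nlinarith [hdiag a b, sq_nonneg (B a a - B b b)]
          rw [pow_two]
          exact mul_le_mul_of_nonneg_left hle hab
      _ = ∑ a, ∑ b, B a b * (B a a / 2) + ∑ a, ∑ b, B a b * (B b b / 2) := by
          rw [← Finset.sum_add_distrib]
          refine Finset.sum_congr rfl fun a _ => ?_
          rw [← Finset.sum_add_distrib]
          exact Finset.sum_congr rfl fun b _ => by ring
      _ = ∑ a, B a a / 2 + ∑ b, B b b / 2 := by
          congr 1
          · refine Finset.sum_congr rfl fun a _ => ?_
            rw [← Finset.sum_mul, feasible_row_sum hB, one_mul]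
          · rw [Finset.sum_comm]
            refine Finset.sum_congr rfl fun b _ => ?_
            rw [← Finset.sum_mul, feasible_col_sum hB, one_mul]
      _ = _ := by rw [← Finset.sum_div, htr]; ring
  have h3 : ∑ a, ∑ b, blockMean z a b ^ 2 = K := by
    rw [← trace_blockMean hz]
    refine Finset.sum_congr rfl fun a _ => ?_
    have : ∑ b, blockMean z a b ^ 2 = ∑ b, blockMean z a b * blockMean z b a :=
      Finset.sum_congr rfl fun b _ => by rw [blockMean_comm z b a, pow_two]
    rw [this, sum_blockMean_mul, blockMean_apply, if_pos rfl]
  have h4 : ∑ a, ∑ b, (B a b - blockMean z a b) ^ 2 = ∑ a, ∑ b, B a b ^ 2 -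
      2 * ∑ a, ∑ b, B a b * blockMean z a b + ∑ a, ∑ b, blockMean z a b ^ 2 := by
    rw [Finset.mul_sum, ← Finset.sum_sub_distrib, ← Finset.sum_add_distrib]
    refine Finset.sum_congr rfl fun a _ => ?_
    rw [Finset.mul_sum, ← Finset.sum_sub_distrib, ← Finset.sum_add_distrib]
    exact Finset.sum_congr rfl fun b _ => by ring
  rw [h4, h3]
  linarith

/-! ### The compression to the within-group fluctuations -/

/-- The compression of a feasible matrix to the vectors with zero mean in each group. -/
def compression (z : Fin n → Fin K) (B : Matrix (Fin n) (Fin n) ℝ) : Matrix (Fin n) (Fin n) ℝ :=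
  (1 - blockMean z) * B * (1 - blockMean z)

lemma posSemidef_compression (z : Fin n → Fin K) (hB : B ∈ feasibleSet n K α) :
    (compression z B).PosSemidef := by
  have h := hB.1.mul_mul_conjTranspose_same (1 - blockMean z)
  rwa [Matrix.conjTranspose_sub, Matrix.conjTranspose_one, isHermitian_blockMean] at h

/-- By cyclicity and idempotence the trace is K minus the inner product of B with B*. -/
lemma trace_compression_le {z : Fin n → Fin K} (hz : Function.Surjective z) {m : ℝ}
    (hm0 : 0 < m) (hmk : ∀ k, m ≤ groupSize z k) (hB : B ∈ feasibleSet n K α) :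
    (compression z B).trace ≤ crossMass z B / m := by
  refine le_trans (le_of_eq ?_) (card_sub_inner_blockMean_le hz hm0 hmk hB)
  have hQ : (1 - blockMean z) * (1 - blockMean z) = 1 - blockMean z := by
    rw [sub_mul, mul_sub, mul_sub, blockMean_mul_self]
    simp
  rw [compression, Matrix.trace_mul_comm, ← mul_assoc, hQ, sub_mul, one_mul, Matrix.trace_sub,
    hB.2.1]
  congr 1
  rw [Matrix.trace_mul_comm, Matrix.trace]
  refine Finset.sum_congr rfl fun a _ => ?_
  rw [Matrix.diag_apply, Matrix.mul_apply]
  exact Finset.sum_congr rfl fun b _ => by rw [blockMean_comm]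

lemma blockMean_mul_mem {M : Matrix (Fin n) (Fin n) ℝ} (z : Fin n → Fin K)
    (hM : ∀ a b, 0 ≤ M a b ∧ M a b ≤ α) (a b : Fin n) :
    0 ≤ (blockMean z * M) a b ∧ (blockMean z * M) a b ≤ α := by
  rw [Matrix.mul_apply]
  refine ⟨Finset.sum_nonneg fun c _ => mul_nonneg (blockMean_nonneg z a c) (hM c b).1, ?_⟩
  calc _ ≤ ∑ c, blockMean z a c * α :=
        Finset.sum_le_sum fun c _ => mul_le_mul_of_nonneg_left (hM c b).2 (blockMean_nonneg z a c)
    _ = α := by rw [← Finset.sum_mul, sum_blockMean, one_mul]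

lemma mul_blockMean_mem {M : Matrix (Fin n) (Fin n) ℝ} (z : Fin n → Fin K)
    (hM : ∀ a b, 0 ≤ M a b ∧ M a b ≤ α) (a b : Fin n) :
    0 ≤ (M * blockMean z) a b ∧ (M * blockMean z) a b ≤ α := by
  rw [Matrix.mul_apply]
  refine ⟨Finset.sum_nonneg fun c _ => mul_nonneg (hM a c).1 (blockMean_nonneg z c b), ?_⟩
  calc _ ≤ ∑ c, α * blockMean z b c := by
        refine Finset.sum_le_sum fun c _ => ?_
        rw [blockMean_comm z c b]
        exact mul_le_mul_of_nonneg_right (hM a c).2 (blockMean_nonneg z b c)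
    _ = α := by rw [← Finset.mul_sum, sum_blockMean, mul_one]

/-- Averaging over groups preserves [0,α], and the compression is a signed sum of four such
matrices, two with each sign. -/
lemma abs_compression_le (z : Fin n → Fin K) (hB : B ∈ feasibleSet n K α) (a b : Fin n) :
    |compression z B a b| ≤ 2 * α := by
  have h0 := hB.2.2.2
  have h1 := blockMean_mul_mem z h0
  have h2 := mul_blockMean_mem z h0
  have h3 := mul_blockMean_mem z h1
  have h4 : compression z B a b = B a b - (blockMean z * B) a b - (B * blockMean z) a b +
      (blockMean z * B * blockMean z) a b := by
    have : compression z B = B - blockMean z * B - B * blockMean z +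
        blockMean z * B * blockMean z := by
      unfold compression
      noncomm_ring
    rw [this]
    simp
  rw [h4, abs_le]
  constructor <;>
    linarith [(h0 a b).1, (h0 a b).2, (h1 a b).1, (h1 a b).2, (h2 a b).1, (h2 a b).2, (h3 a b).1,
      (h3 a b).2]

/-! ### The quadratic decomposition -/

/-- The group mean of a vector. -/
def groupAvg (z : Fin n → Fin K) (v : Fin n → ℝ) (a : Fin n) : ℝ := ∑ b, blockMean z a b * v b

lemma sum_blockMean_quad (z : Fin n → Fin K) (v : Fin n → ℝ) :
    ∑ a, ∑ b, blockMean z a b * (v a * v b) = ∑ a, v a * groupAvg z v a := by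
  refine Finset.sum_congr rfl fun a _ => ?_
  rw [groupAvg, Finset.mul_sum]
  exact Finset.sum_congr rfl fun b _ => by ring

lemma sum_groupAvg_sq (z : Fin n → Fin K) (v : Fin n → ℝ) :
    ∑ a, groupAvg z v a ^ 2 = ∑ a, v a * groupAvg z v a := by
  calc ∑ a, groupAvg z v a ^ 2 = ∑ a, ∑ b, ∑ c, blockMean z b a * blockMean z a c * (v b * v c) := by
        refine Finset.sum_congr rfl fun a _ => ?_
        rw [pow_two, groupAvg, Finset.sum_mul_sum]
        refine Finset.sum_congr rfl fun b _ => Finset.sum_congr rfl fun c _ => ?_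
        rw [blockMean_comm z a b]
        ring
    _ = ∑ b, ∑ c, (∑ a, blockMean z b a * blockMean z a c) * (v b * v c) := by
        rw [Finset.sum_comm]
        refine Finset.sum_congr rfl fun b _ => ?_
        rw [Finset.sum_comm]
        refine Finset.sum_congr rfl fun c _ => ?_
        rw [Finset.sum_mul]
    _ = ∑ b, ∑ c, blockMean z b c * (v b * v c) := by simp only [sum_blockMean_mul]
    _ = _ := sum_blockMean_quad z v

/-- Expand around the group averages w. Unit row and column sums and symmetry of B reduce the mixed
terms, and |w|² = ⟨v,w⟩ since averaging is an orthogonal projection. The first sum vanishes on pairs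
within a group, which is what isolates the mass between groups. -/
lemma quad_sub_blockMean (z : Fin n → Fin K) (hB : B ∈ feasibleSet n K α) (v : Fin n → ℝ) :
    ∑ a, ∑ b, B a b * (v a * v b) - ∑ a, ∑ b, blockMean z a b * (v a * v b) =
      ∑ a, ∑ b, B a b * (2 * ((groupAvg z v a - groupAvg z v b) * (v b - groupAvg z v b)) -
        (groupAvg z v a - groupAvg z v b) ^ 2 / 2) +
      ∑ a, ∑ b, B a b * ((v a - groupAvg z v a) * (v b - groupAvg z v b)) := by
  set w := groupAvg z v with hw
  rw [sum_blockMean_quad, ← hw]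
  have hsq : ∑ a, w a ^ 2 = ∑ a, v a * w a := sum_groupAvg_sq z v
  have hrow : ∀ f : Fin n → ℝ, ∑ a, ∑ b, B a b * f a = ∑ a, f a := by
    intro f
    refine Finset.sum_congr rfl fun a _ => ?_
    rw [← Finset.sum_mul, feasible_row_sum hB, one_mul]
  have hcol : ∀ f : Fin n → ℝ, ∑ a, ∑ b, B a b * f b = ∑ b, f b := by
    intro f
    rw [Finset.sum_comm]
    refine Finset.sum_congr rfl fun b _ => ?_
    rw [← Finset.sum_mul, feasible_col_sum hB, one_mul]
  have hsymm : ∑ a, ∑ b, B a b * (v a * w b) = ∑ a, ∑ b, B a b * (w a * v b) := by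
    rw [Finset.sum_comm]
    refine Finset.sum_congr rfl fun b _ => Finset.sum_congr rfl fun a _ => ?_
    rw [feasible_comm hB a b]
    ring
  have e : ∑ a, ∑ b, B a b * (2 * ((w a - w b) * (v b - w b)) - (w a - w b) ^ 2 / 2) +
      ∑ a, ∑ b, B a b * ((v a - w a) * (v b - w b)) =
      ∑ a, ∑ b, B a b * (v a * v b) + (∑ a, ∑ b, B a b * (w a * v b) -
        ∑ a, ∑ b, B a b * (v a * w b)) - ∑ a, ∑ b, B a b * (2 * (v b * w b)) +
        ∑ a, ∑ b, B a b * (3 / 2 * w b ^ 2) - ∑ a, ∑ b, B a b * (1 / 2 * w a ^ 2) := by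
    simp only [← Finset.sum_add_distrib, ← Finset.sum_sub_distrib]
    exact Finset.sum_congr rfl fun a _ => Finset.sum_congr rfl fun b _ => by ring
  rw [e, hsymm, hcol (fun b => 2 * (v b * w b)), hcol (fun b => 3 / 2 * w b ^ 2),
    hrow (fun a => 1 / 2 * w a ^ 2), ← Finset.mul_sum, ← Finset.mul_sum, ← Finset.mul_sum, hsq]
  ring

lemma frobInner_mul_transpose (X M : Matrix (Fin n) (Fin n) ℝ) :
    frobInner (X * X.transpose) M = ∑ c, ∑ a, ∑ b, M a b * (X a c * X b c) := by
  unfold frobInner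
  have h : ∀ a b, (X * X.transpose) a b * M a b = ∑ c, M a b * (X a c * X b c) := by
    intro a b
    rw [Matrix.mul_apply, Finset.sum_mul]
    exact Finset.sum_congr rfl fun c _ => by rw [Matrix.transpose_apply]; ring
  simp only [h]
  rw [Finset.sum_comm' (t' := Finset.univ) (s' := fun _ => Finset.univ) (by simp)]
  conv_rhs => rw [Finset.sum_comm]
  rw [Finset.sum_comm]
  exact Finset.sum_congr rfl fun a _ => Finset.sum_comm

/-- Optimality against the block matrix. -/
lemma IsRelaxedKMeans.basic_ineq {X : Matrix (Fin n) (Fin n) ℝ} {z : Fin n → Fin K}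
    (h : IsRelaxedKMeans K α X B) (hz : blockMean z ∈ feasibleSet n K α) :
    ∑ a, ∑ b, B a b * ∑ c, ((groupAvg z (fun a => X a c) a - groupAvg z (fun a => X a c) b) ^ 2 / 2 -
      2 * ((groupAvg z (fun a => X a c) a - groupAvg z (fun a => X a c) b) *
        (X b c - groupAvg z (fun a => X a c) b))) ≤
      ∑ c, ∑ a, ∑ b, B a b * ((X a c - groupAvg z (fun a => X a c) a) *
        (X b c - groupAvg z (fun a => X a c) b)) := by
  have h1 : frobInner (X * X.transpose) (blockMean z) ≤ frobInner (X * X.transpose) B := h.2 hz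
  rw [frobInner_mul_transpose, frobInner_mul_transpose, ← sub_nonneg, ← Finset.sum_sub_distrib] at h1
  simp only [quad_sub_blockMean z h.1, Finset.sum_add_distrib] at h1
  have h2 : ∑ a, ∑ b, B a b * ∑ c, ((groupAvg z (fun a => X a c) a -
      groupAvg z (fun a => X a c) b) ^ 2 / 2 -
      2 * ((groupAvg z (fun a => X a c) a - groupAvg z (fun a => X a c) b) *
        (X b c - groupAvg z (fun a => X a c) b))) =
      -∑ c, ∑ a, ∑ b, B a b * (2 * ((groupAvg z (fun a => X a c) a -
        groupAvg z (fun a => X a c) b) * (X b c - groupAvg z (fun a => X a c) b)) -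
        (groupAvg z (fun a => X a c) a - groupAvg z (fun a => X a c) b) ^ 2 / 2) := by
    simp only [Finset.mul_sum, ← Finset.sum_neg_distrib]
    conv_rhs => rw [Finset.sum_comm]
    refine Finset.sum_congr rfl fun a _ => ?_
    conv_rhs => rw [Finset.sum_comm]
    exact Finset.sum_congr rfl fun b _ => Finset.sum_congr rfl fun c _ => by ring
  rw [h2]
  linarith

end Feasible

/-! ### Quadratic forms of the within-group fluctuations -/

section Fluctuation

variable {n K : ℕ}

lemma sum_compression_mul (z : Fin n → Fin K) (B : Matrix (Fin n) (Fin n) ℝ) (v : Fin n → ℝ) :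
    ∑ a, ∑ b, compression z B a b * (v a * v b) =
      ∑ a, ∑ b, B a b * ((v a - groupAvg z v a) * (v b - groupAvg z v b)) := by
  have hquad : ∀ (M : Matrix (Fin n) (Fin n) ℝ) (w : Fin n → ℝ),
      ∑ a, ∑ b, M a b * (w a * w b) = w ⬝ᵥ M.mulVec w := by
    intro M w
    simp only [dotProduct, Matrix.mulVec, Finset.mul_sum]
    exact Finset.sum_congr rfl fun a _ => Finset.sum_congr rfl fun b _ => by ring
  have hQ : (1 - blockMean z).mulVec v = fun a => v a - groupAvg z v a := by
    rw [Matrix.sub_mulVec, Matrix.one_mulVec]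
    rfl
  have hQ' : Matrix.vecMul v (1 - blockMean z) = fun a => v a - groupAvg z v a := by
    rw [← hQ, ← Matrix.mulVec_transpose, Matrix.transpose_sub, Matrix.transpose_one]
    congr 2
    ext a b
    exact blockMean_comm z b a
  rw [hquad, hquad B fun a => v a - groupAvg z v a, compression, ← Matrix.mulVec_mulVec,
    ← Matrix.mulVec_mulVec, hQ, Matrix.dotProduct_mulVec, hQ']

/-- Write R as a Gram matrix and split W into its block on A × A and the rest, using (s+t)² ≤ 2s² +
2t². The block costs its squared operator norm times the trace of R; the rest is bounded entry by
entry. -/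
lemma sum_sum_quad_le_of_split {R W : Matrix (Fin n) (Fin n) ℝ} (hR : R.PosSemidef)
    {A : Finset (Fin n)} {κ η : ℝ}
    (hκ0 : 0 ≤ κ)
    (hκ : ∀ u : Fin n → ℝ, ∑ c ∈ A, (∑ a ∈ A, W a c * u a) ^ 2 ≤ κ * ∑ a ∈ A, u a ^ 2)
    (hη : ∀ a b, |R a b| ≤ η) :
    ∑ c, ∑ a, ∑ b, R a b * (W a c * W b c) ≤
      2 * (κ * R.trace) + 2 * (η * ∑ c, (∑ a, if a ∈ A ∧ c ∈ A then 0 else |W a c|) ^ 2) := by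
  classical
  obtain ⟨d, V, hV⟩ := exists_eq_sum_of_posSemidef hR
  have hform : ∀ w : Fin n → ℝ, ∑ a, ∑ b, R a b * (w a * w b) = ∑ i, (∑ a, V i a * w a) ^ 2 := by
    intro w
    simp only [hV, pow_two, Finset.sum_mul]
    rw [Finset.sum_comm' (t' := Finset.univ) (s' := fun _ => Finset.univ) (by simp)]
    conv_rhs => rw [Finset.sum_comm]
    rw [Finset.sum_comm]
    refine Finset.sum_congr rfl fun a _ => ?_
    rw [Finset.sum_comm]
    refine Finset.sum_congr rfl fun i _ => ?_
    rw [Finset.mul_sum]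
    exact Finset.sum_congr rfl fun b _ => by ring
  set W1 : Fin n → Fin n → ℝ := fun a c => if a ∈ A ∧ c ∈ A then W a c else 0 with hW1
  set W2 : Fin n → Fin n → ℝ := fun a c => if a ∈ A ∧ c ∈ A then 0 else W a c with hW2
  have hsplit : ∀ a c, W a c = W1 a c + W2 a c := by
    intro a c
    simp only [hW1, hW2]
    split_ifs <;> simp
  have hstep : ∀ c, ∑ a, ∑ b, R a b * (W a c * W b c) ≤
      2 * ∑ i, (∑ a, V i a * W1 a c) ^ 2 + 2 * ∑ a, ∑ b, R a b * (W2 a c * W2 b c) := by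
    intro c
    rw [hform (fun a => W a c), hform (fun a => W2 a c), Finset.mul_sum, Finset.mul_sum,
      ← Finset.sum_add_distrib]
    refine Finset.sum_le_sum fun i _ => ?_
    have : ∑ a, V i a * W a c = ∑ a, V i a * W1 a c + ∑ a, V i a * W2 a c := by
      rw [← Finset.sum_add_distrib]
      exact Finset.sum_congr rfl fun a _ => by rw [hsplit]; ring
    rw [this]
    nlinarith [sq_nonneg (∑ a, V i a * W1 a c - ∑ a, V i a * W2 a c)]
  have h1 : ∑ c, ∑ i, (∑ a, V i a * W1 a c) ^ 2 ≤ κ * R.trace := by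
    have htr : R.trace = ∑ i, ∑ a, V i a ^ 2 := by
      rw [Finset.sum_comm, Matrix.trace]
      refine Finset.sum_congr rfl fun a _ => ?_
      rw [Matrix.diag_apply, hV]
      exact Finset.sum_congr rfl fun i _ => by ring
    rw [Finset.sum_comm, htr, Finset.mul_sum]
    refine Finset.sum_le_sum fun i _ => ?_
    have e : ∀ c, (∑ a, V i a * W1 a c) ^ 2 =
        if c ∈ A then (∑ a ∈ A, W a c * V i a) ^ 2 else 0 := by
      intro c
      by_cases hc : c ∈ A
      · rw [if_pos hc, ← Finset.sum_filter_add_sum_filter_not Finset.univ (fun a => a ∈ A)]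
        rw [Finset.sum_eq_zero (s := Finset.univ.filter fun a => ¬ a ∈ A), add_zero]
        · rw [Finset.filter_mem_eq_inter, Finset.univ_inter]
          congr 1
          refine Finset.sum_congr rfl fun a ha => ?_
          simp only [hW1, ha, hc, and_self, if_true]
          ring
        · intro a ha
          simp [hW1, (Finset.mem_filter.1 ha).2]
      · rw [if_neg hc]
        simp [hW1, hc]
    simp only [e]
    rw [Finset.sum_ite_mem, Finset.univ_inter]
    refine (hκ (V i)).trans (mul_le_mul_of_nonneg_left ?_ hκ0)
    exact Finset.sum_le_sum_of_subset_of_nonneg (Finset.subset_univ _) fun a _ _ => sq_nonneg _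
  have h2 : ∀ c, ∑ a, ∑ b, R a b * (W2 a c * W2 b c) ≤
      η * (∑ a, if a ∈ A ∧ c ∈ A then 0 else |W a c|) ^ 2 := by
    intro c
    have habs : ∀ a, |W2 a c| = if a ∈ A ∧ c ∈ A then 0 else |W a c| := by
      intro a
      simp only [hW2]
      split_ifs <;> simp
    rw [pow_two, Finset.sum_mul_sum, Finset.mul_sum]
    refine Finset.sum_le_sum fun a _ => ?_
    rw [Finset.mul_sum]
    refine Finset.sum_le_sum fun b _ => ?_
    rw [← habs a, ← habs b, ← abs_mul]
    exact (le_abs_self _).trans (by rw [abs_mul]; gcongr; exact hη a b)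
  calc _ ≤ ∑ c, (2 * ∑ i, (∑ a, V i a * W1 a c) ^ 2 +
        2 * (η * (∑ a, if a ∈ A ∧ c ∈ A then 0 else |W a c|) ^ 2)) :=
        Finset.sum_le_sum fun c _ => (hstep c).trans (by have := h2 c; linarith)
    _ = 2 * ∑ c, ∑ i, (∑ a, V i a * W1 a c) ^ 2 +
        2 * (η * ∑ c, (∑ a, if a ∈ A ∧ c ∈ A then 0 else |W a c|) ^ 2) := by
        rw [Finset.sum_add_distrib, ← Finset.mul_sum, ← Finset.mul_sum, ← Finset.mul_sum]
    _ ≤ _ := by linarith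

lemma sum_abs_deviation_le {S : Matrix (Fin n) (Fin n) ℝ} {L : ℝ} (hS : IsProbMatrix S L)
    (x : Config n) (c : Fin n) : ∑ a, |deviation S x a c| ≤ degree x c + n * L := by
  have h : ∀ a, |deviation S x a c| ≤ adj x c a + L := by
    intro a
    rw [deviation_apply, adj_comm x c a]
    have h1 := adj_nonneg x a c
    have h2 := hS.nonneg a c
    have h3 := hS.le a c
    rw [abs_le]
    constructor <;> linarith
  refine (Finset.sum_le_sum fun a _ => h a).trans ?_
  rw [Finset.sum_add_distrib]
  simp [degree]

/-- Columns of high degree have absolute sum at most twice their degree. A column of low degree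
meets only high rows: its sum is at most 2τ, and exchanging the summation bounds the total over such
columns by twice the high degrees, each of which exceeds τ. -/
lemma sum_sq_outside_lowDegree_le {S : Matrix (Fin n) (Fin n) ℝ} {L τ : ℝ}
    (hS : IsProbMatrix S L) (x : Config n) (hL : 0 ≤ n * L) (hτ : n * L ≤ τ) :
    ∑ c, (∑ a, if a ∈ lowDegree x τ ∧ c ∈ lowDegree x τ then 0 else |deviation S x a c|) ^ 2 ≤
      8 * ∑ c ∈ highDegree x τ, degree x c ^ 2 := by
  classical
  set A := lowDegree x τ with hA
  set H := highDegree x τ with hH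
  set r : Fin n → ℝ := fun c => ∑ a, if a ∈ A ∧ c ∈ A then 0 else |deviation S x a c| with hr
  have hr0 : ∀ c, 0 ≤ r c := fun c => Finset.sum_nonneg fun a _ => by
    split_ifs
    · exact le_rfl
    · exact abs_nonneg _
  have hle : ∀ c, r c ≤ degree x c + n * L := by
    intro c
    refine le_trans (Finset.sum_le_sum fun a _ => ?_) (sum_abs_deviation_le hS x c)
    split_ifs
    · exact abs_nonneg _
    · exact le_rfl
  have hdH : ∀ c ∈ H, τ ≤ degree x c := by
    intro c hc
    have := (Finset.mem_filter.1 hc).2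
    exact (not_le.1 this).le
  have hHle : ∀ c ∈ H, r c ≤ 2 * degree x c := fun c hc => by
    have := hle c
    have := hdH c hc
    linarith
  have hAle : ∀ c ∈ A, r c ≤ 2 * τ := fun c hc => by
    have h1 := hle c
    have h2 : degree x c ≤ τ := (Finset.mem_filter.1 hc).2
    linarith
  have hsumA : ∑ c ∈ A, r c ≤ ∑ a ∈ H, 2 * degree x a := by
    calc ∑ c ∈ A, r c = ∑ c ∈ A, ∑ a ∈ H, |deviation S x a c| := by
          refine Finset.sum_congr rfl fun c hc => ?_
          have : ∀ a, (if a ∈ A ∧ c ∈ A then 0 else |deviation S x a c|) =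
              if a ∈ H then |deviation S x a c| else 0 := by
            intro a
            simp only [hA, hH, lowDegree, highDegree, Finset.mem_filter, Finset.mem_univ,
              true_and]
            have h2 : degree x c ≤ τ := (Finset.mem_filter.1 hc).2
            by_cases h : degree x a ≤ τ <;> simp [h, h2]
          simp only [hr, this]
          rw [Finset.sum_ite_mem, Finset.univ_inter]
      _ = ∑ a ∈ H, ∑ c ∈ A, |deviation S x a c| := Finset.sum_comm
      _ ≤ ∑ a ∈ H, 2 * degree x a := by
          refine Finset.sum_le_sum fun a ha => ?_
          calc _ ≤ ∑ c, |deviation S x a c| :=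
                Finset.sum_le_sum_of_subset_of_nonneg (Finset.subset_univ _)
                  fun _ _ _ => abs_nonneg _
            _ = ∑ c, |deviation S x c a| :=
                Finset.sum_congr rfl fun c _ => by rw [deviation_comm hS]
            _ ≤ degree x a + n * L := sum_abs_deviation_le hS x a
            _ ≤ _ := by have := hdH a ha; linarith
  have hsqA : ∑ c ∈ A, r c ^ 2 ≤ 4 * ∑ c ∈ H, degree x c ^ 2 := by
    calc _ ≤ ∑ c ∈ A, 2 * τ * r c := Finset.sum_le_sum fun c hc => by
          rw [pow_two]
          exact mul_le_mul_of_nonneg_right (hAle c hc) (hr0 c)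
      _ = 2 * τ * ∑ c ∈ A, r c := by rw [Finset.mul_sum]
      _ ≤ 2 * τ * ∑ a ∈ H, 2 * degree x a := by
          have : 0 ≤ τ := hL.trans hτ
          gcongr
      _ = ∑ a ∈ H, 4 * (τ * degree x a) := by
          rw [Finset.mul_sum]
          exact Finset.sum_congr rfl fun a _ => by ring
      _ ≤ ∑ a ∈ H, 4 * degree x a ^ 2 := by
          refine Finset.sum_le_sum fun a ha => ?_
          rw [pow_two]
          have := degree_nonneg x a
          have := hdH a ha
          gcongr
      _ = _ := by rw [Finset.mul_sum]
  have hsqH : ∑ c ∈ H, r c ^ 2 ≤ 4 * ∑ c ∈ H, degree x c ^ 2 := by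
    rw [Finset.mul_sum]
    refine Finset.sum_le_sum fun c hc => ?_
    have := pow_le_pow_left₀ (hr0 c) (hHle c hc) 2
    linarith
  have hpart : ∑ c, r c ^ 2 = ∑ c ∈ A, r c ^ 2 + ∑ c ∈ H, r c ^ 2 :=
    (Finset.sum_filter_add_sum_filter_not Finset.univ (fun a => degree x a ≤ τ) _).symm
  change ∑ c, r c ^ 2 ≤ _
  rw [hpart]
  linarith

lemma groupAvg_adj (z : Fin n → Fin K) (P : Matrix (Fin K) (Fin K) ℝ) (x : Config n)
    (a c : Fin n) : groupAvg z (fun b => adj x b c) a =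
      P (z a) (z c) + groupAvg z (fun b => deviation (signal z P) x b c) a := by
  have h : ∀ b, blockMean z a b * adj x b c =
      blockMean z a b * P (z a) (z c) + blockMean z a b * deviation (signal z P) x b c := by
    intro b
    rw [deviation_apply, blockMean_apply]
    by_cases hab : z a = z b
    · rw [if_pos hab, hab]
      simp only [signal, Matrix.of_apply]
      ring
    · rw [if_neg hab]
      ring
  simp only [groupAvg, h]
  rw [Finset.sum_add_distrib, ← Finset.sum_mul, sum_blockMean, one_mul]

lemma groupAvg_deviation (S : Matrix (Fin n) (Fin n) ℝ) (z : Fin n → Fin K) (x : Config n)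
    (a c : Fin n) : groupAvg z (fun b => deviation S x b c) a = rowMean S x z (z a) c := by
  simp only [groupAvg, rowMean, group, blockMean_apply]
  rw [Finset.sum_filter, Finset.sum_div]
  refine Finset.sum_congr rfl fun b _ => ?_
  by_cases h : z a = z b
  · rw [if_pos h, if_pos h.symm]
    ring
  · rw [if_neg h, if_neg (Ne.symm h)]
    ring

/-- The fluctuation part of the objective. -/
lemma GoodEvent.sum_fluctuation_le {L c₀ m α : ℝ} {z : Fin n → Fin K}
    {P : Matrix (Fin K) (Fin K) ℝ} {x : Config n} {B : Matrix (Fin n) (Fin n) ℝ}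
    (h : GoodEvent (signal z P) L c₀ z P x)
    (hS : IsProbMatrix (signal z P) L) (hn : 0 < n) (hL : 0 < L) (hnL : 1 ≤ n * L) (hm0 : 0 < m)
    (hmk : ∀ k, m ≤ groupSize z k) (hz : Function.Surjective z) (hα : 0 ≤ α)
    (hB : B ∈ feasibleSet n K α) :
    ∑ c, ∑ a, ∑ b, B a b * ((adj x a c - groupAvg z (fun a => adj x a c) a) *
        (adj x b c - groupAvg z (fun a => adj x a c) b)) ≤
      12000000000 * (n * L * (crossMass z B / m)) + 1400000 * (α * n * Real.exp (-(7 * (n * L)))) := by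
  set S := signal z P with hSdef
  have h1 : ∀ a c, adj x a c - groupAvg z (fun a => adj x a c) a =
      deviation S x a c - groupAvg z (fun a => deviation S x a c) a := by
    intro a c
    rw [groupAvg_adj z P, deviation_apply]
    simp only [hSdef, signal, Matrix.of_apply]
    ring
  simp only [h1]
  have h2 : ∀ c, ∑ a, ∑ b, B a b * ((deviation S x a c - groupAvg z (fun a => deviation S x a c) a) *
      (deviation S x b c - groupAvg z (fun a => deviation S x a c) b)) =
      ∑ a, ∑ b, compression z B a b * (deviation S x a c * deviation S x b c) := fun c =>
    (sum_compression_mul z B fun a => deviation S x a c).symm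
  simp only [h2]
  set q := Real.sqrt (n * L) with hq
  have hq2 : n * L = q ^ 2 := (Real.sq_sqrt (by linarith)).symm
  have hq1 : 1 ≤ q := Real.one_le_sqrt.2 hnL
  have hop := sum_sq_deviation_mul_le hS hn hL hq1 (by norm_num : (0 : ℝ) ≤ 114) hq2 h.dis h.light
  refine (sum_sum_quad_le_of_split (posSemidef_compression z hB) (sq_nonneg _) hop
    (abs_compression_le z hB)).trans ?_
  have h3 := sum_sq_outside_lowDegree_le hS x (τ := 114 * q ^ 2) (by linarith) (by nlinarith)
  have h4 := sum_sq_highDegree_le hn hL h.deg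
  rw [hq2] at h4 ⊢
  have h5 := trace_compression_le hz hm0 hmk hB
  have h6 : (q * (64 * 114 + 68464)) ^ 2 * (compression z B).trace ≤
      (q * (64 * 114 + 68464)) ^ 2 * (crossMass z B / m) := by gcongr
  have h7 := h3.trans (mul_le_mul_of_nonneg_left h4 (by norm_num : (0 : ℝ) ≤ 8))
  have h8 := mul_le_mul_of_nonneg_left h7 (by positivity : 0 ≤ 2 * α)
  have h9 : 0 ≤ crossMass z B / m := div_nonneg (crossMass_nonneg z hB) hm0.le
  have h10 : 0 ≤ q ^ 2 * (crossMass z B / m) := by positivity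
  have h11 : 0 ≤ α * n * Real.exp (-(7 * q ^ 2)) := by positivity
  nlinarith

end Fluctuation

/-! ### The mass between groups -/

section Mass

variable {n K : ℕ}

/-- The part of the correlation that exceeds a fraction of the separation. -/
def excess (z : Fin n → Fin K) (P : Matrix (Fin K) (Fin K) ℝ) (x : Config n) (b : Fin n)
    (k : Fin K) : ℝ :=
  if k = z b then 0 else max 0 (corr (signal z P) x z P b k - sepSq z P (z b) k / 32)

lemma excess_nonneg (z : Fin n → Fin K) (P : Matrix (Fin K) (Fin K) ℝ) (x : Config n) (b : Fin n)
    (k : Fin K) : 0 ≤ excess z P x b k := by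
  unfold excess
  split_ifs
  · exact le_rfl
  · exact le_max_left _ _

/-- Apply `GoodEvent.sum_corr_le` to the set T of vertices with positive excess, with D the
separation. The signal assumption leaves at least D/32 - D/64 = D/64 per vertex to subtract, and
106000·64 = 6784000 is the constant in the exponent produced by `entropy_sub_mul_le`. -/
lemma GoodEvent.sum_excess_group_le {L m Δ : ℝ} {z : Fin n → Fin K}
    {P : Matrix (Fin K) (Fin K) ℝ} {x : Config n} (h : GoodEvent (signal z P) L (1 / 1000) z P x)
    (hS : IsProbMatrix (signal z P) L) (hP : ∀ j k, 0 ≤ P j k ∧ P j k ≤ L)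
    (hn : 0 < n) (hL : 0 < L) (hm0 : 0 < m) (hmn : m ≤ n)
    (hmk : ∀ k, m ≤ groupSize z k) (hmL : 1 ≤ m * L)
    (hΔ : ∀ j k, j ≠ k → Δ ≤ sepSq z P j k) (hsig : 10000000000000 * (n * L / m) ≤ Δ)
    (j k : Fin K) :
    ∑ b ∈ group z j, excess z P x b k ≤
      106000 * (L * n * Real.exp (-(Δ / (6784000 * L)))) := by
  classical
  have hzj : ∀ b ∈ group z j, z b = j := fun b hb => (Finset.mem_filter.1 hb).2
  by_cases hjk : j = k
  · subst hjk
    rw [Finset.sum_eq_zero fun b hb => by rw [excess, if_pos (hzj b hb).symm]]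
    positivity
  set D := sepSq z P j k with hD
  have hDΔ : Δ ≤ D := hΔ j k hjk
  set T := (group z j).filter fun b => D / 32 < corr (signal z P) x z P b k with hT
  have h1 : ∑ b ∈ group z j, excess z P x b k =
      ∑ b ∈ T, corr (signal z P) x z P b k - T.card * (D / 32) := by
    rw [← nsmul_eq_mul, ← Finset.sum_const, ← Finset.sum_sub_distrib, hT, Finset.sum_filter]
    refine Finset.sum_congr rfl fun b hb => ?_
    rw [excess, if_neg (by rw [hzj b hb]; exact Ne.symm hjk), hzj b hb]
    split_ifs with hlt
    · exact max_eq_right (by linarith)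
    · exact max_eq_left (by linarith [not_lt.1 hlt])
  have h2 := h.sum_corr_le hS hP hn hL (by norm_num) (by norm_num) hm0 hmk hmL hjk
    (Finset.filter_subset _ _ : T ⊆ group z j)
  have h3 := entropy_sub_mul_le (t := T.card) hn (D / (6784000 * L))
  have hnm : L ≤ n * L / m := by
    rw [le_div_iff₀ hm0]
    nlinarith
  have h4 : (T.card : ℝ) * (2 * (1 / 1000) * D + 5000000 * (1 / 1000) * (n * L / m) + 7 * L) ≤
      T.card * (D / 64) := by
    refine mul_le_mul_of_nonneg_left ?_ (Nat.cast_nonneg _)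
    linarith
  have h5 : 106 * (L / (1 / 1000)) * entropy n T.card - T.card * (D / 64) =
      106000 * L * (entropy n T.card - T.card * (D / (6784000 * L))) := by
    field_simp
    ring
  have h6 : 106000 * L * (entropy n T.card - T.card * (D / (6784000 * L))) ≤
      106000 * L * (n * Real.exp (-(Δ / (6784000 * L)))) := by
    refine mul_le_mul_of_nonneg_left (h3.trans ?_) (by positivity)
    gcongr
  rw [h1]
  linarith

lemma GoodEvent.sum_excess_le {L m Δ : ℝ} {z : Fin n → Fin K}
    {P : Matrix (Fin K) (Fin K) ℝ} {x : Config n} (h : GoodEvent (signal z P) L (1 / 1000) z P x)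
    (hS : IsProbMatrix (signal z P) L) (hP : ∀ j k, 0 ≤ P j k ∧ P j k ≤ L)
    (hn : 0 < n) (hL : 0 < L) (hm0 : 0 < m) (hmn : m ≤ n)
    (hmk : ∀ k, m ≤ groupSize z k) (hmL : 1 ≤ m * L)
    (hΔ : ∀ j k, j ≠ k → Δ ≤ sepSq z P j k) (hsig : 10000000000000 * (n * L / m) ≤ Δ) :
    ∑ b, ∑ k, excess z P x b k ≤
      106000 * (K ^ 2 * (L * n * Real.exp (-(Δ / (6784000 * L))))) := by
  rw [Finset.sum_comm]
  have h1 : ∀ k, ∑ b, excess z P x b k ≤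
      K * (106000 * (L * n * Real.exp (-(Δ / (6784000 * L))))) := by
    intro k
    rw [← Finset.sum_fiberwise (s := Finset.univ) (g := z)]
    refine (Finset.sum_le_sum fun j _ =>
      h.sum_excess_group_le hS hP hn hL hm0 hmn hmk hmL hΔ hsig j k).trans ?_
    simp
  refine (Finset.sum_le_sum fun k _ => h1 k).trans (le_of_eq ?_)
  simp only [Finset.sum_const, Finset.card_univ, Fintype.card_fin, nsmul_eq_mul]
  ring

/-- A correlation is at most 1/32 of the separation plus the excess. The excess depends on b and the
group of a only; bounding it by its sum over all groups and using unit column sums removes B. -/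
lemma sum_mul_corr_le {α : ℝ} {z : Fin n → Fin K} {P : Matrix (Fin K) (Fin K) ℝ} {x : Config n}
    {B : Matrix (Fin n) (Fin n) ℝ} (hB : B ∈ feasibleSet n K α) :
    ∑ a, ∑ b, (if z a = z b then 0 else B a b * corr (signal z P) x z P b (z a)) ≤
      ∑ a, ∑ b, (if z a = z b then 0 else B a b * (sepSq z P (z b) (z a) / 32)) +
        ∑ b, ∑ k, excess z P x b k := by
  have h1 : ∑ b, ∑ k, excess z P x b k = ∑ a, ∑ b, B a b * ∑ k, excess z P x b k := by
    conv_rhs => rw [Finset.sum_comm]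
    refine Finset.sum_congr rfl fun b _ => ?_
    rw [← Finset.sum_mul, feasible_col_sum hB, one_mul]
  rw [h1, ← Finset.sum_add_distrib]
  refine Finset.sum_le_sum fun a _ => ?_
  rw [← Finset.sum_add_distrib]
  refine Finset.sum_le_sum fun b _ => ?_
  have hab := (hB.2.2.2 a b).1
  have h2 : excess z P x b (z a) ≤ ∑ k, excess z P x b k :=
    Finset.single_le_sum (f := fun k => excess z P x b k)
      (fun k _ => excess_nonneg z P x b k) (Finset.mem_univ _)
  split_ifs with hz
  · rw [zero_add]
    exact mul_nonneg hab (Finset.sum_nonneg fun k _ => excess_nonneg z P x b k)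
  · rw [← mul_add]
    refine mul_le_mul_of_nonneg_left ?_ hab
    rw [excess, if_neg hz] at h2
    have := le_max_right 0 (corr (signal z P) x z P b (z a) - sepSq z P (z b) (z a) / 32)
    linarith

/-- A pointwise quadratic inequality in the signal difference and the two noise means: an eighth of
the squared signal survives, at the price of 1/2 and 9/2 times the squared noise means, that is 5 ·
1100000 in total. -/
lemma le_pair_term {L c₀ m : ℝ} {z : Fin n → Fin K}
    {P : Matrix (Fin K) (Fin K) ℝ} {x : Config n} (h : GoodEvent (signal z P) L c₀ z P x)
    (hS : IsProbMatrix (signal z P) L) (hn : 0 < n) (hL : 0 < L) (hm0 : 0 < m)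
    (hmk : ∀ k, m ≤ groupSize z k) (hmL : 1 ≤ m * L) (a b : Fin n) :
    sepSq z P (z b) (z a) / 8 - 5500000 * (n * L / m) - 2 * corr (signal z P) x z P b (z a) ≤
      ∑ c, ((groupAvg z (fun a => adj x a c) a - groupAvg z (fun a => adj x a c) b) ^ 2 / 2 -
        2 * ((groupAvg z (fun a => adj x a c) a - groupAvg z (fun a => adj x a c) b) *
          (adj x b c - groupAvg z (fun a => adj x a c) b))) := by
  set S := signal z P with hSdef
  have ha := h.sum_sq_rowMean_le hS hn hL hm0 hmk hmL (z a)
  have hb := h.sum_sq_rowMean_le hS hn hL hm0 hmk hmL (z b)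
  have havg : ∀ a c, groupAvg z (fun a => adj x a c) a = P (z a) (z c) + rowMean S x z (z a) c := by
    intro a c
    rw [groupAvg_adj z P, groupAvg_deviation]
  have hpt : ∀ c, (P (z a) (z c) - P (z b) (z c)) ^ 2 / 8 - 1 / 2 * rowMean S x z (z a) c ^ 2 -
      9 / 2 * rowMean S x z (z b) c ^ 2 -
      2 * (deviation S x b c * (P (z a) (z c) - P (z b) (z c)) +
        deviation S x b c * (rowMean S x z (z a) c - rowMean S x z (z b) c)) ≤
      (groupAvg z (fun a => adj x a c) a - groupAvg z (fun a => adj x a c) b) ^ 2 / 2 -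
        2 * ((groupAvg z (fun a => adj x a c) a - groupAvg z (fun a => adj x a c) b) *
          (adj x b c - groupAvg z (fun a => adj x a c) b)) := by
    intro c
    rw [havg, havg, deviation_apply, show S b c = P (z b) (z c) from rfl]
    set s := P (z a) (z c) - P (z b) (z c) with hs
    generalize rowMean S x z (z a) c = w
    generalize rowMean S x z (z b) c = v
    generalize adj x b c = X
    have e : P (z a) (z c) = P (z b) (z c) + s := by rw [hs]; ring
    rw [e]
    generalize P (z b) (z c) = p
    nlinarith [sq_nonneg (s + (w - v) + 4 * v), sq_nonneg (s + 2 * (w - v)), sq_nonneg (w + v)]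
  have hsum := Finset.sum_le_sum fun c (_ : c ∈ Finset.univ) => hpt c
  refine le_trans ?_ hsum
  simp only [Finset.sum_sub_distrib, Finset.sum_add_distrib, ← Finset.mul_sum, ← Finset.sum_div,
    sepSq, corr]
  linarith

/-- The master inequality for the mass between groups. -/
lemma GoodEvent.crossMass_le {L m Δ α : ℝ} {z : Fin n → Fin K}
    {P : Matrix (Fin K) (Fin K) ℝ} {x : Config n} {B : Matrix (Fin n) (Fin n) ℝ}
    (h : GoodEvent (signal z P) L (1 / 1000) z P x)
    (hS : IsProbMatrix (signal z P) L) (hP : ∀ j k, 0 ≤ P j k ∧ P j k ≤ L)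
    (hn : 0 < n) (hL : 0 < L) (hm0 : 0 < m) (hmn : m ≤ n)
    (hmk : ∀ k, m ≤ groupSize z k) (hmL : 1 ≤ m * L) (hz : Function.Surjective z)
    (hα : 1 / m ≤ α)
    (hΔ : ∀ j k, j ≠ k → Δ ≤ sepSq z P j k) (hsig : 10000000000000 * (n * L / m) ≤ Δ)
    (hB : IsRelaxedKMeans K α (adj x) B) :
    Δ * crossMass z B ≤ 100000000 * (α * n * Real.exp (-(7 * (n * L)))) +
      20000000 * (K ^ 2 * (L * n * Real.exp (-(Δ / (6784000 * L))))) := by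
  have hnL : 1 ≤ n * L := hmL.trans (by gcongr)
  have hα0 : 0 ≤ α := le_trans (by positivity) hα
  have h1 := hB.basic_ineq (blockMean_mem_feasibleSet hz hm0 hmk hα)
  have h2 := h1.trans (h.sum_fluctuation_le hS hn hL hnL hm0 hmk hz hα0 hB.1)
  have hlow : ∑ a, ∑ b, ((if z a = z b then 0 else B a b * (7 / 64 * sepSq z P (z b) (z a))) -
      2 * (if z a = z b then 0 else B a b * corr (signal z P) x z P b (z a))) ≤
      ∑ a, ∑ b, B a b * ∑ c, ((groupAvg z (fun a => adj x a c) a -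
        groupAvg z (fun a => adj x a c) b) ^ 2 / 2 -
        2 * ((groupAvg z (fun a => adj x a c) a - groupAvg z (fun a => adj x a c) b) *
          (adj x b c - groupAvg z (fun a => adj x a c) b))) := by
    refine Finset.sum_le_sum fun a _ => Finset.sum_le_sum fun b _ => ?_
    split_ifs with hab
    · have : ∀ c, groupAvg z (fun a => adj x a c) a = groupAvg z (fun a => adj x a c) b := by
        intro c
        rw [groupAvg_adj z P, groupAvg_deviation, groupAvg_adj z P, groupAvg_deviation, hab]
      simp [this]
    · have h3 := le_pair_term h hS hn hL hm0 hmk hmL a b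
      -- The noise means are absorbed in 1/64 of the separation, and 1/8 - 1/64 = 7/64. Twice 1/32
      -- is still to be given up to the correlations.
      have h4 : 7 / 64 * sepSq z P (z b) (z a) - 2 * corr (signal z P) x z P b (z a) ≤
          sepSq z P (z b) (z a) / 8 - 5500000 * (n * L / m) -
            2 * corr (signal z P) x z P b (z a) := by
        have := hΔ (z b) (z a) (Ne.symm hab)
        have : 0 ≤ n * L / m := by positivity
        linarith
      have := mul_le_mul_of_nonneg_left (h4.trans h3) (hB.1.2.2.2 a b).1
      linarith
  have h5 := sum_mul_corr_le (x := x) (P := P) (z := z) hB.1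
  have h6 := h.sum_excess_le hS hP hn hL hm0 hmn hmk hmL hΔ hsig
  set M := ∑ a, ∑ b, (if z a = z b then 0 else B a b * sepSq z P (z b) (z a)) with hM
  have e1 : ∑ a, ∑ b, (if z a = z b then 0 else B a b * (7 / 64 * sepSq z P (z b) (z a))) =
      7 / 64 * M := by
    rw [hM, Finset.mul_sum]
    refine Finset.sum_congr rfl fun a _ => ?_
    rw [Finset.mul_sum]
    refine Finset.sum_congr rfl fun b _ => ?_
    split_ifs <;> ring
  have e2 : ∑ a, ∑ b, (if z a = z b then 0 else B a b * (sepSq z P (z b) (z a) / 32)) =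
      1 / 32 * M := by
    rw [hM, Finset.mul_sum]
    refine Finset.sum_congr rfl fun a _ => ?_
    rw [Finset.mul_sum]
    refine Finset.sum_congr rfl fun b _ => ?_
    split_ifs <;> ring
  have hMΔ : Δ * crossMass z B ≤ M := by
    rw [hM, crossMass, Finset.mul_sum]
    refine Finset.sum_le_sum fun a _ => ?_
    rw [Finset.mul_sum]
    refine Finset.sum_le_sum fun b _ => ?_
    split_ifs with hab
    · simp
    · rw [mul_comm]
      exact mul_le_mul_of_nonneg_left (hΔ _ _ (Ne.symm hab)) (hB.1.2.2.2 a b).1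
  replace hlow := hlow.trans h2
  simp only [Finset.sum_sub_distrib, ← Finset.mul_sum] at hlow
  rw [e1] at hlow
  rw [e2] at h5
  have hδ := crossMass_nonneg z hB.1
  -- The operator-norm part of the fluctuation is thus a small fraction of the left-hand side.
  have h7 : 10000000000000 * (n * L * (crossMass z B / m)) ≤ Δ * crossMass z B := by
    calc _ = 10000000000000 * (n * L / m) * crossMass z B := by ring
      _ ≤ _ := mul_le_mul_of_nonneg_right hsig hδ
  have h8 : 0 ≤ n * L * (crossMass z B / m) := by positivity
  have h9 : 0 ≤ α * n * Real.exp (-(7 * (n * L))) := by positivity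
  have h10 : 0 ≤ K ^ 2 * (L * n * Real.exp (-(Δ / (6784000 * L)))) := by positivity
  linarith

end Mass

/-! ### Rounding -/

section Rounding

variable {n K : ℕ}

lemma partitionMatrix_mul_apply (z : Fin n → Fin K) (M : Matrix (Fin K) (Fin n) ℝ) (i c : Fin n) :
    (partitionMatrix z * M) i c = M (z i) c := by
  simp [Matrix.mul_apply, partitionMatrix, group]

/-- Cauchy-Schwarz over rows and over columns, then `sum_sq_sub_blockMean_le`. -/
lemma l1Norm_sub_blockMean_le {α m : ℝ} {B : Matrix (Fin n) (Fin n) ℝ} {z : Fin n → Fin K}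
    (hz : Function.Surjective z) (hm0 : 0 < m) (hmk : ∀ k, m ≤ groupSize z k)
    (hB : B ∈ feasibleSet n K α) :
    l1Norm (B - blockMean z) ^ 2 ≤ n ^ 2 * (2 * (crossMass z B / m)) := by
  unfold l1Norm
  calc _ ≤ (n : ℝ) * ∑ a, (∑ b, |(B - blockMean z) a b|) ^ 2 := by
        have := sq_sum_le_card_mul_sum_sq (s := (Finset.univ : Finset (Fin n)))
          (f := fun a => ∑ b, |(B - blockMean z) a b|)
        simpa using this
    _ ≤ (n : ℝ) * ∑ a, (n : ℝ) * ∑ b, (B a b - blockMean z a b) ^ 2 := by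
        refine mul_le_mul_of_nonneg_left (Finset.sum_le_sum fun a _ => ?_) (Nat.cast_nonneg _)
        have := sq_sum_le_card_mul_sum_sq (s := (Finset.univ : Finset (Fin n)))
          (f := fun b => |(B - blockMean z) a b|)
        simpa using this
    _ = n ^ 2 * ∑ a, ∑ b, (B a b - blockMean z a b) ^ 2 := by
        rw [← Finset.mul_sum]
        ring
    _ ≤ _ := by
        have := sum_sq_sub_blockMean_le hz hm0 hmk hB
        gcongr

/-- The competitor uses, in each true group, the row of B closest to the common row of B*; its cost
is at most twice the distance of B to B*. The approximation factor 7 makes this 14, and returning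
from B to B* adds 1. -/
lemma IsApproxKMedoids.l1Norm_le {B : Matrix (Fin n) (Fin n) ℝ} {zhat z : Fin n → Fin K}
    {M : Matrix (Fin K) (Fin n) ℝ} (h : IsApproxKMedoids 7 B zhat M)
    (hz : Function.Surjective z) :
    ∑ i, ∑ c, |M (zhat i) c - blockMean z i c| ≤ 15 * l1Norm (B - blockMean z) := by
  classical
  set e : Fin n → ℝ := fun i => ∑ c, |B i c - blockMean z i c| with he
  have hε : l1Norm (B - blockMean z) = ∑ i, e i := rfl
  have hmin : ∀ k, ∃ a ∈ group z k, ∀ i ∈ group z k, e a ≤ e i := by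
    intro k
    obtain ⟨a, ha⟩ := hz k
    exact Finset.exists_min_image _ e ⟨a, by simp [group, ha]⟩
  choose r hr hre using hmin
  have hzr : ∀ k, z (r k) = k := fun k => (Finset.mem_filter.1 (hr k)).2
  have hrow : ∀ i c, blockMean z (r (z i)) c = blockMean z i c := by
    intro i c
    rw [blockMean_apply, blockMean_apply, hzr]
  have h1 := h.2.2 z (Matrix.of fun k c => B (r k) c) hz (by
    rintro _ ⟨k, rfl⟩
    exact ⟨r k, rfl⟩)
  have h2 : l1Norm (partitionMatrix z * (Matrix.of fun k c => B (r k) c) - B) ≤ 2 * ∑ i, e i := by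
    calc _ ≤ ∑ i, (e i + e i) := by
          refine Finset.sum_le_sum fun i _ => ?_
          have h3 : e (r (z i)) ≤ e i := hre (z i) i (by simp [group])
          refine le_trans ?_ (add_le_add_left h3 (e i))
          rw [he, ← Finset.sum_add_distrib]
          refine Finset.sum_le_sum fun c _ => ?_
          rw [Matrix.sub_apply, partitionMatrix_mul_apply, Matrix.of_apply, hrow]
          have h4 := abs_sub_le (B (r (z i)) c) (blockMean z i c) (B i c)
          rw [abs_sub_comm (blockMean z i c)] at h4
          exact h4
      _ = _ := by rw [Finset.sum_add_distrib]; ring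
  have h5 : ∑ i, ∑ c, |M (zhat i) c - blockMean z i c| ≤
      l1Norm (partitionMatrix zhat * M - B) + ∑ i, e i := by
    unfold l1Norm
    rw [he, ← Finset.sum_add_distrib]
    refine Finset.sum_le_sum fun i _ => ?_
    rw [← Finset.sum_add_distrib]
    refine Finset.sum_le_sum fun c _ => ?_
    rw [Matrix.sub_apply, partitionMatrix_mul_apply]
    exact abs_sub_le _ _ _
  rw [hε]
  linarith

/-- The two rows are nonnegative with unit sums and disjoint supports. -/
lemma two_le_sum_abs_blockMean_sub (z : Fin n → Fin K) {i j : Fin n} (hij : z i ≠ z j) :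
    2 ≤ ∑ c, |blockMean z i c - blockMean z j c| := by
  have h : ∀ c, blockMean z i c + blockMean z j c ≤ |blockMean z i c - blockMean z j c| := by
    intro c
    have h1 := blockMean_nonneg z i c
    have h2 := blockMean_nonneg z j c
    by_cases hi : z i = z c
    · have : blockMean z j c = 0 := by
        rw [blockMean_apply, if_neg]
        exact fun hj => hij (hi.trans hj.symm)
      rw [this]
      simp [le_abs_self]
    · have : blockMean z i c = 0 := by rw [blockMean_apply, if_neg hi]
      rw [this]
      simp [le_abs_self]
  have := Finset.sum_le_sum fun c (_ : c ∈ Finset.univ) => h c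
  rw [Finset.sum_add_distrib, sum_blockMean, sum_blockMean] at this
  linarith

/-- A vertex of N lies in at most two of the symmetric differences, through its true and its
estimated label; this cancels the 2 in the normalisation. -/
lemma misclassification_le_of_perm {zhat z : Fin n → Fin K} (π : Equiv.Perm (Fin K))
    {N : Finset (Fin n)} (hn : 0 < n) (h : ∀ b ∉ N, zhat b = π (z b)) :
    misclassification zhat z ≤ N.card / n := by
  classical
  have h0 : misclassification zhat z ≤ 1 / (2 * (n : ℝ)) *
      ∑ k, ((symmDiff (group z k) (group zhat (π k))).card : ℝ) :=
    ciInf_le (Set.finite_range _).bddBelow π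
  have hsub : ∀ k, symmDiff (group z k) (group zhat (π k)) ⊆
      (N.filter fun b => z b = k) ∪ N.filter fun b => zhat b = π k := by
    intro k b hb
    rw [Finset.mem_symmDiff] at hb
    simp only [group, Finset.mem_filter, Finset.mem_univ, true_and] at hb
    have hbN : b ∈ N := by
      by_contra hbN
      have hb' := h b hbN
      rcases hb with ⟨h1, h2⟩ | ⟨h1, h2⟩
      · exact h2 (by rw [hb', h1])
      · exact h2 (π.injective (by rw [← hb', h1]))
    rw [Finset.mem_union, Finset.mem_filter, Finset.mem_filter]
    rcases hb with ⟨h1, _⟩ | ⟨h1, _⟩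
    · exact Or.inl ⟨hbN, h1⟩
    · exact Or.inr ⟨hbN, h1⟩
  have hcard : ∑ k, (symmDiff (group z k) (group zhat (π k))).card ≤ 2 * N.card := by
    calc _ ≤ ∑ k, ((N.filter fun b => z b = k).card + (N.filter fun b => zhat b = π k).card) :=
          Finset.sum_le_sum fun k _ => (Finset.card_le_card (hsub k)).trans (Finset.card_union_le _ _)
      _ = N.card + N.card := by
          rw [Finset.sum_add_distrib, Equiv.sum_comp π fun k => (N.filter fun b => zhat b = k).card,
            ← Finset.card_eq_sum_card_fiberwise (fun _ _ => Finset.mem_univ _),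
            ← Finset.card_eq_sum_card_fiberwise (fun _ _ => Finset.mem_univ _)]
      _ = _ := by ring
  have hcard' : ∑ k, ((symmDiff (group z k) (group zhat (π k))).card : ℝ) ≤ 2 * N.card := by
    exact_mod_cast hcard
  have hn' : (0 : ℝ) < n := by exact_mod_cast hn
  calc _ ≤ _ := h0
    _ ≤ 1 / (2 * (n : ℝ)) * (2 * N.card) := by gcongr
    _ = _ := by field_simp

/-- Call a vertex bad if its medoid is at distance at least 1 from its row of B*. Two good vertices
with the same label are in the same group, as rows of distinct groups are 2 apart. There are fewer
than m bad vertices, so each group has a good one; the labels of these representatives define an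
injection, hence a permutation. -/
lemma IsApproxKMedoids.misclassification_le {m : ℝ} {B : Matrix (Fin n) (Fin n) ℝ}
    {zhat z : Fin n → Fin K} {M : Matrix (Fin K) (Fin n) ℝ} (h : IsApproxKMedoids 7 B zhat M)
    (hn : 0 < n) (hz : Function.Surjective z) (hmk : ∀ k, m ≤ groupSize z k)
    (hε : 15 * l1Norm (B - blockMean z) < m) :
    misclassification zhat z ≤ 15 * l1Norm (B - blockMean z) / n := by
  classical
  set d : Fin n → ℝ := fun i => ∑ c, |M (zhat i) c - blockMean z i c| with hd
  set N : Finset (Fin n) := Finset.univ.filter fun i => 1 ≤ d i with hN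
  have hd0 : ∀ i, 0 ≤ d i := fun i => Finset.sum_nonneg fun _ _ => abs_nonneg _
  have hcard : (N.card : ℝ) ≤ 15 * l1Norm (B - blockMean z) := by
    calc (N.card : ℝ) = ∑ i ∈ N, 1 := by simp
      _ ≤ ∑ i ∈ N, d i := Finset.sum_le_sum fun i hi => (Finset.mem_filter.1 hi).2
      _ ≤ ∑ i, d i := Finset.sum_le_sum_of_subset_of_nonneg (Finset.subset_univ _)
          fun i _ _ => hd0 i
      _ ≤ _ := h.l1Norm_le hz
  have hsep : ∀ i j, i ∉ N → j ∉ N → zhat i = zhat j → z i = z j := by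
    intro i j hi hj hij
    by_contra hne
    have h1 := two_le_sum_abs_blockMean_sub z hne
    have hi' : d i < 1 := by simpa [hN] using hi
    have hj' : d j < 1 := by simpa [hN] using hj
    have h2 : ∑ c, |blockMean z i c - blockMean z j c| ≤ d i + d j := by
      rw [hd, ← Finset.sum_add_distrib]
      refine Finset.sum_le_sum fun c _ => ?_
      have := abs_sub_le (blockMean z i c) (M (zhat i) c) (blockMean z j c)
      rw [abs_sub_comm (blockMean z i c) (M (zhat i) c)] at this
      rw [← hij]
      exact this
    linarith
  have hgood : ∀ k, ∃ b, z b = k ∧ b ∉ N := by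
    intro k
    by_contra hcon
    push Not at hcon
    have hsub : group z k ⊆ N := fun b hb => hcon b (Finset.mem_filter.1 hb).2
    have h1 : groupSize z k ≤ N.card := by
      unfold groupSize
      exact_mod_cast Finset.card_le_card hsub
    linarith [hmk k]
  choose r hr hrN using hgood
  have hinj : Function.Injective fun k => zhat (r k) := by
    intro k l hkl
    rw [← hr k, ← hr l]
    exact hsep _ _ (hrN k) (hrN l) hkl
  set π : Equiv.Perm (Fin K) := Equiv.ofBijective _ (Finite.injective_iff_bijective.1 hinj) with hπ
  have hperm : ∀ b ∉ N, zhat b = π (z b) := by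
    intro b hb
    obtain ⟨k, hk⟩ := π.surjective (zhat b)
    have hk' : zhat (r k) = zhat b := hk
    have := hsep _ _ (hrN k) hb hk'
    rw [← hk, ← this, hr]
  refine (misclassification_le_of_perm π hn hperm).trans ?_
  gcongr

end Rounding

/-! ### The misclassification bound -/

section Main

variable {n K : ℕ}

lemma sepSq_eq (z : Fin n → Fin K) (P : Matrix (Fin K) (Fin K) ℝ) (j k : Fin K) :
    sepSq z P j k = ∑ l, ((group z l).card : ℝ) * (P k l - P j l) ^ 2 := by
  rw [sepSq, ← Finset.sum_fiberwise (s := Finset.univ) (g := z)]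
  refine Finset.sum_congr rfl fun l _ => ?_
  rw [← nsmul_eq_mul, ← Finset.sum_const]
  exact Finset.sum_congr rfl fun c hc => by rw [(Finset.mem_filter.1 hc).2]

lemma signalSq_le_sepSq (z : Fin n → Fin K) (P : Matrix (Fin K) (Fin K) ℝ) {j k : Fin K}
    (hjk : j ≠ k) : signalSq z P ≤ sepSq z P j k := by
  rw [sepSq_eq]
  exact ciInf_le (f := fun q : {q : Fin K × Fin K // q.1 ≠ q.2} =>
    ∑ l, ((group z l).card : ℝ) * (P q.1.2 l - P q.1.1 l) ^ 2) (Set.finite_range _).bddBelow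
    ⟨(j, k), hjk⟩

lemma sepSq_le {z : Fin n → Fin K} {P : Matrix (Fin K) (Fin K) ℝ} {L : ℝ}
    (hP : ∀ j k, 0 ≤ P j k ∧ P j k ≤ L) (j k : Fin K) : sepSq z P j k ≤ n * L ^ 2 := by
  calc sepSq z P j k ≤ ∑ _c : Fin n, L ^ 2 := by
        refine Finset.sum_le_sum fun c _ => ?_
        have h1 := hP k (z c)
        have h2 := hP j (z c)
        exact sq_le_sq' (by linarith) (by linarith)
    _ = _ := by simp

lemma minGroupSize_le (z : Fin n → Fin K) (k : Fin K) : (minGroupSize z : ℝ) ≤ groupSize z k := by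
  unfold groupSize
  exact_mod_cast ciInf_le (OrderBot.bddBelow _) k

lemma minGroupSize_pos {z : Fin n → Fin K} (hz : Function.Surjective z) (hK : 0 < K) :
    0 < minGroupSize z := by
  have : Nonempty (Fin K) := ⟨⟨0, hK⟩⟩
  have h : ∀ k, 1 ≤ (group z k).card := by
    intro k
    obtain ⟨a, ha⟩ := hz k
    exact Finset.card_pos.2 ⟨a, by simp [group, ha]⟩
  exact le_ciInf h

lemma card_mul_le {z : Fin n → Fin K} {m : ℝ} (hmk : ∀ k, m ≤ groupSize z k) : K * m ≤ n := by
  calc (K : ℝ) * m = ∑ _k : Fin K, m := by simp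
    _ ≤ ∑ k, groupSize z k := Finset.sum_le_sum fun k _ => hmk k
    _ = n := by
        have := Finset.card_eq_sum_card_fiberwise (s := (Finset.univ : Finset (Fin n))) (f := z)
          (t := Finset.univ) (fun _ _ => Finset.mem_univ _)
        rw [Finset.card_univ, Fintype.card_fin] at this
        unfold groupSize group
        exact_mod_cast this.symm

/-- The mass between groups is exponentially small. -/
lemma GoodEvent.crossMass_div_le {L m Δ α : ℝ} {z : Fin n → Fin K}
    {P : Matrix (Fin K) (Fin K) ℝ} {x : Config n} {B : Matrix (Fin n) (Fin n) ℝ}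
    (h : GoodEvent (signal z P) L (1 / 1000) z P x)
    (hS : IsProbMatrix (signal z P) L) (hP : ∀ j k, 0 ≤ P j k ∧ P j k ≤ L)
    (hn : 0 < n) (hK : 1 ≤ K) (hL : 0 < L) (hm0 : 0 < m) (hmn : m ≤ n)
    (hmk : ∀ k, m ≤ groupSize z k) (hmL : 1 ≤ m * L) (hz : Function.Surjective z)
    (hα : 1 / m ≤ α) (hα' : α ≤ (K : ℝ) ^ 3 / n * Real.exp (4 * n * L))
    (hΔ : ∀ j k, j ≠ k → Δ ≤ sepSq z P j k) (hΔL : Δ / L ≤ n * L)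
    (hsig : 10000000000000 * (n / m) ≤ Δ / L)
    (hB : IsRelaxedKMeans K α (adj x) B) :
    450 * (crossMass z B / m) ≤ K ^ 3 * Real.exp (-(Δ / L / 6784000)) := by
  set σ := Δ / L with hσ
  have hΔeq : Δ = σ * L := by rw [hσ]; field_simp
  have hn' : (0 : ℝ) < n := by exact_mod_cast hn
  have hK' : (1 : ℝ) ≤ K := by exact_mod_cast hK
  have hσ0 : 0 < σ := lt_of_lt_of_le (by positivity) hsig
  have hnL : 1 ≤ n * L := hmL.trans (by gcongr)
  have hsig' : 10000000000000 * (n * L / m) ≤ Δ := by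
    rw [hΔeq]
    calc _ = 10000000000000 * (n / m) * L := by ring
      _ ≤ _ := by gcongr
  have h1 := h.crossMass_le hS hP hn hL hm0 hmn hmk hmL hz hα hΔ hsig' hB
  have e1 : Δ / (6784000 * L) = σ / 6784000 := by
    rw [hΔeq]
    field_simp
  rw [e1] at h1
  set E := Real.exp (-(σ / 6784000)) with hE
  have hE0 : 0 < E := Real.exp_pos _
  -- The growth e^{4nL} of α leaves e^{-3nL}, and s² ≤ nL turns this into decay in s².
  have h2 : α * n * Real.exp (-(7 * (n * L))) ≤ K ^ 3 * (n * L) * E := by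
    calc _ ≤ (K : ℝ) ^ 3 / n * Real.exp (4 * n * L) * n * Real.exp (-(7 * (n * L))) := by gcongr
      _ = K ^ 3 * (Real.exp (4 * n * L) * Real.exp (-(7 * (n * L)))) := by field_simp
      _ = K ^ 3 * 1 * Real.exp (-(3 * (n * L))) := by
          rw [← Real.exp_add, mul_one]
          congr 2
          ring
      _ ≤ K ^ 3 * (n * L) * E := by
          gcongr
          rw [hE]
          exact Real.exp_le_exp.2 (by linarith)
  have h3 : (K : ℝ) ^ 2 * (L * n * E) ≤ K ^ 3 * (n * L) * E := by
    have : (K : ℝ) ^ 2 ≤ K ^ 3 := pow_le_pow_right₀ hK' (by norm_num)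
    calc _ = (K : ℝ) ^ 2 * ((n * L) * E) := by ring
      _ ≤ K ^ 3 * ((n * L) * E) := by gcongr
      _ = _ := by ring
  have hδ := crossMass_nonneg z hB.1
  have h4 : L * (n * (10000000000000 * (crossMass z B / m))) ≤
      L * (n * (120000000 * (K ^ 3 * E))) := by
    calc _ = 10000000000000 * (n * L / m) * crossMass z B := by ring
      _ ≤ Δ * crossMass z B := by gcongr
      _ ≤ _ := by linarith
  have h5 := le_of_mul_le_mul_left (le_of_mul_le_mul_left h4 hL) hn'
  have : 0 ≤ (K : ℝ) ^ 3 * E := by positivity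
  linarith

/-- With t = σ/67840000, the available decay is e^{-10t} and the fifth power costs e^{5t}, so half
of the exponent is left. -/
lemma pow_five_mul_exp_le {σ : ℝ} (hσ : 0 ≤ σ) :
    (σ / 10000000000000) ^ 5 * Real.exp (-(σ / 6784000)) ≤ Real.exp (-(σ / 13568000)) := by
  set t := σ / 67840000 with ht
  have ht0 : 0 ≤ t := by positivity
  have h1 : (σ / 10000000000000) ^ 5 ≤ Real.exp (5 * t) := by
    have h2 : t ≤ Real.exp t := by linarith [Real.add_one_le_exp t]
    calc (σ / 10000000000000) ^ 5 ≤ t ^ 5 := by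
          gcongr
          rw [ht]
          gcongr
          norm_num
      _ ≤ Real.exp t ^ 5 := by gcongr
      _ = _ := by rw [← Real.exp_nat_mul]; norm_num
  calc _ ≤ Real.exp (5 * t) * Real.exp (-(σ / 6784000)) := by gcongr
    _ = _ := by
        rw [← Real.exp_add, ht]
        congr 1
        ring

/-- Both n/m and K are at most y = σ/10¹³. Checking that the ℓ¹ error is below m costs (n/m)²K³ ≤
y⁵, and the final bound costs K³ ≤ y⁵; `pow_five_mul_exp_le` absorbs either. The last halving of the
exponent is the square root that passes from the squared ℓ¹ error to the error. -/
lemma GoodEvent.misclassification_le {L m Δ α : ℝ} {z zhat : Fin n → Fin K}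
    {P : Matrix (Fin K) (Fin K) ℝ} {x : Config n}
    (h : GoodEvent (signal z P) L (1 / 1000) z P x)
    (hS : IsProbMatrix (signal z P) L) (hP : ∀ j k, 0 ≤ P j k ∧ P j k ≤ L)
    (hn : 0 < n) (hK : 1 ≤ K) (hL : 0 < L) (hm0 : 0 < m)
    (hmk : ∀ k, m ≤ groupSize z k) (hmL : 1 ≤ m * L) (hz : Function.Surjective z)
    (hα : 1 / m ≤ α) (hα' : α ≤ (K : ℝ) ^ 3 / n * Real.exp (4 * n * L))
    (hΔ : ∀ j k, j ≠ k → Δ ≤ sepSq z P j k) (hΔL : Δ / L ≤ n * L)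
    (hsig : 10000000000000 * (n / m) ≤ Δ / L)
    (hout : IsClusteringOutput α (adj x) zhat) :
    misclassification zhat z ≤ Real.exp (-(Δ / L / 27136000)) := by
  obtain ⟨B, M, hB, hM⟩ := hout
  have hn' : (0 : ℝ) < n := by exact_mod_cast hn
  have hK' : (1 : ℝ) ≤ K := by exact_mod_cast hK
  have hKm := card_mul_le hmk
  have hmn : m ≤ n := le_trans (le_mul_of_one_le_left hm0.le hK') hKm
  have h1 := h.crossMass_div_le hS hP hn hK hL hm0 hmn hmk hmL hz hα hα' hΔ hΔL hsig hB
  have h2 := l1Norm_sub_blockMean_le hz hm0 hmk hB.1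
  set σ := Δ / L with hσ
  set ε := l1Norm (B - blockMean z) with hε
  set y := σ / 10000000000000 with hy
  have hε0 : 0 ≤ ε := Finset.sum_nonneg fun _ _ => Finset.sum_nonneg fun _ _ => abs_nonneg _
  have hyn : n / m ≤ y := by
    rw [hy, le_div_iff₀ (by norm_num)]
    linarith
  have hnm1 : 1 ≤ n / m := (one_le_div hm0).2 hmn
  have hy1 : 1 ≤ y := hnm1.trans hyn
  have hKy : (K : ℝ) ≤ y := le_trans ((le_div_iff₀ hm0).2 hKm) hyn
  have hσ0 : 0 ≤ σ := by
    have : σ = y * 10000000000000 := by rw [hy]; ring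
    rw [this]
    positivity
  have h3 := pow_five_mul_exp_le hσ0
  have h4 : (15 * ε) ^ 2 ≤ n ^ 2 * (K ^ 3 * Real.exp (-(σ / 6784000))) := by
    calc (15 * ε) ^ 2 = 225 * ε ^ 2 := by ring
      _ ≤ 225 * (n ^ 2 * (2 * (crossMass z B / m))) := by gcongr
      _ = n ^ 2 * (450 * (crossMass z B / m)) := by ring
      _ ≤ _ := by gcongr
  have hlt : Real.exp (-(σ / 13568000)) < 1 := by
    rw [Real.exp_lt_one_iff]
    have : 0 < σ := by
      have : σ = y * 10000000000000 := by rw [hy]; ring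
      rw [this]
      positivity
    have : 0 < σ / 13568000 := by positivity
    linarith
  have h5 : 15 * ε < m := by
    refine lt_of_pow_lt_pow_left₀ 2 hm0.le (h4.trans_lt ?_)
    calc (n : ℝ) ^ 2 * (K ^ 3 * Real.exp (-(σ / 6784000)))
        = m ^ 2 * ((n / m) ^ 2 * K ^ 3 * Real.exp (-(σ / 6784000))) := by field_simp
      _ ≤ m ^ 2 * (y ^ 2 * y ^ 3 * Real.exp (-(σ / 6784000))) := by gcongr
      _ = m ^ 2 * (y ^ 5 * Real.exp (-(σ / 6784000))) := by ring
      _ ≤ m ^ 2 * Real.exp (-(σ / 13568000)) := by gcongr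
      _ < m ^ 2 * 1 := by gcongr
      _ = m ^ 2 := mul_one _
  refine (hM.misclassification_le hn hz hmk h5).trans ?_
  rw [div_le_iff₀ hn']
  refine le_of_sq_le_sq (h4.trans ?_) (by positivity)
  calc (n : ℝ) ^ 2 * (K ^ 3 * Real.exp (-(σ / 6784000)))
      ≤ n ^ 2 * (y ^ 3 * Real.exp (-(σ / 6784000))) := by gcongr
    _ ≤ n ^ 2 * (y ^ 5 * Real.exp (-(σ / 6784000))) := by
        have : y ^ 3 ≤ y ^ 5 := pow_le_pow_right₀ hy1 (by norm_num)
        gcongr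
    _ ≤ n ^ 2 * Real.exp (-(σ / 13568000)) := by gcongr
    _ = _ := by
        rw [mul_pow, ← Real.exp_nat_mul, mul_comm]
        congr 2
        push_cast
        ring

/-! ### The probability of the good event -/

lemma card_halfIndex_le (hn : 0 < n) (hKn : K ≤ n) : Fintype.card (HalfIndex n K) ≤ 4 * n ^ 2 := by
  have h : Fintype.card (HalfIndex n K) = K * (2 ^ n.size * 2) := by simp
  rw [h]
  calc _ ≤ n * (2 * n * 2) := by
        have := two_pow_size_le hn
        gcongr
    _ = _ := by ring

/-- The six events contribute 1 + 1 + 1 + 8 + 1 + 16, the 8 and the 16 coming from the at most 4n²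
halves of groups. -/
lemma prob_not_goodEvent_le {L m : ℝ} {z : Fin n → Fin K} {P : Matrix (Fin K) (Fin K) ℝ}
    (hS : IsProbMatrix (signal z P) L) (hP : ∀ j k, 0 ≤ P j k ∧ P j k ≤ L) (hn : 0 < n)
    (hKn : K ≤ n) (hL : 0 < L) (hm0 : 0 < m) (hmk : ∀ k, m ≤ groupSize z k) (hmL : 1 ≤ m * L) :
    prob (edgeProb (signal z P)) (fun x => ¬ GoodEvent (signal z P) L (1 / 1000) z P x) ≤
      28 / (n : ℝ) ^ 2 := by
  classical
  set S := signal z P with hSdef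
  have hp := hS.edgeProb_mem
  have h1 := prob_not_degreeEvent hS hL.le
  have h2 := prob_not_discrepancyEvent hS hL
  have h3 := prob_not_lightEvent hS hL hn
  have h4 := prob_not_rowSumEvent hS hL (halfGroup z) (fun i => groupSize z i.1)
    (card_halfGroup_le z) (fun i => hmL.trans (by have := hmk i.1; gcongr))
  have h5 := prob_not_linearEvent hS hL (c₀ := 1 / 1000) (by norm_num) (by norm_num)
    (fun (q : Fin K × Fin K) c => P q.2 (z c) - P q.1 (z c)) (fun q c => by
      have h1 := hP q.2 (z c)
      have h2 := hP q.1 (z c)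
      rw [abs_le]
      constructor <;> linarith)
  have h6 := prob_not_bilinearEvent hS hL (c₀ := 1 / 1000) (by norm_num) (halfGroup z)
    (fun i => groupSize z i.1) (fun i => hm0.trans_le (hmk i.1))
  have hn' : (1 : ℝ) ≤ n := by exact_mod_cast hn
  have hn0 : (0 : ℝ) < n := by linarith
  have hcard : (Fintype.card (HalfIndex n K) : ℝ) ≤ 4 * n ^ 2 := by
    exact_mod_cast card_halfIndex_le hn hKn
  have hKn' : (K : ℝ) ≤ n := by exact_mod_cast hKn
  have hpow : (n : ℝ) ^ 2 * n ^ 2 ≤ n ^ 8 := by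
    rw [← pow_add]
    exact pow_le_pow_right₀ hn' (by norm_num)
  have h4' : (2 * (Fintype.card (HalfIndex n K) : ℝ)) / (n : ℝ) ^ 8 ≤ 8 / (n : ℝ) ^ 2 := by
    rw [div_le_div_iff₀ (by positivity) (by positivity)]
    nlinarith [mul_le_mul_of_nonneg_right hcard (by positivity : (0 : ℝ) ≤ n ^ 2)]
  have h6' : (4 * (Fintype.card (HalfIndex n K) : ℝ)) / (n : ℝ) ^ 8 ≤ 16 / (n : ℝ) ^ 2 := by
    rw [div_le_div_iff₀ (by positivity) (by positivity)]
    nlinarith [mul_le_mul_of_nonneg_right hcard (by positivity : (0 : ℝ) ≤ n ^ 2)]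
  have h5' : (Fintype.card (Fin K × Fin K) : ℝ) / (n : ℝ) ^ 4 ≤ 1 / (n : ℝ) ^ 2 := by
    rw [div_le_div_iff₀ (by positivity) (by positivity)]
    simp only [Fintype.card_prod, Fintype.card_fin, Nat.cast_mul, one_mul]
    calc (K : ℝ) * K * n ^ 2 ≤ n * n * n ^ 2 := by gcongr
      _ = _ := by ring
  have hunion : prob (edgeProb S) (fun x => ¬ GoodEvent S L (1 / 1000) z P x) ≤
      prob (edgeProb S) (fun x => ¬ DegreeEvent L x) +
      (prob (edgeProb S) (fun x => ¬ DiscrepancyEvent L x) +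
      (prob (edgeProb S) (fun x => ¬ LightEvent S (n * L) x) +
      (prob (edgeProb S) (fun x => ¬ RowSumEvent S L (halfGroup z) (fun i => groupSize z i.1) x) +
      (prob (edgeProb S) (fun x => ¬ LinearEvent S L (1 / 1000)
        (fun (q : Fin K × Fin K) c => P q.2 (z c) - P q.1 (z c)) x) +
      prob (edgeProb S) (fun x => ¬ BilinearEvent S L (1 / 1000) (halfGroup z)
        (fun i => groupSize z i.1) x))))) := by
    refine (prob_mono hp fun x hx => ?_).trans <| (prob_or_le hp _ _).trans <| add_le_add le_rfl <|
      (prob_or_le hp _ _).trans <| add_le_add le_rfl <| (prob_or_le hp _ _).trans <|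
      add_le_add le_rfl <| (prob_or_le hp _ _).trans <| add_le_add le_rfl <| prob_or_le hp _ _
    by_contra hcon
    push Not at hcon
    exact hx ⟨hcon.1, hcon.2.1, hcon.2.2.1, hcon.2.2.2.1, hcon.2.2.2.2.1, hcon.2.2.2.2.2⟩
  have e : (28 : ℝ) / (n : ℝ) ^ 2 = 1 / (n : ℝ) ^ 2 + (1 / (n : ℝ) ^ 2 + (1 / (n : ℝ) ^ 2 +
      (8 / (n : ℝ) ^ 2 + (1 / (n : ℝ) ^ 2 + 16 / (n : ℝ) ^ 2)))) := by ring
  rw [e]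
  refine hunion.trans ?_
  exact add_le_add h1 (add_le_add h2 (add_le_add h3 (add_le_add (h4.trans h4')
    (add_le_add (h5.trans h5') (h6.trans h6')))))

end Main

end SBMClustering

end

open MeasureTheory SBMClustering in
theorem theorem2 :
    ∃ c c' c'' : ℝ, 0 < c ∧ 0 < c' ∧ 0 < c'' ∧
      ∀ (n K : ℕ) (z : Fin n → Fin K) (P : Matrix (Fin K) (Fin K) ℝ) (L α : ℝ)
        (Ω : Type*) [MeasurableSpace Ω] (μ : Measure Ω) [IsProbabilityMeasure μ]
        (g : Ω → SimpleGraph (Fin n)),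
        2 ≤ K →
        IsSBM μ g z P →
        (∀ j k, |P j k| ≤ L) →
        1 / (minGroupSize z : ℝ) ≤ L →
        L ≤ 1 / Real.log n →
        1 / (minGroupSize z : ℝ) ≤ α →
        α ≤ (K : ℝ) ^ 3 / n * Real.exp (4 * n * L) →
        c'' * n / (minGroupSize z : ℝ) ≤ signalSq z P / L →
        1 - c / (n : ℝ) ^ 2 ≤
          μ.real {ω | ∀ zhat : Fin n → Fin K,
            IsClusteringOutput α (adjacency (g ω)) zhat →
              misclassification zhat z ≤ Real.exp (-c' * (signalSq z P / L))} := by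
  refine ⟨28, 1 / 27136000, 10000000000000, by norm_num, by norm_num, by norm_num, ?_⟩
  intro n K z P L α Ω _ μ _ g hK hg hPL hmL _ hα hα' hsig
  have hz := hg.surjective
  have hKn : K ≤ n := by simpa using Fintype.card_le_of_surjective z hz
  have hn : 0 < n := by omega
  have hm0 : (0 : ℝ) < minGroupSize z := by exact_mod_cast minGroupSize_pos hz (by omega)
  have hL : 0 < L := lt_of_lt_of_le (by positivity) hmL
  have hmL' : 1 ≤ (minGroupSize z : ℝ) * L := by
    rw [div_le_iff₀ hm0] at hmL
    linarith
  have hP : ∀ j k, 0 ≤ P j k ∧ P j k ≤ L := fun j k =>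
    ⟨(hg.mem_Icc j k).1, (le_abs_self _).trans (hPL j k)⟩
  have hS : IsProbMatrix (signal z P) L :=
    ⟨fun a b => hg.symm.apply (z b) (z a), fun a b => (hP _ _).1,
      fun a b => (hg.mem_Icc _ _).2, fun a b => (hP _ _).2⟩
  have hmk := minGroupSize_le z
  -- Entries in [0,L] bound any separation by nL²; existence of two distinct groups makes the
  -- minimum one of these.
  have hΔL : signalSq z P / L ≤ n * L := by
    have h01 : (⟨0, by omega⟩ : Fin K) ≠ ⟨1, by omega⟩ := by simp
    rw [div_le_iff₀ hL]
    calc _ ≤ _ := (signalSq_le_sepSq z P h01).trans (sepSq_le hP _ _)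
      _ = _ := by ring
  have hprob := prob_not_goodEvent_le hS hP hn hKn hL hm0 hmk hmL'
  rw [prob_not] at hprob
  refine (sub_le_comm.1 hprob).trans
    ((hg.prob_le _).trans (measureReal_mono fun ω hω zhat hout => ?_))
  have hgood : GoodEvent (signal z P) L (1 / 1000) z P (graphConfig (g ω)) := hω
  rw [← adj_graphConfig] at hout
  have h := hgood.misclassification_le hS hP hn (by omega) hL hm0 hmk hmL' hz hα hα'
    (fun j k => signalSq_le_sepSq z P) hΔL (by rw [← mul_div_assoc]; exact hsig) hout
  refine h.trans (le_of_eq ?_)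
  congr 1
  ring
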